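/- Let $\mathbb F\in\{\mathbb R,\mathbb C,\mathbb K,\mathbb O\}$ (reals, complex numbers, quaternions, octonions), $m\ge 1$, with $m=2$ if $\mathbb F=\mathbb O$, and $n=m\dim_{\mathbb R}\mathbb F\geq 2$. Let $\mathbb H_{\mathbb F}^m$ be the hyperbolic space over $\mathbb F$, of real dimension $n$, modeled on the open unit ball of $\mathbb F^m$ and normalized so that its sectional curvature is $-1$ if $\mathbb F=\mathbb R$, and lies between $-1$ and $-1/4$ with value $-1$ on the $\mathbb F$-lines otherwise. Let $o$ be the origin of the ball. For a hypersurface with unit normal $N$ and shape operator $AX=-\overline\nabla_XN$, the $r$-th mean curvature $H_r$ is the $r$-th elementary symmetric function of the principal curvatures ($H_0=1$); it is an $H_r$-hypersurface if, for a choice of smooth unit normal, its $r$-th mean curvature is constant and equal to $H_r$. Every geodesic sphere $S_s(o)$, $s>0$, oriented by its outward normal, is a smooth hypersurface with constant $k$-th mean curvature $H_k^s$ for all $k\ge0$. Let $1\le r\le n-1$ and let $H_r>0$ be a constant. The limit $C_{\mathbb F}(r):=\lim_{s\to+\infty}|H_r^s|$ exists. Put $a(s)=-r|H_r^s|/|H_{r-1}^s|$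 and $b(s)=rH_r/|H_{r-1}^s|$ for $s>0$. There is a unique $\delta_{H_r}\in(0,+\infty]$ such that, for every $\lambda>0$, one has $\lambda<\delta_{H_r}$ if and only if the solution $\tau$ of $y'=ay+b$ on $(0,+\infty)$ with $\tau(\lambda)=1$ satisfies $\tau'(\lambda)<0$. Then there is a one-parameter family $\{\Sigma(\lambda):\lambda\in(0,\delta_{H_r})\}$ of properly embedded rotational $H_r$-hypersurfaces of $\mathbb H_{\mathbb F}^m\times\mathbb R$ with axis $\{o\}\times\mathbb R$ (that is, each connected component of a transversal horizontal section lies in a geodesic sphere centered at the axis), each homeomorphic to $\mathbb S^{n-1}\times\mathbb R$. The minimal distance of $\Sigma(\lambda)$ to the axis is $\lambda$, and $S_\lambda(o)\times\{0\}\subset\Sigma(\lambda)$. Moreover: (i) If $H_r>C_{\mathbb F}(r)$, each $\Sigma(\lambda)$ is of Delaunay type: there are $T>0$ and a smooth, positive, even, $T$-periodic function $\sigma:\mathbb R\to\mathbb R$, strictly increasing on $[0,T/2]$, with $\sigma(0)=\lambda$, such that $\Sigma(\lambda)$ is invariant under the vertical translation $(x,t)\mapsto(x,t+T)$, and the trajectory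 of the gradient of the height function of $\Sigma(\lambda)$ through any of its points is defined for all times and is an unduloid, namely the curve $\{(\gamma(\sigma(t)),t):t\in\mathbb R\}$ for some unit-speed geodesic ray $\gamma$ of $\mathbb H_{\mathbb F}^m$ issuing from $o$. (ii) If $0<H_r\le C_{\mathbb F}(r)$, each $\Sigma(\lambda)$ is symmetric with respect to $\mathbb H_{\mathbb F}^m\times\{0\}$ and its height function is unbounded above (hence, by symmetry, also below). -/

import Mathlib

open Set Filter Topology MeasureTheory
open scoped ContDiff Quaternion RealInnerProductSpace

/-! ### Riemannian geometry of hypersurfaces in coordinates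

The ambient manifold is an open subset `U` of a finite-dimensional real normed space `V`. A Riemannian
metric is a function `g`, where `g x u v` is the inner product of the vectors `u`, `v` at the
point `x`. -/

section Riemannian

variable {V : Type*} [NormedAddCommGroup V] [NormedSpace ℝ V]

/-- The length of a `C¹` curve on `[0, 1]` with respect to the metric `g`. -/
noncomputable def curveLength (g : V → V → V → ℝ) (c : ℝ → V) : ℝ :=
  ∫ t in (0 : ℝ)..1, Real.sqrt (g (c t) (deriv c t) (deriv c t))

/-- The Riemannian distance of `(U, g)`: the infimum of the lengths of the `C¹` curves in `U`
that join `x` to `y`. -/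
noncomputable def riemDist (g : V → V → V → ℝ) (U : Set V) (x y : V) : ℝ :=
  sInf {L : ℝ | ∃ c : ℝ → V, ContDiff ℝ 1 c ∧ c 0 = x ∧ c 1 = y ∧
    (∀ t ∈ Icc (0 : ℝ) 1, c t ∈ U) ∧ L = curveLength g c}

/-- The geodesic sphere of `(U, g)` with centre `o` and radius `s`. -/
def geodesicSphere (g : V → V → V → ℝ) (U : Set V) (o : V) (s : ℝ) : Set V :=
  {x | x ∈ U ∧ riemDist g U o x = s}

/-- `γ`, restricted to `[0, ∞)`, is a unit-speed minimizing geodesic ray issuing from `o`. -/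
def IsGeodesicRay (g : V → V → V → ℝ) (U : Set V) (o : V) (γ : ℝ → V) : Prop :=
  γ 0 = o ∧ (∀ s, 0 ≤ s → γ s ∈ U) ∧
    ∀ s t, 0 ≤ s → 0 ≤ t → riemDist g U (γ s) (γ t) = |s - t|

/-- The Levi-Civita connection on constant vector fields, by Koszul's formula:
`koszul g x u v w` is `g (∇_u v, w)` at `x` for constant `u`, `v`, `w`. -/
noncomputable def koszul (g : V → V → V → ℝ) (x u v w : V) : ℝ :=
  (fderiv ℝ (fun y => g y v w) x u + fderiv ℝ (fun y => g y u w) x v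
    - fderiv ℝ (fun y => g y u v) x w) / 2

/-- `g (∇_X N, Y)` at `x`, for a vector field `N` and tangent vectors `X`, `Y`. -/
noncomputable def covDerivInner (g : V → V → V → ℝ) (N : V → V) (x X Y : V) : ℝ :=
  g x (fderiv ℝ N x X) Y + koszul g x X (N x) Y

/-- `g (A X, Y)` at `x`, where `A X = -∇_X N` is the shape operator of a hypersurface with unit
normal field `N`. -/
noncomputable def secondFundForm (g : V → V → V → ℝ) (N : V → V) (x X Y : V) : ℝ :=
  -covDerivInner g N x X Y

/-- `S` is an embedded smooth hypersurface of `V`: locally a regular level set. -/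
def IsSmoothHypersurface (S : Set V) : Prop :=
  ∀ p ∈ S, ∃ W : Set V, IsOpen W ∧ p ∈ W ∧ ∃ f : V → ℝ, ContDiffOn ℝ ∞ f W ∧
    (∀ x ∈ W, fderiv ℝ f x ≠ 0) ∧ S ∩ W = {x ∈ W | f x = 0}

/-- `S` is a properly embedded smooth hypersurface of the open set `U`. -/
def IsProperlyEmbedded (U S : Set V) : Prop :=
  S ⊆ U ∧ IsSmoothHypersurface S ∧ IsClosed (Subtype.val ⁻¹' S : Set U)

/-- `N` restricts to a smooth unit normal field along `S`; away from `S` it is an arbitrary local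
smooth extension. -/
def IsUnitNormal (g : V → V → V → ℝ) (S : Set V) (N : V → V) : Prop :=
  ∀ p ∈ S, ContDiffAt ℝ ∞ N p ∧ g p (N p) (N p) = 1 ∧
    ∀ X ∈ tangentConeAt ℝ S p, g p (N p) X = 0

/-- `k` lists, with multiplicity, the principal curvatures at `p` of a hypersurface with unit normal
field `N`: there is an orthonormal basis `e` of the tangent space (the orthogonal complement of
`N p`) with `A (e i) = k i • e i`. -/
def IsPrincipalCurvatures (g : V → V → V → ℝ) (N : V → V) (p : V)
    (k : Fin (Module.finrank ℝ V - 1) → ℝ) : Prop :=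
  ∃ e : Fin (Module.finrank ℝ V - 1) → V,
    (∀ i j, g p (e i) (e j) = if i = j then 1 else 0) ∧
    (∀ i, g p (e i) (N p) = 0) ∧
    ∀ i j, secondFundForm g N p (e i) (e j) = if i = j then k i else 0

/-- The `r`-th (non-normalized) mean curvature at `p`, the `r`-th elementary symmetric function of
the principal curvatures, equals `H`. -/
def HasMeanCurvature (g : V → V → V → ℝ) (N : V → V) (p : V) (r : ℕ) (H : ℝ) : Prop :=
  ∃ k : Fin (Module.finrank ℝ V - 1) → ℝ, IsPrincipalCurvatures g N p k ∧
    H = ∑ I ∈ Finset.powersetCard r Finset.univ, ∏ i ∈ I, k i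

/-- `S` is an oriented hypersurface whose `r`-th mean curvature is constant and equal to `H`. -/
def IsHrHypersurface (g : V → V → V → ℝ) (S : Set V) (r : ℕ) (H : ℝ) : Prop :=
  IsSmoothHypersurface S ∧
    ∃ N : V → V, IsUnitNormal g S N ∧ ∀ p ∈ S, HasMeanCurvature g N p r H

/-- The geodesic sphere with centre `o` and radius `s` is a smooth hypersurface and, for its outward
orientation, its `r`-th mean curvature is constant and equal to `h`. -/
def IsSphereMeanCurv (g : V → V → V → ℝ) (U : Set V) (o : V) (r : ℕ) (s h : ℝ) : Prop :=
  IsSmoothHypersurface (geodesicSphere g U o s) ∧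
    ∃ N : V → V, IsUnitNormal g (geodesicSphere g U o s) N ∧
      ∀ p ∈ geodesicSphere g U o s,
        (∀ᶠ t : ℝ in 𝓝[>] 0, s < riemDist g U o (p + t • N p)) ∧ HasMeanCurvature g N p r h

/-! ### Hypersurfaces of the product `M × ℝ`, `M = (U, g)` -/

/-- The product metric `g + dt²`. -/
def prodMetric (g : V → V → V → ℝ) (p X Y : V × ℝ) : ℝ :=
  g p.1 X.1 Y.1 + X.2 * Y.2

/-- The section of `S` at height `t`, as a subset of `M`. -/
def horizontalSection (S : Set (V × ℝ)) (t : ℝ) : Set V := {x | (x, t) ∈ S}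

/-- `S` meets the horizontal hyperplane at height `t` transversally. -/
def IsTransversalAt (S : Set (V × ℝ)) (t : ℝ) : Prop :=
  ∀ x, (x, t) ∈ S → ∃ X ∈ tangentConeAt ℝ S (x, t), X.2 ≠ 0

/-- `S` is rotational with axis `{o} × ℝ`: the connected components of its (transversal) horizontal
sections lie in geodesic spheres centred at the axis. -/
def IsRotational (g : V → V → V → ℝ) (U : Set V) (o : V) (S : Set (V × ℝ)) : Prop :=
  ∀ t, IsTransversalAt S t → ∀ x ∈ horizontalSection S t,
    ∃ s > 0, connectedComponentIn (horizontalSection S t) x ⊆ geodesicSphere g U o s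

/-- `G` is the gradient at `p ∈ S` of the height function `(x, t) ↦ t` of `S`. -/
def IsHeightGradient (g : V → V → V → ℝ) (S : Set (V × ℝ)) (p G : V × ℝ) : Prop :=
  G ∈ tangentConeAt ℝ S p ∧ ∀ X ∈ tangentConeAt ℝ S p, prodMetric g p G X = X.2

/-- `c` is a (complete) integral curve of the gradient of the height function of `S`. -/
def IsHeightTrajectory (g : V → V → V → ℝ) (S : Set (V × ℝ)) (c : ℝ → V × ℝ) : Prop :=
  ∀ u, c u ∈ S ∧ ∃ G, IsHeightGradient g S (c u) G ∧ HasDerivAt c G u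

/-- `σ` is the profile of an unduloid with period `T`: a smooth positive periodic function, with one
minimum (at `0`) and one maximum (at `T / 2`) in each period and symmetric about both. -/
def IsUnduloidProfile (σ : ℝ → ℝ) (T : ℝ) : Prop :=
  ContDiff ℝ ∞ σ ∧ 0 < T ∧ (∀ t, 0 < σ t) ∧ Function.Periodic σ T ∧ Function.Even σ ∧
    StrictMonoOn σ (Icc 0 (T / 2))

/-- `S` is of Delaunay type about the axis `{o} × ℝ`, with neck radius `l`: it is invariant under a
vertical translation, and every trajectory of the gradient of its height function is an unduloid
about the axis, drawn in the vertical half-plane over a geodesic ray issuing from `o`. -/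
def IsDelaunayType (g : V → V → V → ℝ) (U : Set V) (o : V) (l : ℝ) (S : Set (V × ℝ)) : Prop :=
  ∃ T > 0, (∀ x t, (x, t + T) ∈ S ↔ (x, t) ∈ S) ∧
    ∃ σ : ℝ → ℝ, IsUnduloidProfile σ T ∧ σ 0 = l ∧
      ∀ p ∈ S, ∃ c : ℝ → V × ℝ, IsHeightTrajectory g S c ∧ c 0 = p ∧
        ∃ γ : ℝ → V, IsGeodesicRay g U o γ ∧ range c = range fun t => (γ (σ t), t)

/-- `S` is symmetric with respect to the horizontal hyperplane at height `0`. -/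
def IsSymmetricZero (S : Set (V × ℝ)) : Prop :=
  ∀ x t, (x, t) ∈ S ↔ (x, -t) ∈ S

end Riemannian

/-! ### The hyperbolic spaces -/

/-- The octonions, as the Cayley-Dickson double of the quaternions, with their Euclidean norm. -/
def Octonion : Type := WithLp 2 (ℍ[ℝ] × ℍ[ℝ])

noncomputable instance : NormedAddCommGroup Octonion :=
  inferInstanceAs (NormedAddCommGroup (WithLp 2 (ℍ[ℝ] × ℍ[ℝ])))

noncomputable instance : InnerProductSpace ℝ Octonion :=
  inferInstanceAs (InnerProductSpace ℝ (WithLp 2 (ℍ[ℝ] × ℍ[ℝ])))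

/-- `(a, b) (c, d) = (a c - d̄ b, d a + b c̄)`. -/
noncomputable instance : Mul Octonion where
  mul x y := (WithLp.toLp 2 (x.fst * y.fst - star y.snd * x.snd,
    y.snd * x.fst + x.snd * star y.fst) : WithLp 2 (ℍ[ℝ] × ℍ[ℝ]))

/-- The conjugate of `(a, b)` is `(ā, -b)`. -/
noncomputable instance : Star Octonion where
  star x := (WithLp.toLp 2 (star x.fst, -x.snd) : WithLp 2 (ℍ[ℝ] × ℍ[ℝ]))

/-- The four normed division algebras. -/
inductive HypAlg : Type
  | real
  | complex
  | quaternion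
  | octonion

namespace HypAlg

/-- The underlying real vector space. -/
def Carrier : HypAlg → Type
  | real => ℝ
  | complex => ℂ
  | quaternion => ℍ[ℝ]
  | octonion => Octonion

noncomputable instance : (A : HypAlg) → NormedAddCommGroup A.Carrier
  | real => inferInstanceAs (NormedAddCommGroup ℝ)
  | complex => inferInstanceAs (NormedAddCommGroup ℂ)
  | quaternion => inferInstanceAs (NormedAddCommGroup ℍ[ℝ])
  | octonion => inferInstanceAs (NormedAddCommGroup Octonion)

noncomputable instance : (A : HypAlg) → InnerProductSpace ℝ A.Carrier
  | real => inferInstanceAs (InnerProductSpace ℝ ℝ)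
  | complex => inferInstanceAs (InnerProductSpace ℝ ℂ)
  | quaternion => inferInstanceAs (InnerProductSpace ℝ ℍ[ℝ])
  | octonion => inferInstanceAs (InnerProductSpace ℝ Octonion)

noncomputable instance : (A : HypAlg) → Mul A.Carrier
  | real => inferInstanceAs (Mul ℝ)
  | complex => inferInstanceAs (Mul ℂ)
  | quaternion => inferInstanceAs (Mul ℍ[ℝ])
  | octonion => inferInstanceAs (Mul Octonion)

noncomputable instance : (A : HypAlg) → Star A.Carrier
  | real => inferInstanceAs (Star ℝ)
  | complex => inferInstanceAs (Star ℂ)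
  | quaternion => inferInstanceAs (Star ℍ[ℝ])
  | octonion => inferInstanceAs (Star Octonion)

/-- The real dimension. -/
def dim : HypAlg → ℕ
  | real => 1
  | complex => 2
  | quaternion => 4
  | octonion => 8

/-- The factor that normalizes the metric: the sectional curvature is `-1` for `ℝ`, and otherwise it
lies between `-1` and `-1/4`, with the value `-1` on the `𝔽`-lines. -/
def scale : HypAlg → ℝ
  | real => 1
  | _ => 4

end HypAlg

/-- The space `𝔽^m` with its Euclidean norm. -/
abbrev FSpace (A : HypAlg) (m : ℕ) : Type := PiLp 2 fun _ : Fin m => A.Carrier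

/-- The unit ball of `𝔽^m`, on which the hyperbolic space is modeled. -/
def hypBall (A : HypAlg) (m : ℕ) : Set (FSpace A m) := Metric.ball 0 1

/-- The metric of the hyperbolic space at `z` in the unit ball of `𝔽^m`,
`scale * (⟨u, v⟩ / (1 - |z|²) + ∑ i j, Re ((z j z̄ i) (u i v̄ j)) / (1 - |z|²)²)`, where
`Re (a b̄) = ⟨a, b⟩`. If `𝔽` is associative, the last sum is the real part of
`(∑ i, z̄ i u i) (∑ j, v̄ j z j)`; in all cases its value at `u = v` is `|z|²` times the squared norm of
the orthogonal projection of `u` to the `𝔽`-line through `0` and `z`. -/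
noncomputable def hypMetric (A : HypAlg) (m : ℕ) (z u v : FSpace A m) : ℝ :=
  A.scale * (⟪u, v⟫ / (1 - ‖z‖ ^ 2) +
    (∑ i, ∑ j, ⟪z j * star (z i), v j * star (u i)⟫) / (1 - ‖z‖ ^ 2) ^ 2)

/-- The `r`-th mean curvature `H_r^s` of the outward oriented geodesic sphere of radius `s` centred at
the origin of the hyperbolic space. -/
noncomputable def sphereMeanCurv (A : HypAlg) (m r : ℕ) (s : ℝ) : ℝ :=
  Classical.epsilon fun h => IsSphereMeanCurv (hypMetric A m) (hypBall A m) 0 r s h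

/-- The constant `C_𝔽(r)`: the limit of `|H_r^s|` as `s → ∞`. -/
noncomputable def limitMeanCurv (A : HypAlg) (m r : ℕ) : ℝ :=
  limUnder atTop fun s : ℝ => |sphereMeanCurv A m r s|

/-- The coefficient `a(s) = -r |H_r^s| / |H_{r-1}^s|`. -/
noncomputable def coeffA (A : HypAlg) (m r : ℕ) (s : ℝ) : ℝ :=
  -(r * |sphereMeanCurv A m r s| / |sphereMeanCurv A m (r - 1) s|)

/-- The coefficient `b(s) = r H / |H_{r-1}^s|`. -/
noncomputable def coeffB (A : HypAlg) (m r : ℕ) (H s : ℝ) : ℝ :=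
  r * H / |sphereMeanCurv A m (r - 1) s|

/-- The solution `τ` of `y' = a y + b` on `(0, ∞)` with `τ(l) = 1` has `τ'(l) < 0`. -/
def IsNeckRadius (A : HypAlg) (m r : ℕ) (H l : ℝ) : Prop :=
  0 < l ∧ ∃ τ : ℝ → ℝ, (∀ s, 0 < s → HasDerivAt τ (coeffA A m r s * τ s + coeffB A m r H s) s) ∧
    τ l = 1 ∧ deriv τ l < 0

/-- The supremum `δ_H ∈ (0, ∞]` of the neck radii. -/
noncomputable def neckBound (A : HypAlg) (m r : ℕ) (H : ℝ) : EReal :=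
  sSup ((fun l : ℝ => (l : EReal)) '' {l | IsNeckRadius A m r H l})

/-!
All the hypersurfaces are tubes `{(x, t) | ‖x‖ = tanh (σ t / κ)}`: the section at height `t` is
the geodesic sphere of radius `σ t` about the origin. Write `E_k s = |H_k^s|` for the mean
curvatures of the sphere of radius `s`. The principal curvatures of the tube at height `t` are
those of the sphere, multiplied by the cosine `c = (1 + σ'²)^(-1/2)` of the angle between the
profile and the axis, and the curvature `-σ'' c³` of the profile, so the tube has `r`-th mean
curvature `H` if and only if `H = c^r E_r(σ) - σ'' c³ c^(r-1) E_{r-1}(σ)`.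

The solution `τ` of `τ' = -(r E_r / E_{r-1}) τ + r H / E_{r-1}` with `τ(λ) = 1` is a first
integral of this second order equation, which holds along a nonconstant curve with `c^r = τ(σ)`.
Hence `σ'² = G(σ)` with `G = τ^(-2/r) - 1`, the function `profilePotential`, and the profile
solves the Newton equation `σ'' = G'(σ) / 2`, with `σ 0 = λ`, `σ' 0 = 0`. Since `τ'(λ) = r (H -
E_r(λ)) / E_{r-1}(λ)`, the sign condition on `τ'(λ)` says that `H < E_r(λ)`; as `E_r` decreases
continuously from `∞` to `C`, the admissible radii form an interval `(0, δ)`. The condition makes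
`λ` a simple zero of `G`, just beyond which `G` is positive. If `H > C`, then `τ` returns to the
value `1`, transversally (`IsTau.exists_return`), so `G` has a second simple zero and `σ`
oscillates periodically between the two. If `H ≤ C`, then `τ < 1` on `(λ, ∞)`, and `G` is bounded
there because `τ ≥ H / E_r(λ)`, so the profile, obtained by quadrature, is defined on all of `ℝ`.
Both cases are in `exists_profile`.

On the geometric side only few properties of the metric matter, and they are collected in
`IsLineForm`: the metric is `κ² (⟪u, v⟫ / (1 - ‖z‖²) + Q_z(u, v) / (1 - ‖z‖²)²)`, where `Q_z` is
`‖z‖²` times the orthogonal projection to the `𝔽`-line of `z`, with some control of its derivative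
in `z`. The principal curvatures of the spheres follow from Koszul's formula
(`exists_principal_basis`). Distances to the origin are computed by comparing a curve with its
projection to a ray (`riemDist_ray`). That the projection to the `𝔽`-line defines an `IsLineForm`
is a consequence of the identities of `IsHurwitz`, which hold in the four algebras, and of a
substitute for associativity, `IsHurwitz.IsTriple`, which for the octonions holds in dimension two
by alternativity alone.
-/

/-! ### First order linear equations on the half-line -/

section LinearODE

/-- `y' = c y + d` has a solution on `(0, ∞)` with prescribed value at `l > 0`, by variation of
constants. -/
theorem exists_linear_ode {c d : ℝ → ℝ} (hc : ContinuousOn c (Ioi 0)) (hd : ContinuousOn d (Ioi 0))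
    {l : ℝ} (hl : 0 < l) (y₀ : ℝ) :
    ∃ y : ℝ → ℝ, (∀ s, 0 < s → HasDerivAt y (c s * y s + d s) s) ∧ y l = y₀ := by
  have key : ∀ {f : ℝ → ℝ}, ContinuousOn f (Ioi 0) → ∀ s, 0 < s →
      HasDerivAt (fun x => ∫ t in l..x, f t) (f s) s := by
    intro f hf s hs
    have hsub : uIcc l s ⊆ Ioi 0 := fun x hx => lt_of_lt_of_le (lt_min hl hs) hx.1
    exact intervalIntegral.integral_hasDerivAt_right
      ((hf.mono hsub).intervalIntegrable)
      (hf.stronglyMeasurableAtFilter isOpen_Ioi s hs) (hf.continuousAt (Ioi_mem_nhds hs))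
  set E : ℝ → ℝ := fun x => ∫ t in l..x, c t with hE
  have hE' := key hc
  have hf : ContinuousOn (fun s => d s * Real.exp (-E s)) (Ioi 0) :=
    hd.mul (Real.continuous_exp.comp_continuousOn
      (fun s hs => (hE' s hs).continuousAt.continuousWithinAt.neg))
  refine ⟨fun s => Real.exp (E s) * (y₀ + ∫ t in l..s, d t * Real.exp (-E t)), ?_, by simp [hE]⟩
  intro s hs
  have h := (hE' s hs).exp.mul ((key hf s hs).const_add y₀)
  refine h.congr_deriv ?_
  have : Real.exp (E s) * Real.exp (-E s) = 1 := by rw [← Real.exp_add]; simp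
  linear_combination (d s) * this

/-- Bootstrapping: a solution of a linear equation with smooth coefficients is smooth. -/
theorem contDiffOn_of_linear_ode {c d y : ℝ → ℝ} (hc : ContDiffOn ℝ ∞ c (Ioi 0))
    (hd : ContDiffOn ℝ ∞ d (Ioi 0)) (hy : ∀ s, 0 < s → HasDerivAt y (c s * y s + d s) s) :
    ContDiffOn ℝ ∞ y (Ioi 0) := by
  rw [contDiffOn_infty]
  intro n
  induction n with
  | zero => exact contDiffOn_zero.2 fun s hs => (hy s hs).continuousAt.continuousWithinAt
  | succ n ih =>
    have : ((n + 1 : ℕ) : WithTop ℕ∞) = (n : WithTop ℕ∞) + 1 := by norm_cast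
    rw [this, contDiffOn_succ_iff_deriv_of_isOpen isOpen_Ioi]
    refine ⟨fun s hs => (hy s hs).differentiableAt.differentiableWithinAt, by simp, ?_⟩
    have h2 : ContDiffOn ℝ n (fun s => c s * y s + d s) (Ioi 0) :=
      ((hc.of_le (by exact_mod_cast le_top)).mul ih).add (hd.of_le (by exact_mod_cast le_top))
    exact h2.congr fun s hs => (hy s hs).deriv

/-- If `y' = c y + f` with `f ≥ 0` on `(l, u)` and `y l ≥ 0`, then `y u ≥ 0`; if moreover `f > 0` on
`(l, u)`, then `y u > 0`. -/
theorem nonneg_of_linear_ode {c f y : ℝ → ℝ} (hc : ContinuousOn c (Ioi 0)) {l u : ℝ}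
    (hl : 0 < l) (hlu : l < u) (hy : ∀ s, 0 < s → HasDerivAt y (c s * y s + f s) s)
    (hyl : 0 ≤ y l) :
    ((∀ s ∈ Ioo l u, 0 ≤ f s) → 0 ≤ y u) ∧ ((∀ s ∈ Ioo l u, 0 < f s) → 0 < y u) := by
  obtain ⟨E, hE, hEl⟩ := exists_linear_ode (c := fun _ => 0) (d := c) continuousOn_const hc hl 0
  simp only [zero_mul, zero_add] at hE
  have hD : ∀ s, 0 < s → HasDerivAt (fun s => Real.exp (-E s) * y s) (Real.exp (-E s) * f s) s := by
    intro s hs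
    refine ((hE s hs).neg.exp.mul (hy s hs)).congr_deriv ?_
    simp only [Pi.neg_apply]
    ring
  have hcont : ContinuousOn (fun s => Real.exp (-E s) * y s) (Icc l u) := fun s hs =>
    (hD s (hl.trans_le hs.1)).continuousAt.continuousWithinAt
  have hl0 : 0 ≤ Real.exp (-E l) * y l := by positivity
  constructor
  · intro hf
    have := monotoneOn_of_deriv_nonneg (convex_Icc l u) hcont
      (by
        rw [interior_Icc]
        exact fun s hs => (hD s (hl.trans hs.1)).differentiableAt.differentiableWithinAt)
      (by
        rw [interior_Icc]
        intro s hs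
        rw [(hD s (hl.trans hs.1)).deriv]
        have := hf s hs
        positivity)
    have h := this (left_mem_Icc.2 hlu.le) (right_mem_Icc.2 hlu.le) hlu.le
    exact (mul_nonneg_iff_of_pos_left (Real.exp_pos _)).1 (hl0.trans h)
  · intro hf
    have := strictMonoOn_of_deriv_pos (convex_Icc l u) hcont
      (by
        rw [interior_Icc]
        intro s hs
        rw [(hD s (hl.trans hs.1)).deriv]
        have := hf s hs
        positivity)
    have h := this (left_mem_Icc.2 hlu.le) (right_mem_Icc.2 hlu.le) hlu
    exact (mul_pos_iff_of_pos_left (Real.exp_pos _)).1 (hl0.trans_lt h)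

end LinearODE

/-! ### Autonomous equations solved by quadrature -/

section Quadrature

/-- A solution of `σ'' = f(σ)` with `f` smooth near its values is smooth. -/
theorem contDiff_of_second_order {f σ v : ℝ → ℝ} {I : Set ℝ}
    (hf : ContDiffOn ℝ ∞ f I) (hσI : ∀ t, σ t ∈ I) (h1 : ∀ t, HasDerivAt σ (v t) t)
    (h2 : ∀ t, HasDerivAt v (f (σ t)) t) : ContDiff ℝ ∞ σ := by
  have e1 : deriv σ = v := funext fun t => (h1 t).deriv
  have e2 : deriv v = fun t => f (σ t) := funext fun t => (h2 t).deriv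
  have key : ∀ n : ℕ, ContDiff ℝ n σ ∧ ContDiff ℝ n v := by
    intro n
    induction n with
    | zero =>
      exact ⟨contDiff_zero.2 (continuous_iff_continuousAt.2 fun t => (h1 t).continuousAt),
        contDiff_zero.2 (continuous_iff_continuousAt.2 fun t => (h2 t).continuousAt)⟩
    | succ n ih =>
      have : ((n + 1 : ℕ) : WithTop ℕ∞) = (n : WithTop ℕ∞) + 1 := by norm_cast
      rw [this, contDiff_succ_iff_deriv, contDiff_succ_iff_deriv, e1, e2]
      refine ⟨⟨fun t => (h1 t).differentiableAt, by simp, ih.2⟩,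
        ⟨fun t => (h2 t).differentiableAt, by simp, ?_⟩⟩
      rw [← contDiffOn_univ]
      exact (hf.of_le (by exact_mod_cast le_top)).comp ih.1.contDiffOn fun t _ => hσI t
  exact contDiff_infty.2 fun n => (key n).1

/-- A change of parameter: if `h > 0` is continuous and bounded below near infinity, then
`θ ↦ ∫₀^θ h` has a global inverse, with derivative `1 / h`. -/
theorem exists_inverse_integral {h : ℝ → ℝ} (hh : Continuous h) (hpos : ∀ x, 0 < h x) {c : ℝ}
    (hc : 0 < c) (hbd : ∀ x, 1 ≤ |x| → c ≤ h x) :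
    ∃ ψ : ℝ → ℝ, Continuous ψ ∧ (∀ x, ψ (∫ t in (0 : ℝ)..x, h t) = x) ∧
      (∀ t, ∫ x in (0 : ℝ)..(ψ t), h x = t) ∧ StrictMono ψ ∧
      ∀ t, HasDerivAt ψ (h (ψ t))⁻¹ t := by
  set F : ℝ → ℝ := fun x => ∫ t in (0 : ℝ)..x, h t with hF
  have hF' : ∀ x, HasDerivAt F (h x) x := fun x =>
    intervalIntegral.integral_hasDerivAt_right (hh.intervalIntegrable _ _)
      (hh.stronglyMeasurableAtFilter _ _) hh.continuousAt
  have hFc : Continuous F := continuous_iff_continuousAt.2 fun x => (hF' x).continuousAt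
  have hmono : StrictMono F := strictMono_of_deriv_pos fun x => by
    rw [(hF' x).deriv]; exact hpos x
  have hcomp : ∀ x y, x ≤ y → (∀ z ∈ Ioo x y, 1 ≤ |z|) → c * (y - x) ≤ F y - F x := by
    intro x y hxy hz
    have hm : MonotoneOn (fun z => F z - c * z) (Icc x y) := by
      refine monotoneOn_of_deriv_nonneg (convex_Icc x y) (by fun_prop) ?_ ?_
      · intro z _
        exact ((hF' z).sub ((hasDerivAt_id z).const_mul c)).differentiableAt.differentiableWithinAt
      · rw [interior_Icc]
        intro z hz'
        have : HasDerivAt (fun z => F z - c * z) (h z - c * 1) z :=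
          (hF' z).sub ((hasDerivAt_id z).const_mul c)
        rw [this.deriv]
        linarith [hbd z (hz z hz')]
    have := hm (left_mem_Icc.2 hxy) (right_mem_Icc.2 hxy) hxy
    simp only at this
    linarith
  have htop : Tendsto F atTop atTop := by
    refine tendsto_atTop_mono' (f₁ := fun x => F 1 + c * (x - 1)) atTop ?_ ?_
    · filter_upwards [eventually_ge_atTop 1] with x hx
      have := hcomp 1 x hx fun z hz => by rw [abs_of_pos (by linarith [hz.1])]; exact hz.1.le
      linarith
    · exact tendsto_atTop_add_const_left _ _
        ((tendsto_atTop_add_const_right _ _ tendsto_id).const_mul_atTop hc)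
  have hbot : Tendsto F atBot atBot := by
    suffices hle : F ≤ᶠ[atBot] fun x => F (-1) + c * (x + 1) from
      tendsto_atBot_mono' atBot hle (tendsto_atBot_add_const_left _ _
        ((tendsto_atBot_add_const_right _ _ tendsto_id).const_mul_atBot hc))
    · filter_upwards [eventually_le_atBot (-1)] with x hx
      have := hcomp x (-1) hx fun z hz => by
        rw [abs_of_neg (by linarith [hz.2])]; linarith [hz.2]
      linarith
  have hsurj : Function.Surjective F := hFc.surjective htop hbot
  let e : ℝ ≃o ℝ := hmono.orderIsoOfSurjective F hsurj
  have heF : ∀ x, e x = F x := fun x => rfl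
  have hec : Continuous e.symm := e.symm.continuous
  refine ⟨e.symm, hec, fun x => e.symm_apply_apply x, fun t => e.apply_symm_apply t,
    e.symm.strictMono, fun t => ?_⟩
  exact HasDerivAt.of_local_left_inverse hec.continuousAt (hF' _) (hpos _).ne'
    (Eventually.of_forall fun t => e.apply_symm_apply t)

/-- A local form of `hasDerivAt_of_hasDerivAt_of_ne`. -/
theorem hasDerivAt_of_eventually_hasDerivAt {f g : ℝ → ℝ} {x : ℝ}
    (hd : ∀ᶠ y in 𝓝[≠] x, HasDerivAt f (g y) y) (hf : ContinuousAt f x)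
    (hg : ContinuousAt g x) : HasDerivAt f (g x) x := by
  have hr : ∀ᶠ y in 𝓝[>] x, HasDerivAt f (g y) y :=
    hd.filter_mono (nhdsWithin_mono _ fun y hy => ne_of_gt hy)
  have hl : ∀ᶠ y in 𝓝[<] x, HasDerivAt f (g y) y :=
    hd.filter_mono (nhdsWithin_mono _ fun y hy => ne_of_lt hy)
  have A : HasDerivWithinAt f (g x) (Ici x) x :=
    hasDerivWithinAt_Ici_of_tendsto_deriv
      (fun y hy => DifferentiableAt.differentiableWithinAt (HasDerivAt.differentiableAt hy))
      hf.continuousWithinAt hr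
      ((hg.tendsto.mono_left nhdsWithin_le_nhds).congr' (hr.mono fun y hy => hy.deriv.symm))
  have B : HasDerivWithinAt f (g x) (Iic x) x :=
    hasDerivWithinAt_Iic_of_tendsto_deriv
      (fun y hy => DifferentiableAt.differentiableWithinAt (HasDerivAt.differentiableAt hy))
      hf.continuousWithinAt hl
      ((hg.tendsto.mono_left nhdsWithin_le_nhds).congr' (hl.mono fun y hy => hy.deriv.symm))
  simpa using B.union A

/-- Newton's equation by quadrature. If `S` parametrizes the range of a motion with
`S'² = h² G(S)`, `h > 0`, then the reparametrization `σ` of `S` by `t = ∫ h` is a smooth solution of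
`σ'² = G(σ)`, `σ'' = G'(σ) / 2`. -/
theorem newton_of_quadrature {G S S' h ψ : ℝ → ℝ} {I : Set ℝ} (hI : IsOpen I)
    (hG : ContDiffOn ℝ ∞ G I) (hSI : ∀ x, S x ∈ I) (hS : ∀ x, HasDerivAt S (S' x) x)
    (hS'c : Continuous S')
    (hS'0 : ∀ x, ∀ᶠ y in 𝓝[≠] x, S' y ≠ 0) (hh : Continuous h)
    (hpos : ∀ x, 0 < h x) (hEq : ∀ x, S' x ^ 2 = h x ^ 2 * G (S x)) (hψc : Continuous ψ)
    (hψm : StrictMono ψ) (hψ : ∀ t, HasDerivAt ψ (h (ψ t))⁻¹ t) :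
    ContDiff ℝ ∞ (fun t => S (ψ t)) ∧
      (∀ t, deriv (fun t => S (ψ t)) t ^ 2 = G (S (ψ t))) ∧
      ∀ t, deriv (deriv fun t => S (ψ t)) t = deriv G (S (ψ t)) / 2 := by
  set σ : ℝ → ℝ := fun t => S (ψ t) with hσ
  set v : ℝ → ℝ := fun t => S' (ψ t) * (h (ψ t))⁻¹ with hv
  have h1 : ∀ t, HasDerivAt σ (v t) t := fun t => (hS (ψ t)).comp t (hψ t)
  have hvc : Continuous v := (hS'c.comp hψc).mul ((hh.comp hψc).inv₀ fun t => (hpos _).ne')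
  have hσc : Continuous σ := continuous_iff_continuousAt.2 fun t => (h1 t).continuousAt
  have hv2 : ∀ t, v t ^ 2 = G (σ t) := fun t => by
    have := hEq (ψ t)
    have hp := (hpos (ψ t)).ne'
    simp only [hv, hσ, mul_pow, this]
    field_simp
  have hG1 : ∀ t, HasDerivAt G (deriv G (σ t)) (σ t) := fun t =>
    ((hG.contDiffAt (hI.mem_nhds (hSI _))).differentiableAt (by simp)).hasDerivAt
  -- away from the zeros of the velocity, `v = ±√(G ∘ σ)` is differentiable
  have hne : ∀ t, v t ≠ 0 → HasDerivAt v (deriv G (σ t) / 2) t := by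
    intro t ht
    have hd : HasDerivAt (fun t => G (σ t)) (deriv G (σ t) * v t) t := (hG1 t).comp t (h1 t)
    have hGt : G (σ t) ≠ 0 := by rw [← hv2]; exact pow_ne_zero 2 ht
    have hs := hd.sqrt hGt
    have habs : √(G (σ t)) = |v t| := by rw [← hv2, Real.sqrt_sq_eq_abs]
    rcases lt_or_gt_of_ne ht with hneg | hposv
    · have hev : v =ᶠ[𝓝 t] fun t => -√(G (σ t)) := by
        filter_upwards [hvc.continuousAt.eventually_lt continuousAt_const hneg] with x hx
        rw [← hv2, Real.sqrt_sq_eq_abs, abs_of_neg hx, neg_neg]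
      refine (hs.neg.congr_of_eventuallyEq hev).congr_deriv ?_
      rw [habs, abs_of_neg hneg]
      field_simp
    · have hev : v =ᶠ[𝓝 t] fun t => √(G (σ t)) := by
        filter_upwards [continuousAt_const.eventually_lt hvc.continuousAt hposv] with x hx
        rw [← hv2, Real.sqrt_sq_eq_abs, abs_of_pos hx]
      refine (hs.congr_of_eventuallyEq hev).congr_deriv ?_
      rw [habs, abs_of_pos hposv]
      field_simp
  have hG'c : ContDiffOn ℝ ∞ (fun s => deriv G s / 2) I :=
    ((contDiffOn_infty_iff_deriv_of_isOpen hI).1 hG).2.div_const 2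
  have hac : Continuous fun t => deriv G (σ t) / 2 := by
    rw [← continuousOn_univ]
    exact hG'c.continuousOn.comp hσc.continuousOn fun t _ => hSI _
  -- the zeros are isolated, and the derivative extends continuously across them
  have h2 : ∀ t, HasDerivAt v (deriv G (σ t) / 2) t := by
    intro t
    obtain ⟨ε, hε, hball⟩ := Metric.eventually_nhds_iff.1 (eventually_nhdsWithin_iff.1 (hS'0 (ψ t)))
    have hev : ∀ᶠ y in 𝓝 t, y ≠ t → v y ≠ 0 := by
      filter_upwards [hψc.continuousAt.eventually (Metric.ball_mem_nhds (ψ t) hε)] with y hy hyt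
      exact mul_ne_zero (hball hy fun h => hyt (hψm.injective h)) (inv_ne_zero (hpos _).ne')
    refine hasDerivAt_of_eventually_hasDerivAt (g := fun t => deriv G (σ t) / 2) ?_
      hvc.continuousAt hac.continuousAt
    filter_upwards [eventually_nhdsWithin_iff.2 hev] with y hy using hne y hy
  have e1 : deriv σ = v := funext fun t => (h1 t).deriv
  refine ⟨contDiff_of_second_order hG'c (fun t => hSI _) h1 h2, fun t => ?_, fun t => ?_⟩
  · rw [e1]; exact hv2 t
  · rw [e1]; exact (h2 t).deriv

end Quadrature

/-! ### The profile equation -/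

section Profile

/-- The properties of the functions `E₁ s = |H_r^s|`, `E₀ s = |H_{r-1}^s|` on which the profile
depends; `C` is the limit of `E₁`. -/
structure IsCurvaturePair (E₁ E₀ : ℝ → ℝ) (C : ℝ) : Prop where
  smooth₁ : ContDiffOn ℝ ∞ E₁ (Ioi 0)
  smooth₀ : ContDiffOn ℝ ∞ E₀ (Ioi 0)
  pos₁ : ∀ s, 0 < s → 0 < E₁ s
  pos₀ : ∀ s, 0 < s → 0 < E₀ s
  anti₁ : StrictAntiOn E₁ (Ioi 0)
  anti₀ : AntitoneOn E₀ (Ioi 0)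
  tendsto₁ : Tendsto E₁ atTop (𝓝 C)

/-- `τ` solves `τ' = -(r E₁ / E₀) τ + r H / E₀` on `(0, ∞)` with `τ l = 1`. -/
structure IsTau (E₁ E₀ : ℝ → ℝ) (r : ℕ) (H l : ℝ) (τ : ℝ → ℝ) : Prop where
  ode : ∀ s, 0 < s → HasDerivAt τ (-(r * E₁ s / E₀ s) * τ s + r * H / E₀ s) s
  init : τ l = 1

variable {E₁ E₀ τ : ℝ → ℝ} {C H l : ℝ} {r : ℕ}

namespace IsCurvaturePair

theorem limit_lt (h : IsCurvaturePair E₁ E₀ C) {s : ℝ} (hs : 0 < s) : C < E₁ s := by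
  have h1 : E₁ (s + 1) < E₁ s := h.anti₁ hs (by simp; linarith) (by linarith)
  refine lt_of_le_of_lt (le_of_tendsto h.tendsto₁ ?_) h1
  filter_upwards [eventually_ge_atTop (s + 1)] with x hx
  exact h.anti₁.antitoneOn (by simp; linarith) (by simp; linarith) hx

theorem smooth_coeffs (h : IsCurvaturePair E₁ E₀ C) (r : ℕ) (H : ℝ) :
    ContDiffOn ℝ ∞ (fun s => -(r * E₁ s / E₀ s)) (Ioi 0) ∧
      ContDiffOn ℝ ∞ (fun s => r * H / E₀ s) (Ioi 0) :=
  ⟨((contDiffOn_const.mul h.smooth₁).div h.smooth₀ fun s hs => (h.pos₀ s hs).ne').neg,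
    contDiffOn_const.div h.smooth₀ fun s hs => (h.pos₀ s hs).ne'⟩

theorem exists_tau (h : IsCurvaturePair E₁ E₀ C) (r : ℕ) (H : ℝ) (hl : 0 < l) :
    ∃ τ, IsTau E₁ E₀ r H l τ := by
  obtain ⟨y, hy, hyl⟩ := exists_linear_ode (h.smooth_coeffs r H).1.continuousOn
    (h.smooth_coeffs r H).2.continuousOn hl 1
  exact ⟨y, hy, hyl⟩

end IsCurvaturePair

namespace IsTau

theorem smooth (hτ : IsTau E₁ E₀ r H l τ) (h : IsCurvaturePair E₁ E₀ C) :
    ContDiffOn ℝ ∞ τ (Ioi 0) :=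
  contDiffOn_of_linear_ode (h.smooth_coeffs r H).1 (h.smooth_coeffs r H).2 hτ.ode

/-- The constant `H / E₁ l` is a subsolution. -/
theorem ge (hτ : IsTau E₁ E₀ r H l τ) (h : IsCurvaturePair E₁ E₀ C) (hH : 0 < H)
    (hl : 0 < l) (hHl : H < E₁ l) {s : ℝ} (hs : l ≤ s) : H / E₁ l ≤ τ s := by
  have hM := h.pos₁ l hl
  rcases hs.eq_or_lt with rfl | hs
  · rw [hτ.init]; exact (div_le_one hM).2 hHl.le
  have := (nonneg_of_linear_ode (y := fun s => τ s - H / E₁ l)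
    (f := fun s => r * H / E₀ s * (1 - E₁ s / E₁ l))
    (h.smooth_coeffs r H).1.continuousOn hl hs
    (fun s hs => ((hτ.ode s hs).sub_const _).congr_deriv (by
      have := (h.pos₀ s hs).ne'
      field_simp
      ring))
    (by
      simp only [hτ.init, sub_nonneg]
      exact (div_le_one hM).2 hHl.le)).1 (fun x hx => by
      have h0 := h.pos₀ x (hl.trans hx.1)
      have h1 : E₁ x ≤ E₁ l := h.anti₁.antitoneOn hl (hl.trans hx.1) hx.1.le
      have : E₁ x / E₁ l ≤ 1 := (div_le_one hM).2 h1
      have : 0 ≤ 1 - E₁ x / E₁ l := by linarith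
      positivity)
  linarith

theorem pos (hτ : IsTau E₁ E₀ r H l τ) (h : IsCurvaturePair E₁ E₀ C) (hH : 0 < H)
    (hl : 0 < l) (hHl : H < E₁ l) {s : ℝ} (hs : l ≤ s) : 0 < τ s :=
  lt_of_lt_of_le (div_pos hH (h.pos₁ l hl)) (hτ.ge h hH hl hHl hs)

/-- As long as `E₁ > H`, the constant `1` is a strict supersolution. -/
theorem lt_one (hτ : IsTau E₁ E₀ r H l τ) (h : IsCurvaturePair E₁ E₀ C) (hr : 1 ≤ r)
    (hl : 0 < l) {u : ℝ} (hu : l < u) (hE : ∀ s ∈ Ioo l u, H < E₁ s) : τ u < 1 := by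
  have := (nonneg_of_linear_ode (y := fun s => 1 - τ s)
    (f := fun s => r / E₀ s * (E₁ s - H))
    (h.smooth_coeffs r H).1.continuousOn hl hu
    (fun s hs => ((hτ.ode s hs).const_sub 1).congr_deriv (by
      have := (h.pos₀ s hs).ne'
      field_simp
      ring))
    (by simp [hτ.init])).2 (fun x hx => by
      have h0 := h.pos₀ x (hl.trans hx.1)
      have h1 := sub_pos.2 (hE x hx)
      have : (0 : ℝ) < r := by exact_mod_cast hr
      positivity)
  linarith

theorem deriv_eq (hτ : IsTau E₁ E₀ r H l τ) {u : ℝ} (hu : 0 < u) (h1 : τ u = 1) :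
    deriv τ u = r / E₀ u * (H - E₁ u) := by
  rw [(hτ.ode u hu).deriv, h1]
  ring

/-- If `H` exceeds the limit of `E₁`, the solution returns to the value `1`, transversally. -/
theorem exists_return (hτ : IsTau E₁ E₀ r H l τ) (h : IsCurvaturePair E₁ E₀ C)
    (hr : 1 ≤ r) (hl : 0 < l) (hHl : H < E₁ l) (hC : C < H) :
    ∃ u, l < u ∧ τ u = 1 ∧ (∀ s ∈ Ioo l u, τ s < 1) ∧ 0 < deriv τ u := by
  have hr0 : (0 : ℝ) < r := by exact_mod_cast hr
  have hcont : ∀ s, 0 < s → ContinuousAt τ s := fun s hs => (hτ.ode s hs).continuousAt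
  -- `τ < 1` just after `l`
  obtain ⟨ε, hε, hε1⟩ : ∃ ε > 0, ∀ s ∈ Ioc l (l + ε), τ s < 1 := by
    have hc : ContinuousAt E₁ l := h.smooth₁.continuousOn.continuousAt (Ioi_mem_nhds hl)
    obtain ⟨ε, hε, hb⟩ := Metric.eventually_nhds_iff.1 (continuousAt_const.eventually_lt hc hHl)
    refine ⟨ε / 2, by positivity, fun s hs => hτ.lt_one h hr hl hs.1 fun x hx => hb ?_⟩
    rw [Real.dist_eq, abs_of_pos (by linarith [hx.1])]
    linarith [hx.2, hs.2]
  obtain ⟨s₂, hs₂, hs₂1⟩ : ∃ s₂, l < s₂ ∧ 1 ≤ τ s₂ := by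
    by_contra! hcon
    obtain ⟨s₁, hs₁⟩ := eventually_atTop.1 (h.tendsto₁.eventually_lt_const
      (show C < (C + H) / 2 by linarith))
    set s₀ := max s₁ (l + 1) with hs₀
    have hls₀ : l < s₀ := lt_of_lt_of_le (by linarith) (le_max_right _ _)
    set k : ℝ := r * ((H - C) / 2) / E₀ l with hk
    have hE0l := h.pos₀ l hl
    have hkpos : 0 < k := by
      have : 0 < H - C := by linarith
      positivity
    have hmono : MonotoneOn (fun s => τ s - k * s) (Ici s₀) := by
      have hd : ∀ s, s₀ ≤ s → HasDerivAt (fun s => τ s - k * s)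
          ((-(r * E₁ s / E₀ s) * τ s + r * H / E₀ s) - k * 1) s := fun s hs =>
        (hτ.ode s (by linarith)).sub ((hasDerivAt_id s).const_mul k)
      refine monotoneOn_of_deriv_nonneg (convex_Ici _)
        (fun s hs => (hd s hs).continuousAt.continuousWithinAt) ?_ ?_
      · rw [interior_Ici]
        exact fun s hs => (hd s (mem_Ioi.1 hs).le).differentiableAt.differentiableWithinAt
      · rw [interior_Ici]
        intro s hs
        have hs' : s₀ < s := hs
        have hs0 : 0 < s := by linarith
        rw [(hd s hs'.le).deriv]
        have e1 : E₁ s < (C + H) / 2 := hs₁ s ((le_max_left _ _).trans hs'.le)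
        have e2 : τ s < 1 := hcon s (by linarith)
        have e3 : E₀ s ≤ E₀ l := h.anti₀ hl hs0 (by linarith)
        have e4 := h.pos₀ s hs0
        have e5 : E₁ s * τ s ≤ E₁ s := by
          have := h.pos₁ s hs0
          nlinarith
        have e6 : -(r * E₁ s / E₀ s) * τ s + r * H / E₀ s = r * (H - E₁ s * τ s) / E₀ s := by
          field_simp
          ring
        rw [e6, hk, mul_one, sub_nonneg]
        apply div_le_div₀ _ _ e4 e3
        · have : 0 ≤ H - E₁ s * τ s := by linarith
          positivity
        · apply mul_le_mul_of_nonneg_left _ hr0.le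
          linarith
    have hbig : s₀ ≤ s₀ + (1 - τ s₀) / k := by
      have := sub_pos.2 (hcon s₀ hls₀)
      have : 0 < (1 - τ s₀) / k := by positivity
      linarith
    have := hmono (mem_Ici.2 le_rfl) (mem_Ici.2 hbig) hbig
    have h2 := hcon _ (hls₀.trans_le hbig)
    have h3 : k * (s₀ + (1 - τ s₀) / k) = k * s₀ + (1 - τ s₀) := by
      field_simp
    simp only at this
    linarith
  have hcomp : IsCompact {s | s ∈ Icc (l + ε) s₂ ∧ 1 ≤ τ s} := by
    have hc : ContinuousOn τ (Icc (l + ε) s₂) := fun s hs =>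
      (hcont s (by linarith [hs.1])).continuousWithinAt
    exact isCompact_Icc.of_isClosed_subset (hc.preimage_isClosed_of_isClosed isClosed_Icc isClosed_Ici)
      inter_subset_left
  have hls₂ : l + ε ≤ s₂ := by
    by_contra! hlt
    exact absurd (hε1 s₂ ⟨hs₂, hlt.le⟩) (not_lt.2 hs₂1)
  obtain ⟨u, ⟨hu, hu1⟩, hmin⟩ := hcomp.exists_isLeast ⟨s₂, ⟨hls₂, le_rfl⟩, hs₂1⟩
  have hlu : l < u := by linarith [hu.1]
  have hlt : ∀ s ∈ Ioo l u, τ s < 1 := by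
    intro s hs
    by_cases hsε : s ≤ l + ε
    · exact hε1 s ⟨hs.1, hsε⟩
    · by_contra! h1
      exact absurd (hmin ⟨⟨(not_le.1 hsε).le, hs.2.le.trans hu.2⟩, h1⟩) (not_le.2 hs.2)
  have hu_eq : τ u = 1 := by
    refine le_antisymm ?_ hu1
    refine le_of_tendsto ((hcont u (hl.trans hlu)).tendsto.mono_left
      (nhdsWithin_le_nhds (s := Iio u))) ?_
    filter_upwards [Ioo_mem_nhdsLT hlu] with s hs using (hlt s hs).le
  refine ⟨u, hlu, hu_eq, hlt, ?_⟩
  rw [hτ.deriv_eq (hl.trans hlu) hu_eq]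
  have hEu : E₁ u < H := by
    by_contra! hge
    have := hτ.lt_one h hr hl hlu fun s hs =>
      hge.trans_lt (h.anti₁ (hl.trans hs.1) (hl.trans hlu) hs.2)
    linarith
  have := sub_pos.2 hEu
  have := h.pos₀ u (hl.trans hlu)
  positivity

end IsTau

/-- The potential: a profile curve `s = σ(t)` of the hypersurface satisfies `σ'² = G(σ)`. -/
noncomputable def profilePotential (r : ℕ) (τ : ℝ → ℝ) (s : ℝ) : ℝ := τ s ^ (-(2 / r : ℝ)) - 1

/-- The set where the potential is smooth. -/
def profileDomain (τ : ℝ → ℝ) : Set ℝ := {s | 0 < s ∧ 0 < τ s}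

namespace IsTau

theorem isOpen_domain (hτ : IsTau E₁ E₀ r H l τ) : IsOpen (profileDomain τ) := by
  have hc : ContinuousOn τ (Ioi 0) := fun s hs => (hτ.ode s hs).continuousAt.continuousWithinAt
  exact hc.isOpen_inter_preimage isOpen_Ioi isOpen_Ioi

theorem smooth_potential (hτ : IsTau E₁ E₀ r H l τ) (h : IsCurvaturePair E₁ E₀ C) :
    ContDiffOn ℝ ∞ (profilePotential r τ) (profileDomain τ) := by
  refine ContDiffOn.sub ?_ contDiffOn_const
  exact ((hτ.smooth h).mono fun s hs => hs.1).rpow_const_of_ne fun s hs => hs.2.ne'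

theorem hasDerivAt_potential (hτ : IsTau E₁ E₀ r H l τ) {s : ℝ} (hs : s ∈ profileDomain τ) :
    HasDerivAt (profilePotential r τ)
      (-(2 / r : ℝ) * τ s ^ (-(2 / r : ℝ) - 1) * deriv τ s) s := by
  have h1 := hτ.ode s hs.1
  have h2 := (h1.rpow_const (p := -(2 / r : ℝ)) (Or.inl hs.2.ne')).sub_const 1
  refine h2.congr_deriv ?_
  rw [h1.deriv]
  ring

theorem potential_pos (hr : 1 ≤ r) {s : ℝ} (hs : 0 < τ s) (h1 : τ s < 1) :
    0 < profilePotential r τ s := by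
  have hr0 : (0 : ℝ) < r := by exact_mod_cast hr
  have := Real.one_lt_rpow_of_pos_of_lt_one_of_neg hs h1 (z := -(2 / r : ℝ))
    (by have : (0 : ℝ) < 2 / r := by positivity
        linarith)
  simp only [profilePotential]
  linarith

theorem potential_eq_zero {s : ℝ} (h1 : τ s = 1) : profilePotential r τ s = 0 := by
  simp [profilePotential, h1]

/-- Newton's equation for the potential is the equation `H_r = H`: if `p` and `q` are the first
and second derivatives of the profile, the curvature of the profile curve is `-q w³`,
`w = (1 + p²)^{-1/2}`. -/
theorem profile_equation (hτ : IsTau E₁ E₀ r H l τ) (h : IsCurvaturePair E₁ E₀ C) (hr : 1 ≤ r)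
    {s p q : ℝ} (hs : s ∈ profileDomain τ) (hp : p ^ 2 = profilePotential r τ s)
    (hq : q = deriv (profilePotential r τ) s / 2) :
    H = (√(1 + p ^ 2))⁻¹ ^ r * E₁ s +
      -(q * (√(1 + p ^ 2))⁻¹ ^ 3) * ((√(1 + p ^ 2))⁻¹ ^ (r - 1) * E₀ s) := by
  have hr0 : (0 : ℝ) < r := by exact_mod_cast hr
  have hE0 := (h.pos₀ s hs.1).ne'
  have ht := hs.2
  set w : ℝ := τ s ^ (1 / r : ℝ) with hw
  have hw0 : 0 < w := Real.rpow_pos_of_pos ht _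
  have hwr : w ^ r = τ s := by
    rw [hw, ← Real.rpow_natCast, ← Real.rpow_mul ht.le, one_div, inv_mul_cancel₀ hr0.ne',
      Real.rpow_one]
  have hw2 : τ s ^ (-(2 / r : ℝ)) = (w ^ 2)⁻¹ := by
    rw [hw, ← Real.rpow_natCast, ← Real.rpow_mul ht.le, ← Real.rpow_neg ht.le]
    congr 1
    push_cast
    ring
  have hW : (√(1 + p ^ 2))⁻¹ = w := by
    rw [hp, profilePotential, add_sub_cancel, hw2, Real.sqrt_inv, inv_inv, Real.sqrt_sq hw0.le]
  have hq' : q = -(1 / r) * ((w ^ 2)⁻¹ * (τ s)⁻¹) *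
      (-(r * E₁ s / E₀ s) * τ s + r * H / E₀ s) := by
    rw [hq, (hτ.hasDerivAt_potential hs).deriv, (hτ.ode s hs.1).deriv, Real.rpow_sub_one ht.ne',
      hw2]
    ring
  have hw3 : w ^ 3 * w ^ (r - 1) = τ s * w ^ 2 := by
    rw [← hwr, ← pow_add, ← pow_add]
    congr 1
    omega
  rw [hW, hwr]
  calc H = τ s * E₁ s + -(q * (τ s * w ^ 2)) * E₀ s := by
        rw [hq']
        field_simp
        ring
    _ = _ := by rw [← hw3]; ring

end IsTau

end Profile

/-! ### Existence of the profile curves -/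

section ProfileExistence

variable {E₁ E₀ τ : ℝ → ℝ} {C H l : ℝ} {r : ℕ}

/-- The primitive `F` of an even function is odd; so is its inverse. -/
theorem inverse_integral_odd {h ψ : ℝ → ℝ} (hev : ∀ x, h (-x) = h x)
    (hψ₁ : ∀ x, ψ (∫ t in (0 : ℝ)..x, h t) = x) (hψ₂ : ∀ t, ∫ x in (0 : ℝ)..(ψ t), h x = t) (t : ℝ) :
    ψ (-t) = -ψ t := by
  have : ∫ x in (0 : ℝ)..(-ψ t), h x = -t := by
    have h1 := intervalIntegral.integral_comp_neg (a := 0) (b := ψ t) h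
    simp only [hev, neg_zero] at h1
    rw [intervalIntegral.integral_symm, ← h1, hψ₂]
  rw [← this, hψ₁]

namespace IsTau

theorem mem_domain (hτ : IsTau E₁ E₀ r H l τ) (h : IsCurvaturePair E₁ E₀ C) (hH : 0 < H)
    (hl : 0 < l) (hHl : H < E₁ l) {s : ℝ} (hs : l ≤ s) : s ∈ profileDomain τ :=
  ⟨hl.trans_le hs, hτ.pos h hH hl hHl hs⟩

theorem differentiableAt_potential (hτ : IsTau E₁ E₀ r H l τ) {s : ℝ}
    (hs : s ∈ profileDomain τ) : DifferentiableAt ℝ (profilePotential r τ) s :=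
  (hτ.hasDerivAt_potential hs).differentiableAt

theorem deriv_potential (hτ : IsTau E₁ E₀ r H l τ) {u : ℝ} (hu : 0 < u) (h1 : τ u = 1) :
    deriv (profilePotential r τ) u = -(2 / r : ℝ) * deriv τ u := by
  rw [(hτ.hasDerivAt_potential ⟨hu, by rw [h1]; norm_num⟩).deriv, h1]
  simp

theorem deriv_potential_pos (hτ : IsTau E₁ E₀ r H l τ) (h : IsCurvaturePair E₁ E₀ C)
    (hr : 1 ≤ r) (hl : 0 < l) (hHl : H < E₁ l) : 0 < deriv (profilePotential r τ) l := by
  have hr0 : (0 : ℝ) < r := by exact_mod_cast hr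
  rw [hτ.deriv_potential hl hτ.init, hτ.deriv_eq hl hτ.init]
  have := h.pos₀ l hl
  have h2 : 0 < 2 / (r : ℝ) * (r / E₀ l * (E₁ l - H)) := by
    have := sub_pos.2 hHl
    positivity
  linarith

/-- Conclusion common to both cases: a reparametrization of `S` solves the profile equation. -/
theorem profile_of_quadrature (hτ : IsTau E₁ E₀ r H l τ) (h : IsCurvaturePair E₁ E₀ C)
    (hr : 1 ≤ r) (hH : 0 < H) (hl : 0 < l) (hHl : H < E₁ l) {S S' k ψ : ℝ → ℝ}
    (hSl : ∀ x, l ≤ S x) (hS : ∀ x, HasDerivAt S (S' x) x) (hS'c : Continuous S')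
    (hS'0 : ∀ x, ∀ᶠ y in 𝓝[≠] x, S' y ≠ 0) (hk : Continuous k) (hpos : ∀ x, 0 < k x)
    (hEq : ∀ x, S' x ^ 2 = k x ^ 2 * profilePotential r τ (S x)) (hSe : ∀ x, S (-x) = S x)
    (hke : ∀ x, k (-x) = k x) (hS0 : S 0 = l)
    (hψc : Continuous ψ) (hψ₁ : ∀ x, ψ (∫ t in (0 : ℝ)..x, k t) = x)
    (hψ₂ : ∀ t, ∫ x in (0 : ℝ)..(ψ t), k x = t)
    (hψm : StrictMono ψ) (hψ : ∀ t, HasDerivAt ψ (k (ψ t))⁻¹ t) :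
    ContDiff ℝ ∞ (fun t => S (ψ t)) ∧ (∀ t, l ≤ S (ψ t)) ∧ S (ψ 0) = l ∧
      Function.Even (fun t => S (ψ t)) ∧
      ∀ t, H = (√(1 + deriv (fun t => S (ψ t)) t ^ 2))⁻¹ ^ r * E₁ (S (ψ t)) +
        -(deriv (deriv fun t => S (ψ t)) t * (√(1 + deriv (fun t => S (ψ t)) t ^ 2))⁻¹ ^ 3) *
          ((√(1 + deriv (fun t => S (ψ t)) t ^ 2))⁻¹ ^ (r - 1) * E₀ (S (ψ t))) := by
  have hdom : ∀ x, S x ∈ profileDomain τ := fun x => hτ.mem_domain h hH hl hHl (hSl x)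
  obtain ⟨h1, h2, h3⟩ := newton_of_quadrature hτ.isOpen_domain (hτ.smooth_potential h) hdom hS hS'c
    hS'0 hk hpos hEq hψc hψm hψ
  refine ⟨h1, fun t => hSl _, ?_, fun t => ?_, fun t => ?_⟩
  · have : ψ 0 = 0 := by simpa using hψ₁ 0
    rw [this, hS0]
  · simp only [inverse_integral_odd hke hψ₁ hψ₂, hSe]
  · exact hτ.profile_equation h hr (hdom _) (h2 t) (h3 t)

end IsTau

/-- The profile curve when `H` does not exceed the limit of `E₁`: a half-line `[l, ∞)` is
parametrized by `l + x²`. -/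
theorem exists_profile_unbounded (h : IsCurvaturePair E₁ E₀ C) (hr : 1 ≤ r) (hH : 0 < H)
    (hl : 0 < l) (hHl : H < E₁ l) (hC : H ≤ C) :
    ∃ σ : ℝ → ℝ, ContDiff ℝ ∞ σ ∧ (∀ t, l ≤ σ t) ∧ σ 0 = l ∧ Function.Even σ ∧
      ∀ t, H = (√(1 + deriv σ t ^ 2))⁻¹ ^ r * E₁ (σ t) +
        -(deriv (deriv σ) t * (√(1 + deriv σ t ^ 2))⁻¹ ^ 3) *
          ((√(1 + deriv σ t ^ 2))⁻¹ ^ (r - 1) * E₀ (σ t)) := by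
  have hr0 : (0 : ℝ) < r := by exact_mod_cast hr
  obtain ⟨τ, hτ⟩ := h.exists_tau r H hl
  set G := profilePotential r τ with hG
  have hGl : G l = 0 := IsTau.potential_eq_zero hτ.init
  have hlt : ∀ s, l < s → τ s < 1 := fun s hs => hτ.lt_one h hr hl hs fun x hx =>
    hC.trans_lt (h.limit_lt (hl.trans hx.1))
  have hGpos : ∀ s, l < s → 0 < G s := fun s hs =>
    IsTau.potential_pos hr (hτ.pos h hH hl hHl hs.le) (hlt s hs)
  have hdom : ∀ s, l ≤ s → s ∈ profileDomain τ := fun s hs => hτ.mem_domain h hH hl hHl hs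
  have hge : ∀ x : ℝ, l ≤ l + x ^ 2 := fun x => by nlinarith [sq_nonneg x]
  set g : ℝ → ℝ := fun x => dslope G l (l + x ^ 2) with hg
  have hgpos : ∀ x, 0 < g x := by
    intro x
    rcases eq_or_ne x 0 with rfl | hx
    · simp only [hg, ne_eq, OfNat.ofNat_ne_zero, not_false_eq_true, zero_pow, add_zero, dslope_same]
      exact hτ.deriv_potential_pos h hr hl hHl
    · have hx2 : 0 < x ^ 2 := by positivity
      simp only [hg]
      rw [dslope_of_ne _ (by linarith), slope_def_field, hGl]
      have := hGpos (l + x ^ 2) (by linarith)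
      have : 0 < l + x ^ 2 - l := by linarith
      rw [sub_zero]
      positivity
  have hgG : ∀ x, G (l + x ^ 2) = x ^ 2 * g x := by
    intro x
    have := sub_smul_dslope G l (l + x ^ 2)
    rw [hGl, sub_zero, smul_eq_mul] at this
    rw [← this]
    ring
  have hgc : Continuous g := by
    have hc : ContinuousOn (dslope G l) (Ici l) := by
      intro s hs
      have hd := hτ.differentiableAt_potential (hdom s hs)
      rcases eq_or_ne s l with rfl | hne
      · exact (continuousAt_dslope_same.2 hd).continuousWithinAt
      · exact ((continuousAt_dslope_of_ne hne).2 hd.continuousAt).continuousWithinAt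
    exact hc.comp_continuous (by fun_prop) hge
  set k : ℝ → ℝ := fun x => 2 / √(g x) with hk
  have hkc : Continuous k := continuous_const.div hgc.sqrt fun x => (Real.sqrt_pos.2 (hgpos x)).ne'
  have hkpos : ∀ x, 0 < k x := fun x => div_pos two_pos (Real.sqrt_pos.2 (hgpos x))
  have hm : 0 < H / E₁ l := div_pos hH (h.pos₁ l hl)
  set K : ℝ := (H / E₁ l) ^ (-(2 / r : ℝ)) with hK
  have hK0 : 0 < K := Real.rpow_pos_of_pos hm _
  have hGK : ∀ s, l ≤ s → G s ≤ K := by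
    intro s hs
    have := Real.rpow_le_rpow_of_nonpos hm (hτ.ge h hH hl hHl hs) (z := -(2 / r : ℝ))
      (by have : (0 : ℝ) < 2 / r := by positivity
          linarith)
    simp only [hG, profilePotential]
    linarith
  have hkb : ∀ x, 1 ≤ |x| → 2 / √K ≤ k x := by
    intro x hx
    apply div_le_div_of_nonneg_left (by norm_num) (Real.sqrt_pos.2 (hgpos x))
    apply Real.sqrt_le_sqrt
    have h1 : 1 ≤ x ^ 2 := by rw [← sq_abs]; nlinarith
    have h2 := hGK _ (hge x)
    rw [hgG] at h2
    nlinarith [hgpos x]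
  obtain ⟨ψ, hψc, hψ₁, hψ₂, hψm, hψ⟩ := exists_inverse_integral hkc hkpos
    (div_pos two_pos (Real.sqrt_pos.2 hK0)) hkb
  refine ⟨_, hτ.profile_of_quadrature h hr hH hl hHl (S := fun x => l + x ^ 2)
    (S' := fun x => 2 * x) hge (fun x => ?_) (by fun_prop) ?_ hkc hkpos ?_ (by simp)
    (by simp [hk, hg]) (by simp) hψc hψ₁ hψ₂ hψm hψ⟩
  · simpa using ((hasDerivAt_id x).pow 2).const_add l
  · intro x
    rcases eq_or_ne x 0 with rfl | hx
    · filter_upwards [self_mem_nhdsWithin] with y hy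
      simpa using hy
    · filter_upwards [nhdsWithin_le_nhds (isOpen_ne.mem_nhds hx)] with y hy
      simpa using hy
  · intro x
    have : √(g x) ^ 2 = g x := Real.sq_sqrt (hgpos x).le
    have h0 := (hgpos x).ne'
    simp only [hk]
    rw [← hG, hgG, div_pow, this]
    field_simp

/-- The profile curve when `H` exceeds the limit of `E₁`: the motion is an oscillation in the
potential well `[l, u]`, which is parametrized by `(l + u) / 2 - (u - l) / 2 * cos x`. -/
theorem exists_profile_unduloid (h : IsCurvaturePair E₁ E₀ C) (hr : 1 ≤ r) (hH : 0 < H)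
    (hl : 0 < l) (hHl : H < E₁ l) (hC : C < H) :
    ∃ σ : ℝ → ℝ, (ContDiff ℝ ∞ σ ∧ (∀ t, l ≤ σ t) ∧ σ 0 = l ∧ Function.Even σ ∧
      ∀ t, H = (√(1 + deriv σ t ^ 2))⁻¹ ^ r * E₁ (σ t) +
        -(deriv (deriv σ) t * (√(1 + deriv σ t ^ 2))⁻¹ ^ 3) *
          ((√(1 + deriv σ t ^ 2))⁻¹ ^ (r - 1) * E₀ (σ t))) ∧ ∃ T, IsUnduloidProfile σ T := by
  have hr0 : (0 : ℝ) < r := by exact_mod_cast hr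
  obtain ⟨τ, hτ⟩ := h.exists_tau r H hl
  obtain ⟨u, hlu, hu1, hult, hu'⟩ := hτ.exists_return h hr hl hHl hC
  set G := profilePotential r τ with hG
  have hGl : G l = 0 := IsTau.potential_eq_zero hτ.init
  have hGu : G u = 0 := IsTau.potential_eq_zero hu1
  have hGpos : ∀ s ∈ Ioo l u, 0 < G s := fun s hs =>
    IsTau.potential_pos hr (hτ.pos h hH hl hHl hs.1.le) (hult s hs)
  have hdom : ∀ s, l ≤ s → s ∈ profileDomain τ := fun s hs => hτ.mem_domain h hH hl hHl hs
  set d : ℝ := (u - l) / 2 with hd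
  have hd0 : 0 < d := by rw [hd]; linarith
  set S : ℝ → ℝ := fun x => (l + u) / 2 - d * Real.cos x with hSdef
  have hSl : ∀ x, l ≤ S x := fun x => by
    have := Real.cos_le_one x
    simp only [hSdef, hd]; nlinarith
  have hSu : ∀ x, S x ≤ u := fun x => by
    have := Real.neg_one_le_cos x
    simp only [hSdef, hd]; nlinarith
  have hSprod : ∀ x, (S x - l) * (u - S x) = (d * Real.sin x) ^ 2 := fun x => by
    rw [mul_pow, Real.sin_sq]
    simp only [hSdef, hd]; ring
  -- `G s = (s - l) (u - s) g s` with `g` continuous and positive on `[l, u]`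
  set D : ℝ → ℝ := dslope G l with hD
  have hDd : ∀ s ∈ Icc l u, ContinuousAt D s := by
    intro s hs
    have hds := hτ.differentiableAt_potential (hdom s hs.1)
    rcases eq_or_ne s l with rfl | hne
    · exact continuousAt_dslope_same.2 hds
    · exact (continuousAt_dslope_of_ne hne).2 hds.continuousAt
  have hDev : D =ᶠ[𝓝 u] fun s => (s - l)⁻¹ * G s := by
    filter_upwards [isOpen_ne.mem_nhds hlu.ne'] with s hs
    rw [hD, dslope_of_ne _ hs, slope_def_field, hGl]
    ring
  have hDu : HasDerivAt D ((u - l)⁻¹ * deriv G u) u := by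
    have h1 := (hτ.differentiableAt_potential (hdom u hlu.le)).hasDerivAt
    have h2 : HasDerivAt (fun s => (s - l)⁻¹) (-1 / (u - l) ^ 2) u :=
      ((hasDerivAt_id u).sub_const l).inv (sub_pos.2 hlu).ne'
    refine ((h2.mul h1).congr_of_eventuallyEq hDev).congr_deriv ?_
    rw [← hG, hGu]
    ring
  have hDu0 : D u = 0 := by rw [hDev.eq_of_nhds, hGu, mul_zero]
  set g : ℝ → ℝ := fun s => -dslope D u s with hg
  have hgc : ContinuousOn g (Icc l u) := by
    intro s hs
    rcases eq_or_ne s u with rfl | hne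
    · exact (continuousAt_dslope_same.2 hDu.differentiableAt).neg.continuousWithinAt
    · exact ((continuousAt_dslope_of_ne hne).2 (hDd s hs)).neg.continuousWithinAt
  have hgG : ∀ s, G s = (s - l) * (u - s) * g s := by
    intro s
    have h1 := sub_smul_dslope G l s
    have h2 := sub_smul_dslope D u s
    rw [hGl, sub_zero, smul_eq_mul] at h1
    rw [hDu0, sub_zero, smul_eq_mul, hD] at h2
    rw [← h1, ← h2]
    simp only [hg]
    ring
  have hgpos : ∀ s ∈ Icc l u, 0 < g s := by
    intro s hs
    rcases eq_or_ne s u with rfl | hne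
    · simp only [hg, dslope_same, hDu.deriv]
      rw [hG, hτ.deriv_potential (hl.trans hlu) hu1]
      have := sub_pos.2 hlu
      have : 0 < (s - l)⁻¹ * (2 / r * deriv τ s) := by positivity
      linarith
    · have hsu : 0 < u - s := sub_pos.2 (lt_of_le_of_ne hs.2 hne)
      have hDs : 0 < D s := by
        rcases eq_or_ne s l with rfl | hnel
        · rw [hD, dslope_same]; exact hτ.deriv_potential_pos h hr hl hHl
        · have hls : l < s := lt_of_le_of_ne hs.1 (Ne.symm hnel)
          rw [hD, dslope_of_ne _ hnel, slope_def_field, hGl, sub_zero]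
          exact div_pos (hGpos s ⟨hls, sub_pos.1 hsu⟩) (sub_pos.2 hls)
      simp only [hg]
      rw [dslope_of_ne _ hne, slope_def_field, hDu0, sub_zero, ← div_neg, neg_sub]
      positivity
  obtain ⟨x₀, hx₀, hmax⟩ := isCompact_Icc.exists_isMaxOn (nonempty_Icc.2 hlu.le) hgc
  have hSI : ∀ x, S x ∈ Icc l u := fun x => ⟨hSl x, hSu x⟩
  set k : ℝ → ℝ := fun x => 1 / √(g (S x)) with hk
  have hkpos : ∀ x, 0 < k x := fun x => div_pos one_pos (Real.sqrt_pos.2 (hgpos _ (hSI x)))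
  have hSc : Continuous S := by fun_prop
  have hkc : Continuous k := continuous_const.div (hgc.comp_continuous hSc hSI).sqrt
    fun x => (Real.sqrt_pos.2 (hgpos _ (hSI x))).ne'
  have hkb : ∀ x, 1 ≤ |x| → 1 / √(g x₀) ≤ k x := fun x _ =>
    div_le_div_of_nonneg_left (by norm_num) (Real.sqrt_pos.2 (hgpos _ (hSI x)))
      (Real.sqrt_le_sqrt (hmax (hSI x)))
  obtain ⟨ψ, hψc, hψ₁, hψ₂, hψm, hψ⟩ := exists_inverse_integral hkc hkpos
    (div_pos one_pos (Real.sqrt_pos.2 (hgpos x₀ hx₀))) hkb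
  have hSe : ∀ x, S (-x) = S x := fun x => by simp [hSdef]
  have hke : ∀ x, k (-x) = k x := fun x => by simp only [hk, hSe]
  have hprof := hτ.profile_of_quadrature h hr hH hl hHl (S := S)
    (S' := fun x => d * Real.sin x) hSl (fun x => ?_) (by fun_prop) ?_ hkc hkpos ?_ hSe hke
    (by simp only [hSdef, Real.cos_zero, hd]; ring) hψc hψ₁ hψ₂ hψm hψ
  rotate_left
  · refine (((Real.hasDerivAt_cos x).const_mul d).const_sub _).congr_deriv ?_
    ring
  · intro x
    -- where `sin` vanishes, its derivative `cos` does not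
    by_cases hx : Real.sin x = 0
    · have hcx : Real.cos x ≠ 0 := fun hc => by
        have := Real.sin_sq_add_cos_sq x
        simp [hx, hc] at this
      have := (Real.hasDerivAt_sin x).eventually_ne (c := 0) hcx
      filter_upwards [this] with y hy using mul_ne_zero hd0.ne' hy
    · filter_upwards [nhdsWithin_le_nhds (Real.continuous_sin.continuousAt.eventually_ne hx)]
        with y hy using mul_ne_zero hd0.ne' hy
  · intro x
    have : √(g (S x)) ^ 2 = g (S x) := Real.sq_sqrt (hgpos _ (hSI x)).le
    have h0 := (hgpos _ (hSI x)).ne'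
    simp only [hk]
    rw [← hG, hgG, hSprod, div_pow, this]
    field_simp
  refine ⟨_, hprof, 2 * ∫ x in (0 : ℝ)..Real.pi, k x, hprof.1, ?_, fun t => hl.trans_le (hSl _),
    ?_, hprof.2.2.2.1, ?_⟩
  · exact mul_pos two_pos (intervalIntegral.intervalIntegral_pos_of_pos
      (hkc.intervalIntegrable _ _) hkpos Real.pi_pos)
  · have hSp : ∀ x, S (x + 2 * Real.pi) = S x := fun x => by simp [hSdef]
    have hkp : Function.Periodic k (2 * Real.pi) := fun x => by simp only [hk, hSp]
    have hint : ∀ a b, IntervalIntegrable k volume a b := fun a b => hkc.intervalIntegrable _ _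
    have hT : ∫ x in (0 : ℝ)..(2 * Real.pi), k x = 2 * ∫ x in (0 : ℝ)..Real.pi, k x := by
      have h1 := intervalIntegral.integral_comp_neg (a := 0) (b := Real.pi) k
      simp only [hke, neg_zero] at h1
      have h2 := hkp.intervalIntegral_add_eq 0 (-Real.pi)
      rw [zero_add, show -Real.pi + 2 * Real.pi = Real.pi by ring,
        ← intervalIntegral.integral_add_adjacent_intervals (hint (-Real.pi) 0) (hint 0 Real.pi),
        ← h1] at h2
      rw [h2]
      ring
    have hψT : ∀ t, ψ (t + 2 * ∫ x in (0 : ℝ)..Real.pi, k x) = ψ t + 2 * Real.pi := by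
      intro t
      have : ∫ x in (0 : ℝ)..(ψ t + 2 * Real.pi), k x = t + 2 * ∫ x in (0 : ℝ)..Real.pi, k x := by
        rw [← intervalIntegral.integral_add_adjacent_intervals (hint _ (ψ t)) (hint _ _), hψ₂,
          hkp.intervalIntegral_add_eq (ψ t) 0, zero_add, hT]
      rw [← this, hψ₁]
    intro t
    simp only [hψT, hSp]
  · rw [mul_div_cancel_left₀ _ (two_ne_zero)]
    have hψ0 : ψ 0 = 0 := by simpa using hψ₁ 0
    intro a ha b hb hab
    have hmem : ∀ t ∈ Icc 0 (∫ x in (0 : ℝ)..Real.pi, k x), ψ t ∈ Icc 0 Real.pi := by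
      intro t ht
      have h1 := hψm.monotone ht.1
      have h2 := hψm.monotone ht.2
      rw [hψ0] at h1
      rw [hψ₁] at h2
      exact ⟨h1, h2⟩
    have := Real.strictAntiOn_cos (hmem a ha) (hmem b hb) (hψm hab)
    simp only [hSdef]
    nlinarith

/-- The profile of the hypersurface with neck radius `l`. -/
theorem exists_profile (h : IsCurvaturePair E₁ E₀ C) (hr : 1 ≤ r) (hH : 0 < H)
    (hl : 0 < l) (hHl : H < E₁ l) :
    ∃ σ : ℝ → ℝ, (ContDiff ℝ ∞ σ ∧ (∀ t, l ≤ σ t) ∧ σ 0 = l ∧ Function.Even σ ∧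
      ∀ t, H = (√(1 + deriv σ t ^ 2))⁻¹ ^ r * E₁ (σ t) +
        -(deriv (deriv σ) t * (√(1 + deriv σ t ^ 2))⁻¹ ^ 3) *
          ((√(1 + deriv σ t ^ 2))⁻¹ ^ (r - 1) * E₀ (σ t))) ∧
      (C < H → ∃ T, IsUnduloidProfile σ T) := by
  rcases lt_or_ge C H with hC | hC
  · obtain ⟨σ, h1, h2⟩ := exists_profile_unduloid h hr hH hl hHl hC
    exact ⟨σ, h1, fun _ => h2⟩
  · obtain ⟨σ, h1⟩ := exists_profile_unbounded h hr hH hl hHl hC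
    exact ⟨σ, h1, fun h2 => absurd h2 (not_lt.2 hC)⟩

end ProfileExistence

/-! ### The hyperbolic tangent -/

section Tanh

theorem hasDerivAt_tanh (x : ℝ) : HasDerivAt Real.tanh (1 - Real.tanh x ^ 2) x := by
  have hc := (Real.cosh_pos x).ne'
  have h := (Real.hasDerivAt_sinh x).div (Real.hasDerivAt_cosh x) hc
  have e : Real.tanh = Real.sinh / Real.cosh := funext Real.tanh_eq_sinh_div_cosh
  rw [e]
  refine h.congr_deriv ?_
  simp only [Pi.div_apply]
  field_simp

theorem contDiff_tanh : ContDiff ℝ ∞ Real.tanh := by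
  have e : Real.tanh = fun x => Real.sinh x / Real.cosh x := funext Real.tanh_eq_sinh_div_cosh
  rw [e]
  exact Real.contDiff_sinh.div Real.contDiff_cosh fun x => (Real.cosh_pos x).ne'

theorem strictMono_tanh : StrictMono Real.tanh := strictMono_of_deriv_pos fun x => by
  rw [(hasDerivAt_tanh x).deriv]
  have := Real.tanh_sq_lt_one x
  linarith

theorem tanh_pos_of_pos {x : ℝ} (hx : 0 < x) : 0 < Real.tanh x := by
  simpa using strictMono_tanh hx

theorem tendsto_tanh_atTop : Tendsto Real.tanh atTop (𝓝 1) := by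
  rw [tendsto_order]
  refine ⟨fun a ha => ?_, fun a ha => Eventually.of_forall fun x => (Real.tanh_lt_one x).trans ha⟩
  have hb : max a 0 ∈ Ioo (-1 : ℝ) 1 :=
    ⟨lt_of_lt_of_le (by norm_num) (le_max_right _ _), max_lt ha one_pos⟩
  filter_upwards [eventually_gt_atTop (Real.artanh (max a 0))] with x hx
  have := strictMono_tanh hx
  rw [Real.tanh_artanh hb] at this
  exact (le_max_left _ _).trans_lt this

end Tanh

/-! ### Elementary symmetric functions -/

section Esymm

variable {ι κ' : Type*} [Fintype ι] [Fintype κ']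

/-- The `r`-th elementary symmetric function of a finite family. -/
def esymmFn (r : ℕ) (k : ι → ℝ) : ℝ := ∑ I ∈ Finset.powersetCard r Finset.univ, ∏ i ∈ I, k i

theorem esymmFn_eq (r : ℕ) (k : ι → ℝ) : esymmFn r k = (Finset.univ.val.map k).esymm r :=
  (Finset.esymm_map_val k Finset.univ r).symm

theorem esymmFn_equiv (r : ℕ) (e : ι ≃ κ') (k : κ' → ℝ) :
    esymmFn r (fun i => k (e i)) = esymmFn r k := by
  classical
  rw [esymmFn_eq, esymmFn_eq]
  congr 1
  have : (Finset.univ : Finset κ') = Finset.univ.map e.toEmbedding := by simp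
  rw [this, Finset.map_val, Multiset.map_map]
  rfl

theorem esymmFn_smul (r : ℕ) (c : ℝ) (k : ι → ℝ) :
    esymmFn r (fun i => c * k i) = c ^ r * esymmFn r k := by
  rw [esymmFn, esymmFn, Finset.mul_sum]
  refine Finset.sum_congr rfl fun I hI => ?_
  rw [Finset.prod_mul_distrib, Finset.prod_const, (Finset.mem_powersetCard.1 hI).2]

theorem esymmFn_option (r : ℕ) (hr : 1 ≤ r) (k : Option ι → ℝ) :
    esymmFn r k = esymmFn r (fun i => k (some i)) + k none * esymmFn (r - 1) (fun i => k (some i)) := by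
  obtain ⟨r, rfl⟩ : ∃ q, r = q + 1 := ⟨r - 1, by omega⟩
  have h : (Finset.univ : Finset (Option ι)).val.map k =
      k none ::ₘ (Finset.univ.val.map fun i => k (some i)) := by
    simp [univ_option, Finset.insertNone]
  rw [esymmFn_eq, h, esymmFn_eq, esymmFn_eq, Nat.add_sub_cancel]
  simp only [Multiset.esymm, Multiset.powersetCard_cons, Multiset.map_add, Multiset.map_map,
    Multiset.sum_add, Function.comp_def, Multiset.prod_cons, Multiset.sum_map_mul_left]

/-- The elementary symmetric functions of the eigenvalues are invariant under orthogonal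
conjugation. -/
theorem esymmFn_eq_of_orthogonal [DecidableEq ι] (r : ℕ) (P : Matrix ι ι ℝ)
    (hP : P * P.transpose = 1) (k k' : ι → ℝ)
    (h : P * Matrix.diagonal k * P.transpose = Matrix.diagonal k') : esymmFn r k' = esymmFn r k := by
  have h1 : (Matrix.diagonal k').charpoly = (Matrix.diagonal k).charpoly := by
    rw [← h, Matrix.charpoly_mul_comm, ← mul_assoc, mul_eq_one_comm.1 hP, one_mul]
  rw [Matrix.charpoly_diagonal, Matrix.charpoly_diagonal] at h1
  have h2 : ∀ q : ι → ℝ, (∏ i, (Polynomial.X - Polynomial.C (q i))).roots = Finset.univ.val.map q :=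
    fun q => by
      have := Polynomial.roots_multiset_prod_X_sub_C (Finset.univ.val.map q)
      rwa [Multiset.map_map] at this
  rw [esymmFn_eq, esymmFn_eq, ← h2, ← h2, h1]

end Esymm

/-! ### The principal curvatures of geodesic spheres -/

section RadialCurvature

variable {ι : Type*} {κ : ℝ} {β : ι → ℝ}

/-- The `i`-th principal curvature of the sphere of radius `s`, with respect to the inward normal;
`ρ = tanh (s / κ)` is the Euclidean radius, and `β i` is `1` in the directions that are tangent to
the `𝔽`-line through the centre and `0` in the orthogonal directions. -/
noncomputable def radialCurv (κ : ℝ) (β : ι → ℝ) (s : ℝ) (i : ι) : ℝ :=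
  (1 + β i * Real.tanh (s / κ) ^ 2) / (κ * Real.tanh (s / κ))

theorem radialCurv_pos (hκ : 0 < κ) (hβ : ∀ i, β i = 0 ∨ β i = 1) {s : ℝ} (hs : 0 < s) (i : ι) :
    0 < radialCurv κ β s i := by
  have := tanh_pos_of_pos (div_pos hs hκ)
  have : 0 ≤ β i := by rcases hβ i with h | h <;> simp [h]
  unfold radialCurv
  positivity

theorem radialCurv_anti (hκ : 0 < κ) (hβ : ∀ i, β i = 0 ∨ β i = 1) {s t : ℝ} (hs : 0 < s)
    (hst : s < t) (i : ι) : radialCurv κ β t i < radialCurv κ β s i := by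
  have h1 := tanh_pos_of_pos (div_pos hs hκ)
  have h2 : Real.tanh (s / κ) < Real.tanh (t / κ) :=
    strictMono_tanh (div_lt_div_of_pos_right hst hκ)
  have h3 := Real.tanh_lt_one (t / κ)
  unfold radialCurv
  set a := Real.tanh (s / κ)
  set b := Real.tanh (t / κ)
  have hb : 0 < b := h1.trans h2
  have hab : a * b < 1 := by nlinarith
  have e : (1 + β i * a ^ 2) / (κ * a) - (1 + β i * b ^ 2) / (κ * b) =
      (b - a) * (1 - β i * (a * b)) / (κ * (a * b)) := by
    field_simp
    ring
  have h4 : 0 < 1 - β i * (a * b) := by rcases hβ i with h | h <;> simp [h, hab]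
  have h5 : 0 < b - a := sub_pos.2 h2
  rw [← sub_pos, e]
  positivity

theorem radialCurv_smooth (hκ : 0 < κ) (i : ι) :
    ContDiffOn ℝ ∞ (fun s => radialCurv κ β s i) (Ioi 0) := by
  have ht : ContDiff ℝ ∞ fun s => Real.tanh (s / κ) := contDiff_tanh.comp (contDiff_id.div_const κ)
  unfold radialCurv
  refine ContDiffOn.div ?_ ?_ fun s hs => ?_
  · exact (contDiff_const.add (contDiff_const.mul (ht.pow 2))).contDiffOn
  · exact (contDiff_const.mul ht).contDiffOn
  · exact (mul_pos hκ (tanh_pos_of_pos (div_pos hs hκ))).ne'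

theorem radialCurv_tendsto (hκ : 0 < κ) (i : ι) :
    Tendsto (fun s => radialCurv κ β s i) atTop (𝓝 ((1 + β i) / κ)) := by
  have h : Tendsto (fun s => Real.tanh (s / κ)) atTop (𝓝 1) :=
    tendsto_tanh_atTop.comp (tendsto_id.atTop_div_const hκ)
  have := ((h.pow 2).const_mul (β i)).const_add 1 |>.div (h.const_mul κ) (by simpa using hκ.ne')
  simpa [radialCurv, Pi.div_def] using this

variable [Fintype ι]

/-- The `r`-th symmetric function of the principal curvatures of the sphere of radius `s`. -/
noncomputable def radialEsymm (κ : ℝ) (β : ι → ℝ) (r : ℕ) (s : ℝ) : ℝ :=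
  esymmFn r (radialCurv κ β s)

theorem powersetCard_univ_nonempty {r : ℕ} (hr : r ≤ Fintype.card ι) :
    (Finset.powersetCard r (Finset.univ : Finset ι)).Nonempty :=
  Finset.powersetCard_nonempty.2 (by simpa using hr)

theorem radialEsymm_pos (hκ : 0 < κ) (hβ : ∀ i, β i = 0 ∨ β i = 1) {r : ℕ}
    (hr : r ≤ Fintype.card ι) {s : ℝ} (hs : 0 < s) : 0 < radialEsymm κ β r s :=
  Finset.sum_pos (fun _ _ => Finset.prod_pos fun i _ => radialCurv_pos hκ hβ hs i)
    (powersetCard_univ_nonempty hr)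

theorem radialEsymm_nonneg (hκ : 0 < κ) (hβ : ∀ i, β i = 0 ∨ β i = 1) (r : ℕ) {s : ℝ}
    (hs : 0 < s) : 0 ≤ radialEsymm κ β r s :=
  Finset.sum_nonneg fun _ _ => Finset.prod_nonneg fun i _ => (radialCurv_pos hκ hβ hs i).le

theorem radialEsymm_smooth (hκ : 0 < κ) (r : ℕ) :
    ContDiffOn ℝ ∞ (radialEsymm κ β r) (Ioi 0) :=
  ContDiffOn.sum fun _ _ => contDiffOn_prod fun i _ => radialCurv_smooth hκ i

theorem radialEsymm_tendsto (hκ : 0 < κ) (r : ℕ) :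
    Tendsto (radialEsymm κ β r) atTop (𝓝 (esymmFn r fun i => (1 + β i) / κ)) :=
  tendsto_finsetSum _ fun _ _ => tendsto_finsetProd _ fun i _ => radialCurv_tendsto hκ i

theorem radialEsymm_antitone (hκ : 0 < κ) (hβ : ∀ i, β i = 0 ∨ β i = 1) (r : ℕ) :
    AntitoneOn (radialEsymm κ β r) (Ioi 0) := by
  intro s hs t ht hst
  rcases hst.eq_or_lt with rfl | hst
  · rfl
  exact Finset.sum_le_sum fun I _ => Finset.prod_le_prod
    (fun i _ => (radialCurv_pos hκ hβ ht i).le) fun i _ => (radialCurv_anti hκ hβ hs hst i).le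

theorem radialEsymm_strictAnti (hκ : 0 < κ) (hβ : ∀ i, β i = 0 ∨ β i = 1) {r : ℕ} (hr1 : 1 ≤ r)
    (hr : r ≤ Fintype.card ι) : StrictAntiOn (radialEsymm κ β r) (Ioi 0) := by
  intro s hs t ht hst
  refine Finset.sum_lt_sum_of_nonempty (powersetCard_univ_nonempty hr) fun I hI => ?_
  have hI' : I.Nonempty := by
    rw [← Finset.card_pos, (Finset.mem_powersetCard.1 hI).2]
    exact hr1
  exact Finset.prod_lt_prod_of_nonempty (fun i _ => radialCurv_pos hκ hβ ht i)
    (fun i _ => radialCurv_anti hκ hβ hs hst i) hI'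

theorem isCurvaturePair_radialEsymm (hκ : 0 < κ) (hβ : ∀ i, β i = 0 ∨ β i = 1) {r : ℕ}
    (hr1 : 1 ≤ r) (hr : r ≤ Fintype.card ι) :
    IsCurvaturePair (radialEsymm κ β r) (radialEsymm κ β (r - 1))
      (esymmFn r fun i => (1 + β i) / κ) where
  smooth₁ := radialEsymm_smooth hκ r
  smooth₀ := radialEsymm_smooth hκ (r - 1)
  pos₁ _ hs := radialEsymm_pos hκ hβ hr hs
  pos₀ _ hs := radialEsymm_pos hκ hβ (by omega) hs
  anti₁ := radialEsymm_strictAnti hκ hβ hr1 hr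
  anti₀ := radialEsymm_antitone hκ hβ (r - 1)
  tendsto₁ := radialEsymm_tendsto hκ r

/-- Small spheres have arbitrarily large mean curvatures. -/
theorem exists_lt_radialEsymm (hκ : 0 < κ) (hβ : ∀ i, β i = 0 ∨ β i = 1) {r : ℕ} (hr1 : 1 ≤ r)
    (hr : r ≤ Fintype.card ι) {H : ℝ} (hH : 0 < H) : ∃ s, 0 < s ∧ H < radialEsymm κ β r s := by
  -- choose the radius so that every principal curvature is at least `H + 1`
  set ρ : ℝ := min ((κ * (H + 1))⁻¹) (1 / 2) with hρ
  have hρ0 : 0 < ρ := lt_min (by positivity) (by norm_num)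
  have hρ1 : ρ < 1 := (min_le_right _ _).trans_lt (by norm_num)
  have hρm : ρ ∈ Ioo (-1 : ℝ) 1 := ⟨by linarith, hρ1⟩
  have hs : 0 < κ * Real.artanh ρ := mul_pos hκ (Real.artanh_pos ⟨hρ0, hρ1⟩)
  refine ⟨_, hs, ?_⟩
  have hk : ∀ i, H + 1 ≤ radialCurv κ β (κ * Real.artanh ρ) i := by
    intro i
    have : 0 ≤ β i := by rcases hβ i with h | h <;> simp [h]
    rw [radialCurv, mul_div_cancel_left₀ _ hκ.ne', Real.tanh_artanh hρm,
      le_div_iff₀ (mul_pos hκ hρ0)]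
    have h1 : ρ ≤ (κ * (H + 1))⁻¹ := min_le_left _ _
    have h2 : κ * (H + 1) * ρ ≤ 1 := by
      have := mul_le_mul_of_nonneg_left h1 (show 0 ≤ κ * (H + 1) by positivity)
      rwa [mul_inv_cancel₀ (by positivity)] at this
    have h3 : 0 ≤ β i * ρ ^ 2 := by positivity
    linarith
  obtain ⟨I, hI⟩ := powersetCard_univ_nonempty hr
  have h1 : (H + 1) ^ r ≤ ∏ i ∈ I, radialCurv κ β (κ * Real.artanh ρ) i := by
    rw [← (Finset.mem_powersetCard.1 hI).2, ← Finset.prod_const]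
    exact Finset.prod_le_prod (fun _ _ => by linarith) fun i _ => hk i
  have h2 : ∏ i ∈ I, radialCurv κ β (κ * Real.artanh ρ) i ≤ radialEsymm κ β r (κ * Real.artanh ρ) :=
    Finset.single_le_sum (f := fun I => ∏ i ∈ I, radialCurv κ β (κ * Real.artanh ρ) i)
      (fun J _ => Finset.prod_nonneg fun i _ => (radialCurv_pos hκ hβ hs i).le) hI
  have h3 : H + 1 ≤ (H + 1) ^ r := le_self_pow₀ (by linarith) (by omega)
  linarith

end RadialCurvature

/-! ### The metric of the unit ball -/

section BallMetric

theorem one_sub_norm_sq_pos {W : Type*} [NormedAddCommGroup W] {x : W} (hx : ‖x‖ < 1) :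
    0 < 1 - ‖x‖ ^ 2 := by
  nlinarith [norm_nonneg x]

variable {V : Type*} [NormedAddCommGroup V] [InnerProductSpace ℝ V]

/-- The properties of the form `Q x u v = ‖x‖² ⟪P_x u, v⟫`, where `P_x` is the orthogonal projection
to the `𝔽`-line through `0` and `x`, on which the geometry of rotational hypersurfaces depends. The
family `β` lists the eigenvalues of `P_x` on the orthogonal complement of `x`. -/
structure IsLineForm (β : Fin (Module.finrank ℝ V - 1) → ℝ) (Q : V → V → V → ℝ) : Prop where
  smooth : ContDiff ℝ ∞ fun p : V × V × V => Q p.1 p.2.1 p.2.2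
  smul_left : ∀ x (a : ℝ) u v, Q x (a • u) v = a * Q x u v
  add_left : ∀ x u u' v, Q x (u + u') v = Q x u v + Q x u' v
  symm : ∀ x u v, Q x u v = Q x v u
  radial : ∀ x v, Q x x v = ‖x‖ ^ 2 * ⟪x, v⟫
  fderiv_radial : ∀ x v w, fderiv ℝ (fun y => Q y v w) x x = 2 * Q x v w
  fderiv_closed : ∀ x X Y, ⟪x, X⟫ = 0 → ⟪x, Y⟫ = 0 →
    fderiv ℝ (fun y => Q y x Y) x X = fderiv ℝ (fun y => Q y X x) x Y
  fderiv_self : ∀ x X, ⟪x, X⟫ = 0 → fderiv ℝ (fun y => Q y x x) x X = 0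
  inner_sq_le : ∀ x u, ⟪x, u⟫ ^ 2 ≤ Q x u u
  exists_basis : ∀ x, x ≠ 0 → ∃ e : Fin (Module.finrank ℝ V - 1) → V, Orthonormal ℝ e ∧
    (∀ i, ⟪x, e i⟫ = 0) ∧ ∀ i v, Q x (e i) v = β i * ‖x‖ ^ 2 * ⟪e i, v⟫

/-- The metric of the unit ball defined by the form `Q`. -/
noncomputable def ballMetric (κ : ℝ) (Q : V → V → V → ℝ) (z u v : V) : ℝ :=
  κ ^ 2 * (⟪u, v⟫ / (1 - ‖z‖ ^ 2) + Q z u v / (1 - ‖z‖ ^ 2) ^ 2)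

variable {κ : ℝ} {Q : V → V → V → ℝ} {β : Fin (Module.finrank ℝ V - 1) → ℝ} {x : V}

namespace IsLineForm

theorem smooth_apply (h : IsLineForm β Q) (v w : V) : ContDiff ℝ ∞ fun y => Q y v w :=
  h.smooth.comp (contDiff_id.prodMk (contDiff_const (c := (v, w))))

theorem differentiable_apply (h : IsLineForm β Q) (v w : V) : Differentiable ℝ fun y => Q y v w :=
  (h.smooth_apply v w).differentiable (by simp)

theorem metric_symm (h : IsLineForm β Q) (x u v : V) :
    ballMetric κ Q x u v = ballMetric κ Q x v u := by
  rw [ballMetric, ballMetric, h.symm, real_inner_comm]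

theorem metric_smul_left (h : IsLineForm β Q) (x : V) (a : ℝ) (u v : V) :
    ballMetric κ Q x (a • u) v = a * ballMetric κ Q x u v := by
  rw [ballMetric, ballMetric, h.smul_left, real_inner_smul_left]
  ring

theorem metric_smul_right (h : IsLineForm β Q) (x : V) (a : ℝ) (u v : V) :
    ballMetric κ Q x u (a • v) = a * ballMetric κ Q x u v := by
  rw [h.metric_symm, h.metric_smul_left, h.metric_symm]

theorem metric_add_left (h : IsLineForm β Q) (x u u' v : V) :
    ballMetric κ Q x (u + u') v = ballMetric κ Q x u v + ballMetric κ Q x u' v := by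
  rw [ballMetric, ballMetric, ballMetric, h.add_left, inner_add_left]
  ring

/-- Gauss's lemma: radial vectors are orthogonal to the spheres. -/
theorem metric_radial (h : IsLineForm β Q) (hx : ‖x‖ < 1) (v : V) :
    ballMetric κ Q x x v = κ ^ 2 * ⟪x, v⟫ / (1 - ‖x‖ ^ 2) ^ 2 := by
  have := (one_sub_norm_sq_pos hx).ne'
  rw [ballMetric, h.radial]
  field_simp
  ring

theorem hasFDerivAt_metric (h : IsLineForm β Q) (hx : ‖x‖ < 1) (v w : V) :
    DifferentiableAt ℝ (fun y => ballMetric κ Q y v w) x ∧ ∀ u,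
      fderiv ℝ (fun y => ballMetric κ Q y v w) x u =
        κ ^ 2 * (2 * ⟪x, u⟫ * ⟪v, w⟫ / (1 - ‖x‖ ^ 2) ^ 2 +
          fderiv ℝ (fun y => Q y v w) x u / (1 - ‖x‖ ^ 2) ^ 2 +
          4 * ⟪x, u⟫ * Q x v w / (1 - ‖x‖ ^ 2) ^ 3) := by
  have hq := (one_sub_norm_sq_pos hx).ne'
  have hn : HasFDerivAt (fun y : V => 1 - ‖y‖ ^ 2) (-(2 • innerSL ℝ x)) x :=
    (hasStrictFDerivAt_norm_sq x).hasFDerivAt.const_sub 1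
  have hi1 : HasFDerivAt (fun y : V => (1 - ‖y‖ ^ 2)⁻¹) _ x :=
    (hasDerivAt_inv hq).comp_hasFDerivAt x hn
  have hQ := (h.differentiable_apply v w x).hasFDerivAt
  have hm := ((hi1.const_mul ⟪v, w⟫).add (hQ.mul (hi1.pow 2))).const_mul (κ ^ 2)
  have e : (fun y => ballMetric κ Q y v w) = fun y => κ ^ 2 *
      (⟪v, w⟫ * (1 - ‖y‖ ^ 2)⁻¹ + Q y v w * ((1 - ‖y‖ ^ 2)⁻¹) ^ 2) := by
    funext y
    simp only [ballMetric, div_eq_mul_inv, inv_pow]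
  rw [e]
  refine ⟨hm.differentiableAt, fun u => ?_⟩
  have := hm.fderiv
  simp only [Pi.add_apply, Pi.mul_apply] at this
  rw [this]
  simp [innerSL_apply_apply]
  field_simp
  ring

theorem koszul_smul (h : IsLineForm β Q) (hx : ‖x‖ < 1) (a b c : ℝ) (u v w : V) :
    koszul (ballMetric κ Q) x (a • u) (b • v) (c • w) =
      a * b * c * koszul (ballMetric κ Q) x u v w := by
  have e : ∀ (p q : ℝ) (u v w : V), fderiv ℝ (fun y => ballMetric κ Q y (p • u) (q • v)) x w =
      p * q * fderiv ℝ (fun y => ballMetric κ Q y u v) x w := by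
    intro p q u v w
    simp only [h.metric_smul_left, h.metric_smul_right, ← mul_assoc]
    rw [fderiv_const_mul (h.hasFDerivAt_metric hx u v).1]
    simp
  simp only [koszul, e, map_smul, smul_eq_mul]
  ring

/-- The Christoffel part of `g (∇_X x, Y)` for the position field `x`; the remaining part is
`ballMetric κ Q x X Y`, and the sum is a multiple of the second fundamental form of the sphere. -/
theorem koszul_tangent (h : IsLineForm β Q) (hx : ‖x‖ < 1) {X Y : V} (hX : ⟪x, X⟫ = 0)
    (hY : ⟪x, Y⟫ = 0) : koszul (ballMetric κ Q) x X x Y =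
      κ ^ 2 * (‖x‖ ^ 2 * ⟪X, Y⟫ / (1 - ‖x‖ ^ 2) ^ 2 + Q x X Y / (1 - ‖x‖ ^ 2) ^ 2 +
        2 * ‖x‖ ^ 2 * Q x X Y / (1 - ‖x‖ ^ 2) ^ 3) := by
  have hXx : ⟪X, x⟫ = 0 := by rw [real_inner_comm, hX]
  rw [koszul, (h.hasFDerivAt_metric hx _ _).2, (h.hasFDerivAt_metric hx _ _).2,
    (h.hasFDerivAt_metric hx _ _).2, h.fderiv_radial, h.fderiv_closed x X Y hX hY, hX, hY, hXx,
    real_inner_self_eq_norm_sq]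
  ring

theorem koszul_tangent_radial (h : IsLineForm β Q) (hx : ‖x‖ < 1) {X : V} (hX : ⟪x, X⟫ = 0) :
    koszul (ballMetric κ Q) x X x x = 0 := by
  rw [koszul, (h.hasFDerivAt_metric hx _ _).2, (h.hasFDerivAt_metric hx _ _).2, h.fderiv_self x X hX,
    hX]
  ring

theorem koszul_radial_tangent (h : IsLineForm β Q) (hx : ‖x‖ < 1) {X : V} (hX : ⟪x, X⟫ = 0) :
    koszul (ballMetric κ Q) x x x X = 0 := by
  rw [koszul, (h.hasFDerivAt_metric hx _ _).2, (h.hasFDerivAt_metric hx _ _).2, h.fderiv_self x X hX,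
    h.fderiv_radial, h.radial, hX]
  ring

theorem koszul_radial (h : IsLineForm β Q) (hx : ‖x‖ < 1) :
    koszul (ballMetric κ Q) x x x x = 2 * κ ^ 2 * ‖x‖ ^ 4 / (1 - ‖x‖ ^ 2) ^ 3 := by
  have := (one_sub_norm_sq_pos hx).ne'
  rw [koszul, (h.hasFDerivAt_metric hx _ _).2, h.fderiv_radial, h.radial, real_inner_self_eq_norm_sq]
  field_simp
  ring

/-- An orthonormal basis of the tangent space of the sphere through `x` that consists of principal
directions; `(1 - ‖x‖²) / (κ ‖x‖) • x` is the outward unit normal. -/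
theorem exists_principal_basis (h : IsLineForm β Q) (hκ : 0 < κ) (hβ : ∀ i, β i = 0 ∨ β i = 1)
    (hx0 : x ≠ 0) (hx : ‖x‖ < 1) :
    ∃ f : Fin (Module.finrank ℝ V - 1) → V, (∀ i, ⟪x, f i⟫ = 0) ∧
      (∀ i j, ballMetric κ Q x (f i) (f j) = if i = j then 1 else 0) ∧
      ∀ i j, (1 - ‖x‖ ^ 2) / (κ * ‖x‖) *
        (ballMetric κ Q x (f i) (f j) + koszul (ballMetric κ Q) x (f i) x (f j)) =
          if i = j then (1 + β i * ‖x‖ ^ 2) / (κ * ‖x‖) else 0 := by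
  obtain ⟨e, he, hxe, hQ⟩ := h.exists_basis x hx0
  have hq := one_sub_norm_sq_pos hx
  have hn : 0 < ‖x‖ := norm_pos_iff.2 hx0
  have hee : ∀ i j, ⟪e i, e j⟫ = if i = j then (1 : ℝ) else 0 := orthonormal_iff_ite.1 he
  set c : Fin (Module.finrank ℝ V - 1) → ℝ := fun i =>
    κ ^ 2 * (1 / (1 - ‖x‖ ^ 2) + β i * ‖x‖ ^ 2 / (1 - ‖x‖ ^ 2) ^ 2) with hc
  have hcpos : ∀ i, 0 < c i := by
    intro i
    have : 0 ≤ β i := by rcases hβ i with h | h <;> simp [h]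
    positivity
  have hm : ∀ i j, ballMetric κ Q x (e i) (e j) = if i = j then c i else 0 := by
    intro i j
    rw [ballMetric, hQ, hee]
    split_ifs <;> simp [hc]
  have hk : ∀ i j, (1 - ‖x‖ ^ 2) / (κ * ‖x‖) *
      (ballMetric κ Q x (e i) (e j) + koszul (ballMetric κ Q) x (e i) x (e j)) =
        if i = j then c i * ((1 + β i * ‖x‖ ^ 2) / (κ * ‖x‖)) else 0 := by
    intro i j
    rw [hm, h.koszul_tangent hx (hxe i) (hxe j), hQ, hee]
    split_ifs with hij
    · simp only [hc]
      rcases hβ i with h0 | h0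
      · rw [h0]
        field_simp
        ring
      · rw [h0]
        field_simp
        ring
    · simp
  refine ⟨fun i => (√(c i))⁻¹ • e i, fun i => by rw [real_inner_smul_right, hxe, mul_zero],
    fun i j => ?_, fun i j => ?_⟩
  · rw [h.metric_smul_left, h.metric_smul_right, hm]
    split_ifs with hij
    · subst hij
      have h1 := Real.mul_self_sqrt (hcpos i).le
      have h2 := (Real.sqrt_pos.2 (hcpos i)).ne'
      field_simp
      rw [sq, h1]
    · simp
  · have e1 := h.koszul_smul (κ := κ) hx (√(c i))⁻¹ 1 (√(c j))⁻¹ (e i) x (e j)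
    rw [one_smul, mul_one] at e1
    rw [h.metric_smul_left, h.metric_smul_right, e1]
    have h3 := hk i j
    have h4 : (1 - ‖x‖ ^ 2) / (κ * ‖x‖) * ((√(c i))⁻¹ * ((√(c j))⁻¹ * ballMetric κ Q x (e i) (e j)) +
        (√(c i))⁻¹ * (√(c j))⁻¹ * koszul (ballMetric κ Q) x (e i) x (e j)) =
        (√(c i))⁻¹ * (√(c j))⁻¹ * (if i = j then c i * ((1 + β i * ‖x‖ ^ 2) / (κ * ‖x‖)) else 0) := by
      rw [← h3]
      ring
    rw [h4]
    split_ifs with hij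
    · subst hij
      have h1 := Real.mul_self_sqrt (hcpos i).le
      have h2 := (Real.sqrt_pos.2 (hcpos i)).ne'
      field_simp
      rw [sq √(c i), h1]
    · simp

end IsLineForm

end BallMetric

/-! ### Distances in the ball -/

section Distance

variable {V : Type*} [NormedAddCommGroup V] [InnerProductSpace ℝ V]
  {κ : ℝ} {Q : V → V → V → ℝ} {β : Fin (Module.finrank ℝ V - 1) → ℝ}

theorem hasDerivAt_artanh {y : ℝ} (hy : y ∈ Ioo (-1 : ℝ) 1) :
    HasDerivAt Real.artanh (1 - y ^ 2)⁻¹ y := by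
  have h1 : 0 < 1 + y := by linarith [hy.1]
  have h2 : 0 < 1 - y := by linarith [hy.2]
  have hlog : HasDerivAt (fun z : ℝ => 1 / 2 * (Real.log (1 + z) - Real.log (1 - z)))
      (1 / 2 * (1 / (1 + y) - -1 / (1 - y))) y :=
    ((((hasDerivAt_id y).const_add 1).log h1.ne').sub
      (((hasDerivAt_id y).const_sub 1).log h2.ne')).const_mul _
  refine (hlog.congr_of_eventuallyEq ?_).congr_deriv ?_
  · filter_upwards [isOpen_Ioo.mem_nhds hy] with z hz
    rw [Real.artanh_eq_half_log ⟨hz.1.le, hz.2.le⟩,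
      Real.log_div (by linarith [hz.1]) (by linarith [hz.2])]
  · have : 1 - y ^ 2 = (1 + y) * (1 - y) := by ring
    rw [this]
    field_simp
    ring

theorem curveLength_nonneg (g : V → V → V → ℝ) (c : ℝ → V) : 0 ≤ curveLength g c :=
  intervalIntegral.integral_nonneg zero_le_one fun _ _ => Real.sqrt_nonneg _

theorem riemDist_le_curveLength (g : V → V → V → ℝ) (U : Set V) {c : ℝ → V} (hc : ContDiff ℝ 1 c)
    (hU : ∀ t ∈ Icc (0 : ℝ) 1, c t ∈ U) : riemDist g U (c 0) (c 1) ≤ curveLength g c := by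
  refine csInf_le ⟨0, ?_⟩ ⟨c, hc, rfl, rfl, hU, rfl⟩
  rintro L ⟨c, -, -, -, -, rfl⟩
  exact curveLength_nonneg g c

namespace IsLineForm

/-- The function `κ artanh ⟪z, e⟫` has gradient at most `1`: by the Cauchy-Schwarz inequality for the
metric, since the squared norm of the covector `⟪·, e⟫` is at most `(1 - ‖z‖²) (1 - ⟪z, e⟫²) / κ²`. -/
theorem sq_inner_le_metric (h : IsLineForm β Q) {z e : V} (hz : ‖z‖ < 1) (he : ‖e‖ = 1) (u : V) :
    (κ * (⟪u, e⟫ / (1 - ⟪z, e⟫ ^ 2))) ^ 2 ≤ ballMetric κ Q z u u := by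
  have hq := one_sub_norm_sq_pos hz
  have hza : ⟪z, e⟫ ^ 2 ≤ ‖z‖ ^ 2 := by
    have := abs_real_inner_le_norm z e
    rw [he, mul_one] at this
    exact sq_le_sq.2 (by rwa [abs_norm])
  set a := ⟪z, e⟫ with ha
  have hA : 0 < 1 - a ^ 2 := by linarith
  set p := ⟪u, e⟫ with hp
  set b := ⟪z, u⟫ with hb
  set μ := p / (1 - a ^ 2) with hμ
  have hpμ : p = μ * (1 - a ^ 2) := by rw [hμ]; field_simp
  have h1 : 0 ≤ ‖u - μ • (e - a • z)‖ ^ 2 := sq_nonneg _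
  have hexp : ‖u - μ • (e - a • z)‖ ^ 2 =
      ‖u‖ ^ 2 - 2 * μ * (p - a * b) + μ ^ 2 * (1 - 2 * a ^ 2 + a ^ 2 * ‖z‖ ^ 2) := by
    rw [norm_sub_sq_real, norm_smul, mul_pow, norm_sub_sq_real, norm_smul, mul_pow,
      real_inner_smul_right, inner_sub_right, real_inner_smul_right, real_inner_smul_right, he,
      Real.norm_eq_abs, Real.norm_eq_abs, sq_abs, sq_abs, real_inner_comm z u,
      real_inner_comm z e, ← ha, ← hb, ← hp]
    ring
  rw [hexp] at h1
  have h2 : 0 ≤ (b - μ * a * (1 - ‖z‖ ^ 2)) ^ 2 / (1 - ‖z‖ ^ 2) := by positivity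
  have h3 : (b - μ * a * (1 - ‖z‖ ^ 2)) ^ 2 / (1 - ‖z‖ ^ 2) =
      b ^ 2 / (1 - ‖z‖ ^ 2) - 2 * μ * a * b + μ ^ 2 * a ^ 2 * (1 - ‖z‖ ^ 2) := by
    field_simp
    ring
  rw [h3] at h2
  have h4 : μ ^ 2 * (1 - a ^ 2) ≤ ‖u‖ ^ 2 + b ^ 2 / (1 - ‖z‖ ^ 2) := by
    rw [hpμ] at h1
    nlinarith
  have h5 : b ^ 2 ≤ Q z u u := h.inner_sq_le z u
  have h6 : μ ^ 2 * (1 - ‖z‖ ^ 2) ≤ ‖u‖ ^ 2 + Q z u u / (1 - ‖z‖ ^ 2) := by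
    have h7 : b ^ 2 / (1 - ‖z‖ ^ 2) ≤ Q z u u / (1 - ‖z‖ ^ 2) := by gcongr
    have h8 : μ ^ 2 * (1 - ‖z‖ ^ 2) ≤ μ ^ 2 * (1 - a ^ 2) :=
      mul_le_mul_of_nonneg_left (by linarith) (sq_nonneg _)
    linarith
  rw [ballMetric, real_inner_self_eq_norm_sq, mul_pow]
  apply mul_le_mul_of_nonneg_left _ (sq_nonneg κ)
  have h9 : ‖u‖ ^ 2 / (1 - ‖z‖ ^ 2) + Q z u u / (1 - ‖z‖ ^ 2) ^ 2 =
      (‖u‖ ^ 2 + Q z u u / (1 - ‖z‖ ^ 2)) / (1 - ‖z‖ ^ 2) := by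
    field_simp
  rw [h9, le_div_iff₀ hq]
  exact h6

theorem continuousOn_metric (h : IsLineForm β Q) {c v : ℝ → V} {s : Set ℝ} (hc : ContinuousOn c s)
    (hv : ContinuousOn v s) (hs : ∀ t ∈ s, ‖c t‖ < 1) :
    ContinuousOn (fun t => ballMetric κ Q (c t) (v t) (v t)) s := by
  have hQ : ContinuousOn (fun t => Q (c t) (v t) (v t)) s :=
    h.smooth.continuous.comp_continuousOn (hc.prodMk (hv.prodMk hv))
  have hn : ContinuousOn (fun t => 1 - ‖c t‖ ^ 2) s := continuousOn_const.sub (hc.norm.pow 2)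
  have h0 : ∀ t ∈ s, 1 - ‖c t‖ ^ 2 ≠ 0 := fun t ht => (one_sub_norm_sq_pos (hs t ht)).ne'
  exact continuousOn_const.mul (((hv.inner hv).div hn h0).add
    (hQ.div (hn.pow 2) fun t ht => pow_ne_zero 2 (h0 t ht)))

theorem inner_mem_Ioo {z e : V} (hz : ‖z‖ < 1) (he : ‖e‖ = 1) : ⟪z, e⟫ ∈ Ioo (-1 : ℝ) 1 := by
  have := abs_real_inner_le_norm z e
  rw [he, mul_one] at this
  exact abs_lt.1 (this.trans_lt hz)

theorem le_curveLength (h : IsLineForm β Q) {e : V} (he : ‖e‖ = 1) {c : ℝ → V}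
    (hc : ContDiff ℝ 1 c) (hU : ∀ t ∈ Icc (0 : ℝ) 1, c t ∈ Metric.ball (0 : V) 1) :
    |κ * Real.artanh ⟪c 1, e⟫ - κ * Real.artanh ⟪c 0, e⟫| ≤ curveLength (ballMetric κ Q) c := by
  have hb : ∀ t ∈ Icc (0 : ℝ) 1, ‖c t‖ < 1 := fun t ht => by simpa using hU t ht
  have hc' : Continuous (deriv c) := hc.continuous_deriv le_rfl
  have hd : ∀ t ∈ Icc (0 : ℝ) 1, HasDerivAt (fun t => κ * Real.artanh ⟪c t, e⟫)
      (κ * (⟪deriv c t, e⟫ / (1 - ⟪c t, e⟫ ^ 2))) t := by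
    intro t ht
    have h1 : HasDerivAt (fun t => ⟪c t, e⟫) ⟪deriv c t, e⟫ t := by
      have := ((hc.differentiable (by simp)) t).hasDerivAt.inner ℝ (hasDerivAt_const t e)
      simpa using this
    refine (((hasDerivAt_artanh (inner_mem_Ioo (hb t ht) he)).comp t h1).const_mul κ).congr_deriv ?_
    ring
  have hcontI : ContinuousOn (fun t => κ * (⟪deriv c t, e⟫ / (1 - ⟪c t, e⟫ ^ 2))) (Icc 0 1) := by
    refine continuousOn_const.mul (ContinuousOn.div ?_ ?_ fun t ht => ?_)
    · exact (hc'.inner continuous_const).continuousOn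
    · exact (continuous_const.sub ((hc.continuous.inner continuous_const).pow 2)).continuousOn
    · have := inner_mem_Ioo (hb t ht) he
      have : ⟪c t, e⟫ ^ 2 < 1 := by rw [sq_lt_one_iff_abs_lt_one, abs_lt]; exact this
      linarith
  rw [← uIcc_of_le (zero_le_one' ℝ)] at hcontI
  rw [← intervalIntegral.integral_eq_sub_of_hasDerivAt (fun t ht => hd t (by
    rwa [uIcc_of_le (zero_le_one' ℝ)] at ht)) hcontI.intervalIntegrable]
  refine (intervalIntegral.abs_integral_le_integral_abs zero_le_one).trans ?_
  refine intervalIntegral.integral_mono_on zero_le_one hcontI.intervalIntegrable.abs ?_ ?_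
  · apply ContinuousOn.intervalIntegrable
    rw [uIcc_of_le (zero_le_one' ℝ)]
    exact (h.continuousOn_metric hc.continuous.continuousOn hc'.continuousOn hb).sqrt
  · intro t ht
    exact Real.abs_le_sqrt (h.sq_inner_le_metric (hb t ht) he _)

theorem norm_tanh_smul_lt (κ : ℝ) {e : V} (he : ‖e‖ = 1) (s : ℝ) :
    ‖Real.tanh (s / κ) • e‖ < 1 := by
  rw [norm_smul, he, mul_one, Real.norm_eq_abs]
  exact Real.abs_tanh_lt_one _

/-- The radii, parametrized by arc length, are minimizing geodesics. -/
theorem riemDist_ray (h : IsLineForm β Q) (hκ : 0 < κ) {e : V} (he : ‖e‖ = 1) (s t : ℝ) :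
    riemDist (ballMetric κ Q) (Metric.ball 0 1) (Real.tanh (s / κ) • e) (Real.tanh (t / κ) • e) =
      |s - t| := by
  set c : ℝ → V := fun u => Real.tanh ((s + u * (t - s)) / κ) • e with hcdef
  have hd : ∀ u, HasDerivAt c
      (((1 - Real.tanh ((s + u * (t - s)) / κ) ^ 2) * ((t - s) / κ)) • e) u := by
    intro u
    have h1 : HasDerivAt (fun u : ℝ => (s + u * (t - s)) / κ) ((t - s) / κ) u := by
      simpa using (((hasDerivAt_id u).mul_const (t - s)).const_add s).div_const κ
    exact ((hasDerivAt_tanh _).comp u h1).smul_const e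
  have hc : ContDiff ℝ 1 c := by
    have : ContDiff ℝ 1 fun u : ℝ => (s + u * (t - s)) / κ := by fun_prop
    exact ((contDiff_tanh.of_le (by simp)).comp this).smul contDiff_const
  have hcU : ∀ u ∈ Icc (0 : ℝ) 1, c u ∈ Metric.ball (0 : V) 1 := fun u _ => by
    simpa using norm_tanh_smul_lt κ he _
  have hc0 : c 0 = Real.tanh (s / κ) • e := by simp [hcdef]
  have hc1 : c 1 = Real.tanh (t / κ) • e := by simp [hcdef]
  have hlen : curveLength (ballMetric κ Q) c = |s - t| := by
    have : ∀ u, ballMetric κ Q (c u) (deriv c u) (deriv c u) = (s - t) ^ 2 := by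
      intro u
      set T := Real.tanh ((s + u * (t - s)) / κ) with hT
      have hT1 : T ^ 2 < 1 := Real.tanh_sq_lt_one _
      have hT2 : 1 - T ^ 2 ≠ 0 := by linarith
      have hn : ‖c u‖ ^ 2 = T ^ 2 := by
        simp only [hcdef]
        rw [← hT, norm_smul, he, mul_one, Real.norm_eq_abs, sq_abs]
      have hQ : Q (c u) e e = T ^ 2 := by
        -- `e` is radial if `T ≠ 0`; at the centre `Q` vanishes, by `fderiv_radial` at `0`
        rcases eq_or_ne T 0 with hT0 | hT0
        · have hcu : c u = 0 := by simp only [hcdef]; rw [← hT, hT0, zero_smul]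
          have h1 := h.fderiv_radial (c u) e e
          rw [hcu, map_zero] at h1
          rw [hcu, hT0]
          linarith
        · have h1 := h.radial (c u) e
          have hcu : c u = T • e := rfl
          rw [hn, hcu, h.smul_left, real_inner_smul_left, real_inner_self_eq_norm_sq, he, one_pow,
            mul_one, mul_comm (T ^ 2)] at h1
          exact mul_left_cancel₀ hT0 h1
      rw [(hd u).deriv, h.metric_smul_left, h.metric_smul_right, ballMetric, hQ, hn,
        real_inner_self_eq_norm_sq, he, ← hT]
      field_simp
      ring
    rw [curveLength]
    simp only [this, Real.sqrt_sq_eq_abs]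
    simp
  apply le_antisymm
  · rw [← hlen, ← hc0, ← hc1]
    exact riemDist_le_curveLength _ _ hc hcU
  · refine le_csInf ⟨_, c, hc, hc0, hc1, hcU, rfl⟩ ?_
    rintro L ⟨c, hc, h0, h1, hU, rfl⟩
    refine le_trans (le_of_eq ?_) (h.le_curveLength he hc hU)
    rw [h0, h1, real_inner_smul_left, real_inner_smul_left, real_inner_self_eq_norm_sq, he, one_pow,
      mul_one, mul_one, Real.artanh_tanh, Real.artanh_tanh, mul_div_cancel₀ _ hκ.ne',
      mul_div_cancel₀ _ hκ.ne', abs_sub_comm]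

theorem isGeodesicRay (h : IsLineForm β Q) (hκ : 0 < κ) {e : V} (he : ‖e‖ = 1) :
    IsGeodesicRay (ballMetric κ Q) (Metric.ball 0 1) 0 fun s => Real.tanh (s / κ) • e :=
  ⟨by simp, fun s _ => by simpa using norm_tanh_smul_lt κ he s,
    fun s t _ _ => h.riemDist_ray hκ he s t⟩

theorem riemDist_zero [Nontrivial V] (h : IsLineForm β Q) (hκ : 0 < κ) {x : V} (hx : ‖x‖ < 1) :
    riemDist (ballMetric κ Q) (Metric.ball 0 1) 0 x = κ * Real.artanh ‖x‖ := by
  obtain ⟨e, he, hxe⟩ : ∃ e : V, ‖e‖ = 1 ∧ x = ‖x‖ • e := by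
    rcases eq_or_ne x 0 with rfl | hx0
    · obtain ⟨e, he⟩ := exists_norm_eq V zero_le_one
      exact ⟨e, he, by simp⟩
    · have := norm_ne_zero_iff.2 hx0
      refine ⟨‖x‖⁻¹ • x, norm_smul_inv_norm hx0, ?_⟩
      rw [smul_smul, mul_inv_cancel₀ this, one_smul]
  have hm : ‖x‖ ∈ Ioo (-1 : ℝ) 1 := ⟨by linarith [norm_nonneg x], hx⟩
  have := h.riemDist_ray hκ he 0 (κ * Real.artanh ‖x‖)
  rw [mul_div_cancel_left₀ _ hκ.ne', Real.tanh_artanh hm, ← hxe] at this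
  have h0 : 0 ≤ κ * Real.artanh ‖x‖ := mul_nonneg hκ.le (Real.artanh_nonneg (norm_nonneg x))
  simpa [abs_of_nonneg h0] using this

theorem mem_geodesicSphere [Nontrivial V] (h : IsLineForm β Q) (hκ : 0 < κ) {s : ℝ} {x : V} :
    x ∈ geodesicSphere (ballMetric κ Q) (Metric.ball 0 1) 0 s ↔ 0 ≤ s ∧ ‖x‖ = Real.tanh (s / κ) := by
  constructor
  · rintro ⟨hx, hd⟩
    rw [mem_ball_zero_iff] at hx
    have hm : ‖x‖ ∈ Ioo (-1 : ℝ) 1 := ⟨by linarith [norm_nonneg x], hx⟩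
    rw [h.riemDist_zero hκ hx] at hd
    rw [← hd, mul_div_cancel_left₀ _ hκ.ne', Real.tanh_artanh hm]
    exact ⟨mul_nonneg hκ.le (Real.artanh_nonneg (norm_nonneg x)), rfl⟩
  · rintro ⟨-, hx⟩
    have hx1 : ‖x‖ < 1 := by rw [hx]; exact Real.tanh_lt_one _
    refine ⟨by simpa using hx1, ?_⟩
    rw [h.riemDist_zero hκ hx1, hx, Real.artanh_tanh, mul_div_cancel₀ _ hκ.ne']

end IsLineForm

end Distance

/-! ### Tangent cones of level sets -/

section TangentCone

variable {E : Type*} [NormedAddCommGroup E] [NormedSpace ℝ E]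

theorem fderiv_eq_zero_of_mem_tangentConeAt {S : Set E} {f : E → ℝ} {p : E}
    (hf : DifferentiableAt ℝ f p) (hS : ∀ x ∈ S, f x = 0) (hp : p ∈ S) {X : E}
    (hX : X ∈ tangentConeAt ℝ S p) : fderiv ℝ f p X = 0 := by
  have h1 : HasFDerivWithinAt f (fderiv ℝ f p) S p := hf.hasFDerivAt.hasFDerivWithinAt
  have h2 : HasFDerivWithinAt f (0 : E →L[ℝ] ℝ) S p :=
    (hasFDerivWithinAt_const (0 : ℝ) p S).congr hS (hS p hp)
  exact h1.unique_on h2 hX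

theorem mem_tangentConeAt_of_hasDerivAt {S : Set E} {c : ℝ → E} {X : E} {t : ℝ}
    (hc : HasDerivAt c X t) (hS : ∀ u, c u ∈ S) : X ∈ tangentConeAt ℝ S (c t) := by
  have h := hc.hasFDerivAt.hasFDerivWithinAt (s := univ) |>.mapsTo_tangent_cone
    (show (1 : ℝ) ∈ tangentConeAt ℝ univ t by rw [tangentConeAt_univ]; trivial)
  have h2 : X ∈ tangentConeAt ℝ (c '' univ) (c t) := by simpa using h
  refine tangentConeAt_mono ?_ h2
  rintro _ ⟨u, -, rfl⟩
  exact hS u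

end TangentCone

/-! ### Geodesic spheres -/

section Sphere

variable {V : Type*} [NormedAddCommGroup V] [InnerProductSpace ℝ V]
  {κ : ℝ} {Q : V → V → V → ℝ} {β : Fin (Module.finrank ℝ V - 1) → ℝ}

/-- Vectors orthogonal to the position vector are velocities of curves in the Euclidean sphere. -/
theorem exists_curve_in_sphere {p X : V} (hp : p ≠ 0) (hX : ⟪p, X⟫ = 0) :
    ∃ c : ℝ → V, c 0 = p ∧ HasDerivAt c X 0 ∧ ∀ u, ‖c u‖ = ‖p‖ := by
  rcases eq_or_ne X 0 with rfl | hX0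
  · exact ⟨fun _ => p, rfl, hasDerivAt_const _ _, fun _ => rfl⟩
  have hn : 0 < ‖p‖ := norm_pos_iff.2 hp
  have hm : 0 < ‖X‖ := norm_pos_iff.2 hX0
  set a : ℝ := ‖X‖ / ‖p‖ with ha
  have ha0 : 0 < a := by positivity
  have hXa : ‖X‖ = a * ‖p‖ := by rw [ha]; field_simp
  refine ⟨fun u => Real.cos (a * u) • p + (Real.sin (a * u) / a) • X, by simp, ?_, fun u => ?_⟩
  · have h1 : HasDerivAt (fun u : ℝ => a * u) a 0 := by simpa using (hasDerivAt_id (0 : ℝ)).const_mul a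
    have h2 := (((Real.hasDerivAt_cos _).comp 0 h1).smul_const p).add
      ((((Real.hasDerivAt_sin _).comp 0 h1).div_const a).smul_const X)
    refine h2.congr_deriv ?_
    simp [ha0.ne']
  · rw [← sq_eq_sq₀ (norm_nonneg _) (norm_nonneg _), norm_add_sq_real, norm_smul, norm_smul, mul_pow,
      mul_pow, real_inner_smul_left, real_inner_smul_right, hX, Real.norm_eq_abs, Real.norm_eq_abs,
      sq_abs, sq_abs, hXa]
    have h1 := Real.sin_sq_add_cos_sq (a * u)
    have h2 : (Real.sin (a * u) / a) ^ 2 * (a * ‖p‖) ^ 2 = Real.sin (a * u) ^ 2 * ‖p‖ ^ 2 := by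
      clear_value a
      field_simp
    linear_combination ‖p‖ ^ 2 * h1 + h2

/-- The factor that normalizes the position vector. -/
noncomputable def radialFactor (κ : ℝ) (y : V) : ℝ := (1 - ‖y‖ ^ 2) / (κ * ‖y‖)

theorem contDiffAt_radialFactor (hκ : 0 < κ) {x : V} (hx : x ≠ 0) :
    ContDiffAt ℝ ∞ (radialFactor κ : V → ℝ) x :=
  (contDiffAt_const.sub (contDiff_norm_sq ℝ).contDiffAt).div
    (contDiffAt_const.mul (contDiffAt_norm ℝ hx)) (mul_pos hκ (norm_pos_iff.2 hx)).ne'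

theorem fderiv_radialFactor (hκ : 0 < κ) {x : V} (hx : x ≠ 0) (X : V) :
    fderiv ℝ (radialFactor κ : V → ℝ) x X = -(1 + ‖x‖ ^ 2) / (κ * ‖x‖ ^ 3) * ⟪x, X⟫ := by
  have hn : 0 < ‖x‖ := norm_pos_iff.2 hx
  have h1 : HasFDerivAt (fun y : V => ‖y‖ ^ 2) (2 • innerSL ℝ x) x :=
    (hasStrictFDerivAt_norm_sq x).hasFDerivAt
  have h2 : HasDerivAt (fun q : ℝ => (1 - q) / (κ * √q))
      (((-1) * (κ * √(‖x‖ ^ 2)) - (1 - ‖x‖ ^ 2) * (κ * (1 / (2 * √(‖x‖ ^ 2))))) /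
        (κ * √(‖x‖ ^ 2)) ^ 2) (‖x‖ ^ 2) :=
    ((hasDerivAt_id _).const_sub 1).div ((Real.hasDerivAt_sqrt (by positivity)).const_mul κ)
      (by rw [Real.sqrt_sq hn.le]; positivity)
  have h3 := h2.comp_hasFDerivAt x h1
  have e : (radialFactor κ : V → ℝ) = (fun q : ℝ => (1 - q) / (κ * √q)) ∘ fun y : V => ‖y‖ ^ 2 := by
    funext y
    simp [radialFactor]
  rw [e, h3.fderiv, Real.sqrt_sq hn.le]
  simp [innerSL_apply_apply]
  field_simp
  ring

theorem fderiv_unit_radial (hκ : 0 < κ) {x : V} (hx : x ≠ 0) {X : V} (hX : ⟪x, X⟫ = 0) :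
    fderiv ℝ (fun y : V => radialFactor κ y • y) x X = radialFactor κ x • X := by
  have h1 := ((contDiffAt_radialFactor hκ hx).differentiableAt (by simp)).hasFDerivAt.smul
    (hasFDerivAt_id x)
  have h2 := h1.fderiv
  simp only [id] at h2
  have h3 : fderiv ℝ (fun y : V => radialFactor κ y • y) x = _ := h2
  rw [h3]
  simp [fderiv_radialFactor hκ hx, hX]

namespace IsLineForm

theorem metric_self_radial (h : IsLineForm β Q) (hκ : 0 < κ) {x : V} (hx : x ≠ 0) (hx1 : ‖x‖ < 1) :
    radialFactor κ x ^ 2 * ballMetric κ Q x x x = 1 := by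
  have hn : 0 < ‖x‖ := norm_pos_iff.2 hx
  have := one_sub_norm_sq_pos hx1
  rw [h.metric_radial hx1, real_inner_self_eq_norm_sq, radialFactor]
  field_simp

theorem metric_pos (h : IsLineForm β Q) (hκ : 0 < κ) {x w : V} (hx : ‖x‖ < 1) (hw : w ≠ 0) :
    0 < ballMetric κ Q x w w := by
  have := one_sub_norm_sq_pos hx
  have h1 : 0 ≤ Q x w w := (sq_nonneg _).trans (h.inner_sq_le x w)
  have h2 : 0 < ‖w‖ := norm_pos_iff.2 hw
  rw [ballMetric, real_inner_self_eq_norm_sq]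
  positivity

/-- The form `Q x` as a bilinear map. -/
def form (h : IsLineForm β Q) (x : V) : V →ₗ[ℝ] V →ₗ[ℝ] ℝ :=
  LinearMap.mk₂ ℝ (Q x) (h.add_left x) (h.smul_left x)
    (fun u v v' => by rw [h.symm, h.add_left, h.symm x v, h.symm x v'])
    (fun a u v => by rw [h.symm, h.smul_left, h.symm x v]; rfl)

end IsLineForm

/-- Two orthonormal bases that diagonalize the same bilinear form have eigenvalues with the same
symmetric functions. -/
theorem esymmFn_eq_of_bases [FiniteDimensional ℝ V] {ι : Type*} [Fintype ι] [DecidableEq ι]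
    (G Φ : V →ₗ[ℝ] V →ₗ[ℝ] ℝ) (W : Submodule ℝ V) (hW : Module.finrank ℝ W = Fintype.card ι)
    {e f : ι → V} (he : ∀ i, e i ∈ W) (hf : ∀ i, f i ∈ W)
    (hGe : ∀ i j, G (e i) (e j) = if i = j then 1 else 0)
    (hGf : ∀ i j, G (f i) (f j) = if i = j then 1 else 0) {k k' : ι → ℝ}
    (hΦe : ∀ i j, Φ (e i) (e j) = if i = j then k' i else 0)
    (hΦf : ∀ i j, Φ (f i) (f j) = if i = j then k i else 0) (r : ℕ) :
    esymmFn r k' = esymmFn r k := by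
  have hli : LinearIndependent ℝ f := by
    rw [Fintype.linearIndependent_iff]
    intro a ha i
    have := congrArg (fun v => G v (f i)) ha
    simpa [hGf] using this
  have hspan : Submodule.span ℝ (range f) = W := by
    refine Submodule.eq_of_le_of_finrank_eq (Submodule.span_le.2 (range_subset_iff.2 hf)) ?_
    rw [finrank_span_eq_card hli, hW]
  have hex : ∀ i, ∃ c : ι → ℝ, ∑ j, c j • f j = e i := fun i =>
    (Submodule.mem_span_range_iff_exists_fun ℝ).1 (hspan ▸ he i)
  choose P hP using hex
  have hG : ∀ i j, G (e i) (e j) = ∑ a, P i a * P j a := by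
    intro i j
    rw [← hP i, ← hP j]
    simp [hGf, mul_comm]
  have hΦ : ∀ i j, Φ (e i) (e j) = ∑ a, P i a * k a * P j a := by
    intro i j
    rw [← hP i, ← hP j]
    simp only [map_sum, map_smul, LinearMap.sum_apply, LinearMap.smul_apply, hΦf, smul_eq_mul,
      mul_ite, mul_zero]
    refine Finset.sum_congr rfl fun a _ => ?_
    simp
    ring
  refine esymmFn_eq_of_orthogonal r (Matrix.of P) ?_ k k' ?_
  · ext i j
    rw [Matrix.mul_apply, Matrix.one_apply, ← hGe, hG]
    rfl
  · ext i j
    rw [Matrix.mul_apply, Matrix.diagonal_apply, ← hΦe, hΦ]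
    simp [Matrix.mul_diagonal]

end Sphere

/-! ### The mean curvatures of geodesic spheres -/

section SphereCurvature

theorem radialFactor_pos {V : Type*} [NormedAddCommGroup V] {κ : ℝ} (hκ : 0 < κ)
    {x : V} (hx : x ≠ 0) (hx1 : ‖x‖ < 1) :
    0 < radialFactor κ x :=
  div_pos (one_sub_norm_sq_pos hx1) (mul_pos hκ (norm_pos_iff.2 hx))

variable {V : Type*} [NormedAddCommGroup V] [InnerProductSpace ℝ V]
  {κ : ℝ} {Q : V → V → V → ℝ} {β : Fin (Module.finrank ℝ V - 1) → ℝ}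

/-- The shape operator of the sphere through `x`, with respect to the inward normal:
`g (∇_X N, Y) = shapeForm κ Q x X Y` for the outward unit normal `N` and vectors `X`, `Y` tangent to
the sphere. -/
noncomputable def shapeForm (κ : ℝ) (Q : V → V → V → ℝ) (x X Y : V) : ℝ :=
  (1 - ‖x‖ ^ 2) / (κ * ‖x‖) * (ballMetric κ Q x X Y + koszul (ballMetric κ Q) x X x Y)

namespace IsLineForm

theorem covDerivInner_of_radial (h : IsLineForm β Q) {N : V → V} {x X : V} (hx1 : ‖x‖ < 1)
    (hN : N x = radialFactor κ x • x) (hN' : fderiv ℝ N x X = radialFactor κ x • X) (Y : V) :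
    covDerivInner (ballMetric κ Q) N x X Y = shapeForm κ Q x X Y := by
  have := h.koszul_smul (κ := κ) hx1 1 (radialFactor κ x) 1 X x Y
  simp only [one_smul, one_mul, mul_one] at this
  rw [covDerivInner, hN, hN', h.metric_smul_left, this, shapeForm, radialFactor]
  ring

theorem exists_metric_bilin (h : IsLineForm β Q) (κ : ℝ) (x : V) :
    ∃ G : V →ₗ[ℝ] V →ₗ[ℝ] ℝ, ∀ X Y, G X Y = ballMetric κ Q x X Y := by
  refine ⟨(κ ^ 2 / (1 - ‖x‖ ^ 2)) • innerₗ V + (κ ^ 2 / (1 - ‖x‖ ^ 2) ^ 2) • h.form x,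
    fun X Y => ?_⟩
  simp only [LinearMap.add_apply, LinearMap.smul_apply, innerₗ_apply_apply, smul_eq_mul, form,
    LinearMap.mk₂_apply, ballMetric]
  ring

theorem exists_shape_bilin (h : IsLineForm β Q) (κ : ℝ) {x : V} (hx1 : ‖x‖ < 1) :
    ∃ Φ : V →ₗ[ℝ] V →ₗ[ℝ] ℝ, ∀ X Y, ⟪x, X⟫ = 0 → ⟪x, Y⟫ = 0 → Φ X Y = shapeForm κ Q x X Y := by
  set q := ‖x‖ ^ 2 with hq
  refine ⟨((1 - q) / (κ * ‖x‖) * κ ^ 2 * (1 / (1 - q) + q / (1 - q) ^ 2)) • innerₗ V +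
    ((1 - q) / (κ * ‖x‖) * κ ^ 2 * (1 / (1 - q) ^ 2 + 1 / (1 - q) ^ 2 + 2 * q / (1 - q) ^ 3)) •
      h.form x, fun X Y hX hY => ?_⟩
  simp only [LinearMap.add_apply, LinearMap.smul_apply, innerₗ_apply_apply, smul_eq_mul, form,
    LinearMap.mk₂_apply]
  rw [shapeForm, h.koszul_tangent hx1 hX hY, ballMetric, ← hq]
  ring

theorem finrank_perp [FiniteDimensional ℝ V] {x : V} (hx : x ≠ 0) :
    Module.finrank ℝ (ℝ ∙ x)ᗮ = Fintype.card (Fin (Module.finrank ℝ V - 1)) := by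
  have hpos : 0 < Module.finrank ℝ V := Module.finrank_pos_iff_exists_ne_zero.2 ⟨x, hx⟩
  have : Fact (Module.finrank ℝ V = Module.finrank ℝ V - 1 + 1) := ⟨by omega⟩
  rw [Submodule.finrank_orthogonal_span_singleton (n := Module.finrank ℝ V - 1) hx,
    Fintype.card_fin]

theorem mem_perp {x y : V} : y ∈ (ℝ ∙ x)ᗮ ↔ ⟪x, y⟫ = 0 :=
  Submodule.mem_orthogonal_singleton_iff_inner_right

variable [Nontrivial V]

theorem ne_zero_of_mem_geodesicSphere (h : IsLineForm β Q) (hκ : 0 < κ) {s : ℝ} (hs : 0 < s) {x : V}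
    (hx : x ∈ geodesicSphere (ballMetric κ Q) (Metric.ball 0 1) 0 s) : x ≠ 0 := by
  have h1 := (h.mem_geodesicSphere hκ).1 hx
  rw [← norm_pos_iff, h1.2]
  exact tanh_pos_of_pos (div_pos hs hκ)

theorem norm_lt_of_mem_geodesicSphere (h : IsLineForm β Q) (hκ : 0 < κ) {s : ℝ} {x : V}
    (hx : x ∈ geodesicSphere (ballMetric κ Q) (Metric.ball 0 1) 0 s) : ‖x‖ < 1 := by
  rw [((h.mem_geodesicSphere hκ).1 hx).2]
  exact Real.tanh_lt_one _

theorem isSmoothHypersurface_sphere (h : IsLineForm β Q) (hκ : 0 < κ) {s : ℝ} (hs : 0 < s) :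
    IsSmoothHypersurface (geodesicSphere (ballMetric κ Q) (Metric.ball 0 1) 0 s) := by
  intro p hp
  have hρ := tanh_pos_of_pos (div_pos hs hκ)
  refine ⟨{x | x ≠ 0}, isOpen_ne, h.ne_zero_of_mem_geodesicSphere hκ hs hp,
    fun x => ‖x‖ ^ 2 - Real.tanh (s / κ) ^ 2,
    ((contDiff_norm_sq ℝ).sub contDiff_const).contDiffOn, fun x hx h0 => ?_, ?_⟩
  · have h1 : HasFDerivAt (fun x : V => ‖x‖ ^ 2 - Real.tanh (s / κ) ^ 2) (2 • innerSL ℝ x) x :=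
      (hasStrictFDerivAt_norm_sq x).hasFDerivAt.sub_const _
    rw [h1.fderiv] at h0
    have h2 := DFunLike.congr_fun h0 x
    simp [innerSL_apply_apply] at h2
    exact hx h2
  · ext x
    simp only [mem_inter_iff, h.mem_geodesicSphere hκ, mem_ofPred_eq, sub_eq_zero,
      sq_eq_sq₀ (norm_nonneg x) hρ.le]
    constructor
    · rintro ⟨⟨-, h1⟩, h2⟩
      exact ⟨h2, h1⟩
    · rintro ⟨h2, h1⟩
      exact ⟨⟨hs.le, h1⟩, h2⟩

theorem mem_tangentCone_sphere (h : IsLineForm β Q) (hκ : 0 < κ) {s : ℝ} (hs : 0 < s) {p X : V}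
    (hp : p ∈ geodesicSphere (ballMetric κ Q) (Metric.ball 0 1) 0 s) :
    X ∈ tangentConeAt ℝ (geodesicSphere (ballMetric κ Q) (Metric.ball 0 1) 0 s) p ↔
      ⟪p, X⟫ = 0 := by
  constructor
  · intro hX
    have h1 : HasFDerivAt (fun x : V => ‖x‖ ^ 2 - Real.tanh (s / κ) ^ 2) (2 • innerSL ℝ p) p :=
      (hasStrictFDerivAt_norm_sq p).hasFDerivAt.sub_const _
    have h2 := fderiv_eq_zero_of_mem_tangentConeAt h1.differentiableAt (fun x hx => by
      rw [((h.mem_geodesicSphere hκ).1 hx).2, sub_self]) hp hX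
    rw [h1.fderiv] at h2
    simpa [innerSL_apply_apply] using h2
  · intro hX
    obtain ⟨c, hc0, hc, hcn⟩ :=
      exists_curve_in_sphere (h.ne_zero_of_mem_geodesicSphere hκ hs hp) hX
    have := mem_tangentConeAt_of_hasDerivAt hc
      (S := geodesicSphere (ballMetric κ Q) (Metric.ball 0 1) 0 s) (fun u => by
        rw [h.mem_geodesicSphere hκ, hcn]
        exact (h.mem_geodesicSphere hκ).1 hp)
    rwa [hc0] at this

theorem lt_riemDist_iff (h : IsLineForm β Q) (hκ : 0 < κ) {s : ℝ} {x : V} (hx : ‖x‖ < 1) :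
    s < riemDist (ballMetric κ Q) (Metric.ball 0 1) 0 x ↔ Real.tanh (s / κ) < ‖x‖ := by
  have hm : ‖x‖ ∈ Ioo (-1 : ℝ) 1 := ⟨by linarith [norm_nonneg x], hx⟩
  rw [h.riemDist_zero hκ hx, ← div_lt_iff₀' hκ, ← strictMono_tanh.lt_iff_lt, Real.tanh_artanh hm]

/-- A radial vector `a • p` at a point `p` of a sphere points outward if and only if `a > 0`. -/
theorem outward_radial (h : IsLineForm β Q) (hκ : 0 < κ) {s : ℝ} (hs : 0 < s) {p : V}
    (hp : p ∈ geodesicSphere (ballMetric κ Q) (Metric.ball 0 1) 0 s) {a : ℝ} :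
    (∀ᶠ t : ℝ in 𝓝[>] 0, s < riemDist (ballMetric κ Q) (Metric.ball 0 1) 0 (p + t • (a • p))) ↔
      0 < a := by
  have hp0 : 0 < ‖p‖ := norm_pos_iff.2 (h.ne_zero_of_mem_geodesicSphere hκ hs hp)
  have hp1 := h.norm_lt_of_mem_geodesicSphere hκ hp
  have hps := ((h.mem_geodesicSphere hκ).1 hp).2
  have hc : Continuous fun t : ℝ => p + t • (a • p) := by fun_prop
  have hev : ∀ᶠ t : ℝ in 𝓝[>] 0, ‖p + t • (a • p)‖ < 1 := by
    refine nhdsWithin_le_nhds (hc.norm.continuousAt.eventually_lt continuousAt_const ?_)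
    simpa using hp1
  have hev2 : ∀ᶠ t : ℝ in 𝓝[>] 0, 0 < 1 + t * a := by
    have hc2 : Continuous fun t : ℝ => 1 + t * a := by fun_prop
    refine nhdsWithin_le_nhds (continuousAt_const.eventually_lt hc2.continuousAt ?_)
    simp
  have key : ∀ᶠ t : ℝ in 𝓝[>] 0,
      (s < riemDist (ballMetric κ Q) (Metric.ball 0 1) 0 (p + t • (a • p)) ↔ 0 < a) := by
    filter_upwards [hev, hev2, self_mem_nhdsWithin] with t ht ht2 ht0
    have ht0' : 0 < t := ht0
    have e : p + t • (a • p) = (1 + t * a) • p := by rw [add_smul, one_smul, mul_smul]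
    rw [h.lt_riemDist_iff hκ ht, e, norm_smul, Real.norm_eq_abs, abs_of_pos ht2, ← hps]
    constructor
    · intro h1
      have h2 : 0 < t * a * ‖p‖ := by linarith
      have h3 : 0 < t * a := (mul_pos_iff_of_pos_right hp0).1 h2
      exact (mul_pos_iff_of_pos_left ht0').1 h3
    · intro h1
      have : 0 < t * a * ‖p‖ := by positivity
      linarith
  constructor
  · intro h1
    obtain ⟨t, ht1, ht2⟩ := (h1.and key).exists
    exact ht2.1 ht1
  · intro h1
    filter_upwards [key] with t ht using ht.2 h1

/-- An outward unit normal field of a geodesic sphere is the normalized position vector. -/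
theorem unitNormal_eq (h : IsLineForm β Q) (hκ : 0 < κ) {s : ℝ} (hs : 0 < s) {N : V → V} {p : V}
    (hN : IsUnitNormal (ballMetric κ Q) (geodesicSphere (ballMetric κ Q) (Metric.ball 0 1) 0 s) N)
    (hp : p ∈ geodesicSphere (ballMetric κ Q) (Metric.ball 0 1) 0 s)
    (hout : ∀ᶠ t : ℝ in 𝓝[>] 0,
      s < riemDist (ballMetric κ Q) (Metric.ball 0 1) 0 (p + t • N p)) :
    N p = radialFactor κ p • p := by
  have hp0 := h.ne_zero_of_mem_geodesicSphere hκ hs hp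
  have hp1 := h.norm_lt_of_mem_geodesicSphere hκ hp
  have hn : 0 < ‖p‖ := norm_pos_iff.2 hp0
  obtain ⟨-, hunit, hperp⟩ := hN p hp
  set a := ⟪p, N p⟫ / ‖p‖ ^ 2 with ha
  set w := N p - a • p with hw
  have hpw : ⟪p, w⟫ = 0 := by
    rw [hw, inner_sub_right, real_inner_smul_right, real_inner_self_eq_norm_sq, ha]
    field_simp
    ring
  have hNw : N p = a • p + w := by rw [hw]; abel
  have h1 := hperp w ((h.mem_tangentCone_sphere hκ hs hp).2 hpw)
  rw [hNw, h.metric_add_left, h.metric_smul_left, h.metric_radial hp1, hpw, mul_zero, zero_div,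
    mul_zero, zero_add] at h1
  have hw0 : w = 0 := by
    by_contra hne
    exact (h.metric_pos hκ hp1 hne).ne' h1
  rw [hw0, add_zero] at hNw
  rw [hNw] at hout
  have hapos := (h.outward_radial hκ hs hp).1 hout
  rw [hNw, h.metric_smul_left, h.metric_smul_right] at hunit
  have h2 := h.metric_self_radial hκ hp0 hp1
  have hg := h.metric_pos hκ hp1 hp0
  have h3 : a ^ 2 = radialFactor κ p ^ 2 := by
    apply mul_right_cancel₀ hg.ne'
    rw [h2, ← hunit]
    ring
  rw [hNw, (sq_eq_sq₀ hapos.le (radialFactor_pos hκ hp0 hp1).le).1 h3]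

theorem isSphereMeanCurv (h : IsLineForm β Q) (hκ : 0 < κ) (hβ : ∀ i, β i = 0 ∨ β i = 1) {s : ℝ}
    (hs : 0 < s) (k : ℕ) :
    IsSphereMeanCurv (ballMetric κ Q) (Metric.ball 0 1) 0 k s
      ((-1) ^ k * radialEsymm κ β k s) := by
  refine ⟨h.isSmoothHypersurface_sphere hκ hs, fun y => radialFactor κ y • y, fun p hp => ?_,
    fun p hp => ?_⟩
  · have hp0 := h.ne_zero_of_mem_geodesicSphere hκ hs hp
    have hp1 := h.norm_lt_of_mem_geodesicSphere hκ hp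
    refine ⟨(contDiffAt_radialFactor hκ hp0).smul contDiffAt_id, ?_, fun X hX => ?_⟩
    · rw [h.metric_smul_left, h.metric_smul_right, ← mul_assoc, ← sq, h.metric_self_radial hκ hp0 hp1]
    · rw [h.metric_smul_left, h.metric_radial hp1, (h.mem_tangentCone_sphere hκ hs hp).1 hX]
      simp
  · have hp0 := h.ne_zero_of_mem_geodesicSphere hκ hs hp
    have hp1 := h.norm_lt_of_mem_geodesicSphere hκ hp
    refine ⟨(h.outward_radial hκ hs hp).2 (radialFactor_pos hκ hp0 hp1), ?_⟩
    obtain ⟨f, hf, hgf, hkf⟩ := h.exists_principal_basis hκ hβ hp0 hp1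
    refine ⟨fun i => (-1) * radialCurv κ β s i, ⟨f, hgf, fun i => ?_, fun i j => ?_⟩, ?_⟩
    · rw [h.metric_smul_right, h.metric_symm, h.metric_radial hp1, hf]
      simp
    · rw [secondFundForm, h.covDerivInner_of_radial (N := fun y : V => radialFactor κ y • y) hp1 rfl
        (fderiv_unit_radial hκ hp0 (hf i)),
        shapeForm, hkf, ((h.mem_geodesicSphere hκ).1 hp).2]
      split_ifs <;> simp [radialCurv]
    · exact (esymmFn_smul k (-1) _).symm

/-- The outward unit normal field is determined along the sphere, and so are its derivatives in
tangential directions, hence the mean curvatures; they do not depend on the principal basis. -/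
theorem sphereMeanCurv_unique [FiniteDimensional ℝ V] (h : IsLineForm β Q) (hκ : 0 < κ)
    (hβ : ∀ i, β i = 0 ∨ β i = 1) {s : ℝ} (hs : 0 < s) {k : ℕ} {H : ℝ}
    (hH : IsSphereMeanCurv (ballMetric κ Q) (Metric.ball 0 1) 0 k s H) :
    H = (-1) ^ k * radialEsymm κ β k s := by
  obtain ⟨-, N, hN, hcurv⟩ := hH
  have hNeq : ∀ p ∈ geodesicSphere (ballMetric κ Q) (Metric.ball 0 1) 0 s,
      N p = radialFactor κ p • p := fun p hp => h.unitNormal_eq hκ hs hN hp (hcurv p hp).1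
  obtain ⟨p, hp⟩ := exists_norm_eq V (tanh_pos_of_pos (div_pos hs hκ)).le
  have hpS : p ∈ geodesicSphere (ballMetric κ Q) (Metric.ball 0 1) 0 s :=
    (h.mem_geodesicSphere hκ).2 ⟨hs.le, hp⟩
  have hp0 := h.ne_zero_of_mem_geodesicSphere hκ hs hpS
  have hp1 := h.norm_lt_of_mem_geodesicSphere hκ hpS
  obtain ⟨k', ⟨e, hge, heN, hke⟩, rfl⟩ := (hcurv p hpS).2
  have hrf := radialFactor_pos hκ hp0 hp1
  have hpe : ∀ i, ⟪p, e i⟫ = 0 := by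
    intro i
    have h1 := heN i
    rw [hNeq p hpS, h.metric_smul_right, h.metric_symm, h.metric_radial hp1] at h1
    have h2 : 0 < radialFactor κ p * (κ ^ 2 / (1 - ‖p‖ ^ 2) ^ 2) := by
      have := one_sub_norm_sq_pos hp1
      positivity
    have h3 : radialFactor κ p * (κ ^ 2 / (1 - ‖p‖ ^ 2) ^ 2) * ⟪p, e i⟫ = 0 := by
      rw [← h1]; ring
    exact (mul_eq_zero.1 h3).resolve_left h2.ne'
  -- the derivatives of `N` along the sphere are determined by the values of `N` on the sphere
  have hfd : ∀ i, fderiv ℝ N p (e i) = radialFactor κ p • e i := by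
    intro i
    obtain ⟨c, hc0, hc, hcn⟩ := exists_curve_in_sphere hp0 (hpe i)
    have hcS : ∀ u, c u ∈ geodesicSphere (ballMetric κ Q) (Metric.ball 0 1) 0 s := fun u => by
      rw [h.mem_geodesicSphere hκ, hcn]
      exact (h.mem_geodesicSphere hκ).1 hpS
    have h1 : HasDerivAt (N ∘ c) (fderiv ℝ N p (e i)) 0 := by
      have := ((hN p hpS).1.differentiableAt (by simp)).hasFDerivAt
      rw [← hc0] at this
      have h2 := this.comp_hasDerivAt 0 hc
      rwa [hc0] at h2
    have hd : DifferentiableAt ℝ (fun y : V => radialFactor κ y • y) p :=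
      ((contDiffAt_radialFactor hκ hp0).smul contDiffAt_id).differentiableAt (by simp)
    have h2 : HasDerivAt ((fun y : V => radialFactor κ y • y) ∘ c)
        (fderiv ℝ (fun y : V => radialFactor κ y • y) p (e i)) 0 := by
      have := hd.hasFDerivAt
      rw [← hc0] at this
      have h2 := this.comp_hasDerivAt 0 hc
      rwa [hc0] at h2
    have h3 : N ∘ c = (fun y : V => radialFactor κ y • y) ∘ c := funext fun u => hNeq _ (hcS u)
    rw [h3] at h1
    rw [h1.unique h2, fderiv_unit_radial hκ hp0 (hpe i)]
  obtain ⟨f, hf, hgf, hkf⟩ := h.exists_principal_basis hκ hβ hp0 hp1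
  obtain ⟨G, hG⟩ := h.exists_metric_bilin κ p
  obtain ⟨Φ, hΦ⟩ := h.exists_shape_bilin κ hp1
  rw [radialEsymm, ← esymmFn_smul]
  refine esymmFn_eq_of_bases G (-Φ) _ (finrank_perp hp0) (fun i => mem_perp.2 (hpe i))
    (fun i => mem_perp.2 (hf i)) (fun i j => by rw [hG, hge]) (fun i j => by rw [hG, hgf])
    (fun i j => ?_) (fun i j => ?_) k
  · rw [LinearMap.neg_apply, LinearMap.neg_apply, hΦ _ _ (hpe i) (hpe j), ← hke, secondFundForm,
      h.covDerivInner_of_radial hp1 (hNeq p hpS) (hfd i)]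
  · rw [LinearMap.neg_apply, LinearMap.neg_apply, hΦ _ _ (hf i) (hf j), shapeForm, hkf, hp,
      radialCurv]
    split_ifs <;> simp

end IsLineForm

end SphereCurvature

/-! ### Rotational hypersurfaces -/

section Tube

/-- The rotational hypersurface whose section at height `t` is the geodesic sphere of radius
`σ t`, that is, the Euclidean sphere of radius `tanh (σ t / κ)`. -/
def tube (V : Type*) [NormedAddCommGroup V] (κ : ℝ) (σ : ℝ → ℝ) : Set (V × ℝ) :=
  {p | ‖p.1‖ = Real.tanh (σ p.2 / κ)}

theorem tube_ne_zero {V : Type*} [NormedAddCommGroup V] {κ : ℝ} {σ : ℝ → ℝ} (hκ : 0 < κ)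
    (hpos : ∀ t, 0 < σ t) {p : V × ℝ} (hp : p ∈ tube V κ σ) :
    p.1 ≠ 0 := by
  have hp' : ‖p.1‖ = _ := hp
  rw [← norm_pos_iff, hp']
  exact tanh_pos_of_pos (div_pos (hpos _) hκ)

theorem tube_norm_lt {V : Type*} [NormedAddCommGroup V] {κ : ℝ} {σ : ℝ → ℝ} {p : V × ℝ}
    (hp : p ∈ tube V κ σ) : ‖p.1‖ < 1 := by
  have hp' : ‖p.1‖ = _ := hp
  rw [hp']
  exact Real.tanh_lt_one _

variable {V : Type*} [NormedAddCommGroup V] [InnerProductSpace ℝ V]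
  {κ : ℝ} {Q : V → V → V → ℝ} {β : Fin (Module.finrank ℝ V - 1) → ℝ} {σ : ℝ → ℝ}

/-- The factor `(1 + σ'²)^{-1/2}`, the cosine of the angle between the profile and the axis. -/
noncomputable def tubeAngle (σ : ℝ → ℝ) (t : ℝ) : ℝ := (√(1 + deriv σ t ^ 2))⁻¹

/-- The inward unit normal `(1 + σ'²)^{-1/2} (σ' ∂_t - ∂_s)` of the tube. -/
noncomputable def tubeNormal (κ : ℝ) (σ : ℝ → ℝ) (p : V × ℝ) : V × ℝ :=
  (-(radialFactor κ p.1 * tubeAngle σ p.2) • p.1, deriv σ p.2 * tubeAngle σ p.2)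

theorem contDiff_tubeRadius (κ : ℝ) (hσ : ContDiff ℝ ∞ σ) :
    ContDiff ℝ ∞ fun t => Real.tanh (σ t / κ) :=
  contDiff_tanh.comp (hσ.div_const κ)

theorem hasDerivAt_tubeRadius (κ : ℝ) (hσ : ContDiff ℝ ∞ σ) (t : ℝ) :
    HasDerivAt (fun t => Real.tanh (σ t / κ))
      ((1 - Real.tanh (σ t / κ) ^ 2) * (deriv σ t / κ)) t :=
  (hasDerivAt_tanh _).comp t ((hσ.differentiable (by simp) t).hasDerivAt.div_const κ)

theorem hasFDerivAt_tubeFn (κ : ℝ) (hσ : ContDiff ℝ ∞ σ) (p : V × ℝ) :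
    DifferentiableAt ℝ (fun p : V × ℝ => ‖p.1‖ ^ 2 - Real.tanh (σ p.2 / κ) ^ 2) p ∧
      ∀ X, fderiv ℝ (fun p : V × ℝ => ‖p.1‖ ^ 2 - Real.tanh (σ p.2 / κ) ^ 2) p X =
        2 * ⟪p.1, X.1⟫ - 2 * Real.tanh (σ p.2 / κ) *
          ((1 - Real.tanh (σ p.2 / κ) ^ 2) * (deriv σ p.2 / κ)) * X.2 := by
  have h1 : HasFDerivAt (fun p : V × ℝ => ‖p.1‖ ^ 2) _ p :=
    (hasStrictFDerivAt_norm_sq p.1).hasFDerivAt.comp p hasFDerivAt_fst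
  have hs : HasFDerivAt (fun p : V × ℝ => p.2) (ContinuousLinearMap.snd ℝ V ℝ) p := hasFDerivAt_snd
  have h2 : HasFDerivAt (fun p : V × ℝ => Real.tanh (σ p.2 / κ) ^ 2) _ p :=
    ((hasDerivAt_tubeRadius κ hσ p.2).pow 2).comp_hasFDerivAt p hs
  refine ⟨(h1.sub h2).differentiableAt, fun X => ?_⟩
  have h3 := (h1.sub h2).fderiv
  have h4 : fderiv ℝ (fun p : V × ℝ => ‖p.1‖ ^ 2 - Real.tanh (σ p.2 / κ) ^ 2) p = _ := h3
  rw [h4]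
  simp [innerSL_apply_apply]

/-- Tangent vectors of the tube satisfy `X_s = σ' X_t`. -/
theorem inner_of_mem_tangentCone_tube (hσ : ContDiff ℝ ∞ σ) {p X : V × ℝ} (hp : p ∈ tube V κ σ)
    (hX : X ∈ tangentConeAt ℝ (tube V κ σ) p) :
    ⟪p.1, X.1⟫ = ‖p.1‖ * (1 - ‖p.1‖ ^ 2) * (deriv σ p.2 / κ) * X.2 := by
  obtain ⟨h1, h2⟩ := hasFDerivAt_tubeFn κ hσ p
  have h3 := fderiv_eq_zero_of_mem_tangentConeAt h1 (fun x hx => by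
    have hx' : ‖x.1‖ = _ := hx
    rw [hx', sub_self]) hp hX
  have hp' : ‖p.1‖ = _ := hp
  rw [h2, ← hp'] at h3
  linarith

theorem isProperlyEmbedded_tube (hκ : 0 < κ) (hσ : ContDiff ℝ ∞ σ) (hpos : ∀ t, 0 < σ t) :
    IsProperlyEmbedded (Metric.ball (0 : V) 1 ×ˢ univ) (tube V κ σ) := by
  refine ⟨fun p hp => ⟨by simpa using tube_norm_lt hp, trivial⟩, fun p hp => ?_, ?_⟩
  · refine ⟨{x | x.1 ≠ 0}, isOpen_ne.preimage continuous_fst, tube_ne_zero hκ hpos hp,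
      fun p => ‖p.1‖ ^ 2 - Real.tanh (σ p.2 / κ) ^ 2, ContDiff.contDiffOn ?_, fun x hx h0 => ?_, ?_⟩
    · exact ((contDiff_norm_sq ℝ).comp contDiff_fst).sub
        (((contDiff_tubeRadius κ hσ).comp contDiff_snd).pow 2)
    · have h2 := (hasFDerivAt_tubeFn κ hσ x).2 (x.1, 0)
      rw [h0] at h2
      simp only [zero_apply, mul_zero, sub_zero] at h2
      exact hx (by simpa using h2)
    · ext x
      have hρ := tanh_pos_of_pos (div_pos (hpos x.2) hκ)
      simp only [mem_inter_iff, tube, mem_ofPred_eq, sub_eq_zero,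
        sq_eq_sq₀ (norm_nonneg x.1) hρ.le]
      exact and_comm
  · refine IsClosed.preimage continuous_subtype_val ?_
    exact isClosed_eq (by fun_prop) ((contDiff_tubeRadius κ hσ).continuous.comp continuous_snd)

namespace IsLineForm

theorem horizontalSection_tube [Nontrivial V] (h : IsLineForm β Q) (hκ : 0 < κ)
    (hpos : ∀ t, 0 < σ t) (t : ℝ) : horizontalSection (tube V κ σ) t =
      geodesicSphere (ballMetric κ Q) (Metric.ball 0 1) 0 (σ t) := by
  ext x
  rw [h.mem_geodesicSphere hκ]
  simp [horizontalSection, tube, (hpos t).le]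

theorem isRotational_tube [Nontrivial V] (h : IsLineForm β Q) (hκ : 0 < κ)
    (hpos : ∀ t, 0 < σ t) :
    IsRotational (ballMetric κ Q) (Metric.ball 0 1) 0 (tube V κ σ) := by
  intro t _ x _
  refine ⟨σ t, hpos t, (connectedComponentIn_subset _ _).trans ?_⟩
  rw [h.horizontalSection_tube hκ hpos]

theorem koszul_prodMetric (h : IsLineForm β Q) {p : V × ℝ} (hp : ‖p.1‖ < 1) (X Y Z : V × ℝ) :
    koszul (prodMetric (ballMetric κ Q)) p X Y Z = koszul (ballMetric κ Q) p.1 X.1 Y.1 Z.1 := by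
  have e : ∀ u v w : V × ℝ, fderiv ℝ (fun y => prodMetric (ballMetric κ Q) y v w) p u =
      fderiv ℝ (fun y => ballMetric κ Q y v.1 w.1) p.1 u.1 := by
    intro u v w
    have h1 := ((h.hasFDerivAt_metric (κ := κ) hp v.1 w.1).1.hasFDerivAt.comp p
      hasFDerivAt_fst).add_const (v.2 * w.2)
    have h2 : fderiv ℝ (fun y => prodMetric (ballMetric κ Q) y v w) p = _ := h1.fderiv
    rw [h2]
    simp
  simp only [koszul, e]

end IsLineForm

theorem contDiff_deriv_profile (hσ : ContDiff ℝ ∞ σ) : ContDiff ℝ ∞ (deriv σ) :=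
  (contDiff_infty_iff_deriv.1 hσ).2

theorem tubeAngle_sq (σ : ℝ → ℝ) (t : ℝ) : tubeAngle σ t ^ 2 * (1 + deriv σ t ^ 2) = 1 := by
  have : 0 < 1 + deriv σ t ^ 2 := by positivity
  rw [tubeAngle, inv_pow, Real.sq_sqrt this.le, inv_mul_cancel₀ this.ne']

theorem contDiff_tubeAngle (hσ : ContDiff ℝ ∞ σ) : ContDiff ℝ ∞ (tubeAngle σ) := by
  have h1 : ContDiff ℝ ∞ fun t => 1 + deriv σ t ^ 2 :=
    contDiff_const.add ((contDiff_deriv_profile hσ).pow 2)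
  have h2 : ∀ t, 1 + deriv σ t ^ 2 ≠ 0 := fun t => by positivity
  exact (h1.sqrt h2).inv fun t => (Real.sqrt_pos.2 (by positivity)).ne'

theorem fderiv_tubeNormal (hκ : 0 < κ) (hσ : ContDiff ℝ ∞ σ) {p : V × ℝ} (hp : p.1 ≠ 0)
    (X : V × ℝ) : fderiv ℝ (tubeNormal κ σ) p X =
      (-(fderiv ℝ (radialFactor κ : V → ℝ) p.1 X.1 * tubeAngle σ p.2 +
          radialFactor κ p.1 * (deriv (tubeAngle σ) p.2 * X.2)) • p.1 -
        (radialFactor κ p.1 * tubeAngle σ p.2) • X.1,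
        (deriv (deriv σ) p.2 * tubeAngle σ p.2 + deriv σ p.2 * deriv (tubeAngle σ) p.2) * X.2) := by
  have hr : HasFDerivAt (fun p : V × ℝ => radialFactor κ p.1) _ p :=
    ((contDiffAt_radialFactor hκ hp).differentiableAt (by simp)).hasFDerivAt.comp p hasFDerivAt_fst
  have hwd := ((contDiff_tubeAngle hσ).differentiable (by simp) p.2).hasDerivAt
  have hsd := ((contDiff_deriv_profile hσ).differentiable (by simp) p.2).hasDerivAt
  have hs : HasFDerivAt (fun p : V × ℝ => p.2) (ContinuousLinearMap.snd ℝ V ℝ) p := hasFDerivAt_snd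
  have hw : HasFDerivAt (fun p : V × ℝ => tubeAngle σ p.2) _ p :=
    hwd.comp_hasFDerivAt p hs
  have hb : HasFDerivAt (fun p : V × ℝ => deriv σ p.2 * tubeAngle σ p.2) _ p :=
    (hsd.mul hwd).comp_hasFDerivAt p hs
  have h1 := ((hr.mul hw).neg.smul (hasFDerivAt_fst (p := p))).prodMk hb
  have h2 : fderiv ℝ (tubeNormal κ σ) p = _ := h1.fderiv
  rw [h2]
  refine Prod.ext ?_ ?_
  · simp only [ContinuousLinearMap.prod_apply]
    simp
    module
  · simp

theorem contDiffAt_tubeNormal (hκ : 0 < κ) (hσ : ContDiff ℝ ∞ σ) {p : V × ℝ} (hp : p.1 ≠ 0) :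
    ContDiffAt ℝ ∞ (tubeNormal κ σ : V × ℝ → V × ℝ) p := by
  have hr : ContDiffAt ℝ ∞ (fun p : V × ℝ => radialFactor κ p.1) p :=
    (contDiffAt_radialFactor hκ hp).comp p contDiffAt_fst
  have hw : ContDiffAt ℝ ∞ (fun p : V × ℝ => tubeAngle σ p.2) p :=
    ((contDiff_tubeAngle hσ).comp contDiff_snd).contDiffAt
  have hb : ContDiffAt ℝ ∞ (fun p : V × ℝ => deriv σ p.2) p :=
    ((contDiff_deriv_profile hσ).comp contDiff_snd).contDiffAt
  exact ((hr.mul hw).neg.smul contDiffAt_fst).prodMk (hb.mul hw)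

namespace IsLineForm

theorem isUnitNormal_tube (h : IsLineForm β Q) (hκ : 0 < κ) (hσ : ContDiff ℝ ∞ σ)
    (hpos : ∀ t, 0 < σ t) :
    IsUnitNormal (prodMetric (ballMetric κ Q)) (tube V κ σ) (tubeNormal κ σ) := by
  intro p hp
  have hp0 := tube_ne_zero hκ hpos hp
  have hp1 := tube_norm_lt hp
  have hn : 0 < ‖p.1‖ := norm_pos_iff.2 hp0
  have hq := one_sub_norm_sq_pos hp1
  refine ⟨contDiffAt_tubeNormal hκ hσ hp0, ?_, fun X hX => ?_⟩
  · have h1 := h.metric_self_radial hκ hp0 hp1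
    have h2 := tubeAngle_sq σ p.2
    simp only [prodMetric, tubeNormal, h.metric_smul_left, h.metric_smul_right]
    linear_combination tubeAngle σ p.2 ^ 2 * h1 + h2
  · have h1 := inner_of_mem_tangentCone_tube hσ hp hX
    simp only [prodMetric, tubeNormal, h.metric_smul_left, h.metric_radial hp1, h1, radialFactor]
    field_simp
    ring

/-- The second fundamental form of the tube in the frame formed by the principal directions `f i` of
the sphere and the unit tangent vector of the profile curve. -/
theorem secondFundForm_tube (h : IsLineForm β Q) (hκ : 0 < κ) (hσ : ContDiff ℝ ∞ σ)
    {p : V × ℝ} (hp0 : p.1 ≠ 0) (hp1 : ‖p.1‖ < 1) :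
    (∀ X Y, ⟪p.1, X⟫ = 0 → secondFundForm (prodMetric (ballMetric κ Q)) (tubeNormal κ σ) p
      (X, 0) (Y, 0) = tubeAngle σ p.2 * shapeForm κ Q p.1 X Y) ∧
    (∀ X (c d : ℝ), ⟪p.1, X⟫ = 0 → secondFundForm (prodMetric (ballMetric κ Q)) (tubeNormal κ σ) p
      (X, 0) (c • p.1, d) = 0) ∧
    (∀ X (c d : ℝ), ⟪p.1, X⟫ = 0 → secondFundForm (prodMetric (ballMetric κ Q)) (tubeNormal κ σ) p
      (c • p.1, d) (X, 0) = 0) ∧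
    secondFundForm (prodMetric (ballMetric κ Q)) (tubeNormal κ σ) p
      ((tubeAngle σ p.2 * (deriv σ p.2 * radialFactor κ p.1)) • p.1, tubeAngle σ p.2)
      ((tubeAngle σ p.2 * (deriv σ p.2 * radialFactor κ p.1)) • p.1, tubeAngle σ p.2) =
        -(deriv (deriv σ) p.2 * tubeAngle σ p.2 ^ 3) := by
  have hn : 0 < ‖p.1‖ := norm_pos_iff.2 hp0
  have hq := one_sub_norm_sq_pos hp1
  have hk1 := fun (a b c : ℝ) (X : V) => h.koszul_smul (κ := κ) hp1 a b c X p.1 p.1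
  have hk2 := fun (a b c : ℝ) (X : V) => h.koszul_smul (κ := κ) hp1 a b c p.1 p.1 X
  refine ⟨fun X Y hX => ?_, fun X c d hX => ?_, fun X c d hX => ?_, ?_⟩
  · have hk := h.koszul_smul (κ := κ) hp1 1 (-(radialFactor κ p.1 * tubeAngle σ p.2)) 1 X p.1 Y
    simp only [one_smul] at hk
    rw [secondFundForm, covDerivInner, h.koszul_prodMetric hp1, fderiv_tubeNormal hκ hσ hp0,
      fderiv_radialFactor hκ hp0, hX]
    simp only [prodMetric, tubeNormal, hk, mul_zero, zero_mul, add_zero, neg_zero, zero_smul,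
      zero_sub]
    rw [← neg_smul, h.metric_smul_left, shapeForm, radialFactor]
    ring
  · have hk := hk1 1 (-(radialFactor κ p.1 * tubeAngle σ p.2)) c X
    rw [one_smul] at hk
    rw [secondFundForm, covDerivInner, h.koszul_prodMetric hp1, fderiv_tubeNormal hκ hσ hp0,
      fderiv_radialFactor hκ hp0, hX]
    simp only [prodMetric, tubeNormal, hk, mul_zero, zero_mul, add_zero, neg_zero, zero_smul,
      zero_sub]
    rw [← neg_smul, h.metric_smul_left, h.metric_smul_right, h.metric_symm, h.metric_radial hp1, hX,
      h.koszul_tangent_radial hp1 hX]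
    ring
  · have hk := hk2 c (-(radialFactor κ p.1 * tubeAngle σ p.2)) 1 X
    rw [one_smul] at hk
    rw [secondFundForm, covDerivInner, h.koszul_prodMetric hp1, fderiv_tubeNormal hκ hσ hp0]
    simp only [prodMetric, tubeNormal, hk]
    rw [smul_smul, ← sub_smul, h.metric_smul_left, h.metric_radial hp1, hX,
      h.koszul_radial_tangent hp1 hX]
    ring
  · rw [secondFundForm, covDerivInner, h.koszul_prodMetric hp1, fderiv_tubeNormal hκ hσ hp0,
      fderiv_radialFactor hκ hp0]
    simp only [prodMetric, tubeNormal]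
    rw [h.koszul_smul hp1, h.koszul_radial hp1, smul_smul, ← sub_smul, h.metric_smul_left,
      h.metric_smul_right, h.metric_radial hp1, real_inner_smul_right, real_inner_self_eq_norm_sq,
      radialFactor]
    field_simp
    ring

theorem finrank_prod_sub_one [FiniteDimensional ℝ V] (hV : 0 < Module.finrank ℝ V) :
    Module.finrank ℝ (V × ℝ) - 1 = Module.finrank ℝ V - 1 + 1 := by
  rw [Module.finrank_prod, Module.finrank_self]
  omega

theorem hasMeanCurvature_tube [FiniteDimensional ℝ V] (h : IsLineForm β Q) (hκ : 0 < κ)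
    (hβ : ∀ i, β i = 0 ∨ β i = 1) (hσ : ContDiff ℝ ∞ σ) (hpos : ∀ t, 0 < σ t) {r : ℕ} (hr : 1 ≤ r)
    {p : V × ℝ} (hp : p ∈ tube V κ σ) :
    HasMeanCurvature (prodMetric (ballMetric κ Q)) (tubeNormal κ σ) p r
      (tubeAngle σ p.2 ^ r * radialEsymm κ β r (σ p.2) +
        -(deriv (deriv σ) p.2 * tubeAngle σ p.2 ^ 3) *
          (tubeAngle σ p.2 ^ (r - 1) * radialEsymm κ β (r - 1) (σ p.2))) := by
  have hp0 := tube_ne_zero hκ hpos hp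
  have hp1 := tube_norm_lt hp
  have hp' : ‖p.1‖ = _ := hp
  have hV : 0 < Module.finrank ℝ V := Module.finrank_pos_iff_exists_ne_zero.2 ⟨p.1, hp0⟩
  obtain ⟨f, hf, hgf, hkf⟩ := h.exists_principal_basis hκ hβ hp0 hp1
  obtain ⟨s1, s2, s3, s4⟩ := h.secondFundForm_tube hκ hσ hp0 hp1
  set w := tubeAngle σ p.2 with hw
  let E : Option (Fin (Module.finrank ℝ V - 1)) → V × ℝ := fun o =>
    o.elim ((w * (deriv σ p.2 * radialFactor κ p.1)) • p.1, w) fun i => (f i, 0)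
  let K : Option (Fin (Module.finrank ℝ V - 1)) → ℝ := fun o =>
    o.elim (-(deriv (deriv σ) p.2 * w ^ 3)) fun i => w * radialCurv κ β (σ p.2) i
  let ε : Fin (Module.finrank ℝ (V × ℝ) - 1) ≃ Option (Fin (Module.finrank ℝ V - 1)) :=
    (finCongr (finrank_prod_sub_one hV)).trans (finSuccEquiv _)
  have hgp : ∀ i, ballMetric κ Q p.1 p.1 (f i) = 0 := fun i => by
    rw [h.metric_radial hp1, hf, mul_zero, zero_div]
  have hgp' : ∀ i, ballMetric κ Q p.1 (f i) p.1 = 0 := fun i => by rw [h.metric_symm, hgp]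
  have hrad := h.metric_self_radial hκ hp0 hp1
  have hw2 := tubeAngle_sq σ p.2
  rw [← hw] at hw2
  refine ⟨fun i => K (ε i), ⟨fun i => E (ε i), fun i j => ?_, fun i => ?_, fun i j => ?_⟩, ?_⟩
  · simp only [← ε.injective.eq_iff (a := i)]
    generalize ε i = a
    generalize ε j = b
    cases a <;> cases b
    · simp only [E, Option.elim, prodMetric, h.metric_smul_left, h.metric_smul_right, if_true]
      linear_combination w ^ 2 * deriv σ p.2 ^ 2 * hrad + hw2
    · simp [E, prodMetric, h.metric_smul_left, hgp]
    · simp [E, prodMetric, h.metric_smul_right, hgp']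
    · simp [E, prodMetric, hgf]
  · change prodMetric (ballMetric κ Q) p (E (ε i)) _ = 0
    generalize ε i = a
    cases a
    · simp only [E, Option.elim, prodMetric, tubeNormal, h.metric_smul_left, h.metric_smul_right]
      rw [← hw]
      linear_combination -w ^ 2 * deriv σ p.2 * hrad
    · simp only [E, Option.elim, prodMetric, tubeNormal, h.metric_smul_right, hgp', mul_zero,
        zero_mul, add_zero]
  · simp only [← ε.injective.eq_iff (a := i)]
    generalize ε i = a
    generalize ε j = b
    cases a <;> cases b
    · simp only [E, K, Option.elim, if_true]
      exact s4
    · simp only [E, Option.elim, reduceCtorEq, if_false]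
      exact s3 _ _ _ (hf _)
    · simp only [E, Option.elim, reduceCtorEq, if_false]
      exact s2 _ _ _ (hf _)
    · simp only [E, K, Option.elim, Option.some.injEq]
      rw [s1 _ _ (hf _), shapeForm, hkf, hp', radialCurv]
      split_ifs <;> simp
  · have h1 := esymmFn_equiv r ε K
    have h2 := esymmFn_option r hr K
    simp only [K, Option.elim] at h2
    rw [esymmFn_smul, esymmFn_smul] at h2
    exact (h1.trans h2).symm

theorem isHrHypersurface_tube [FiniteDimensional ℝ V] (h : IsLineForm β Q) (hκ : 0 < κ)
    (hβ : ∀ i, β i = 0 ∨ β i = 1) (hσ : ContDiff ℝ ∞ σ) (hpos : ∀ t, 0 < σ t) {r : ℕ} (hr : 1 ≤ r)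
    {H : ℝ} (hH : ∀ t, H = tubeAngle σ t ^ r * radialEsymm κ β r (σ t) +
        -(deriv (deriv σ) t * tubeAngle σ t ^ 3) *
          (tubeAngle σ t ^ (r - 1) * radialEsymm κ β (r - 1) (σ t))) :
    IsHrHypersurface (prodMetric (ballMetric κ Q)) (tube V κ σ) r H := by
  refine ⟨(isProperlyEmbedded_tube hκ hσ hpos).2.1, tubeNormal κ σ,
    h.isUnitNormal_tube hκ hσ hpos, fun p hp => ?_⟩
  rw [hH p.2]
  exact h.hasMeanCurvature_tube hκ hβ hσ hpos hr hp

end IsLineForm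

/-- The tube is homeomorphic to the product of a sphere and a line. -/
theorem nonempty_homeomorph_tube {W : Type*} [NormedAddCommGroup W] [InnerProductSpace ℝ W]
    (L : V ≃ₗᵢ[ℝ] W) (hκ : 0 < κ) (hσ : ContDiff ℝ ∞ σ) (hpos : ∀ t, 0 < σ t) :
    Nonempty (tube V κ σ ≃ₜ (Metric.sphere (0 : W) 1 × ℝ)) := by
  have hρ : ∀ t, 0 < Real.tanh (σ t / κ) := fun t => tanh_pos_of_pos (div_pos (hpos t) hκ)
  have hρc : Continuous fun t => Real.tanh (σ t / κ) := (contDiff_tubeRadius κ hσ).continuous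
  refine ⟨{
    toFun := fun p => (⟨L ((Real.tanh (σ p.1.2 / κ))⁻¹ • p.1.1), ?_⟩, p.1.2)
    invFun := fun y => ⟨(Real.tanh (σ y.2 / κ) • L.symm y.1, y.2), ?_⟩
    left_inv := fun p => ?_
    right_inv := fun y => ?_
    continuous_toFun := ?_
    continuous_invFun := ?_ }⟩
  · have hp : ‖p.1.1‖ = _ := p.2
    rw [mem_sphere_zero_iff_norm, L.norm_map, norm_smul, hp, norm_inv, Real.norm_eq_abs,
      abs_of_pos (hρ _), inv_mul_cancel₀ (hρ _).ne']
  · have hy : ‖(y.1 : W)‖ = 1 := mem_sphere_zero_iff_norm.1 y.1.2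
    simp only [tube, mem_ofPred_eq]
    rw [norm_smul, L.symm.norm_map, hy, mul_one, Real.norm_eq_abs, abs_of_pos (hρ _)]
  · apply Subtype.ext
    simp [smul_smul, mul_inv_cancel₀ (hρ _).ne']
  · refine Prod.ext (Subtype.ext ?_) rfl
    simp [smul_smul, inv_mul_cancel₀ (hρ _).ne']
  · have h1 : Continuous fun p : tube V κ σ => Real.tanh (σ p.1.2 / κ) :=
      hρc.comp (continuous_snd.comp continuous_subtype_val)
    refine Continuous.prodMk (Continuous.subtype_mk (L.continuous.comp ?_) _) (by fun_prop)
    exact (h1.inv₀ fun p => (hρ _).ne').smul (continuous_fst.comp continuous_subtype_val)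
  · refine Continuous.subtype_mk (Continuous.prodMk ?_ continuous_snd) _
    exact (hρc.comp continuous_snd).smul
      (L.symm.continuous.comp (continuous_subtype_val.comp continuous_fst))

namespace IsLineForm

/-- The trajectories of the gradient of the height function are the profile curves over the
geodesic rays issuing from the origin. -/
theorem exists_heightTrajectory (h : IsLineForm β Q) (hκ : 0 < κ) (hσ : ContDiff ℝ ∞ σ)
    (hpos : ∀ t, 0 < σ t) {p : V × ℝ} (hp : p ∈ tube V κ σ) :
    ∃ c : ℝ → V × ℝ, IsHeightTrajectory (ballMetric κ Q) (tube V κ σ) c ∧ c 0 = p ∧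
      ∃ γ : ℝ → V, IsGeodesicRay (ballMetric κ Q) (Metric.ball 0 1) 0 γ ∧
        range c = range fun t => (γ (σ t), t) := by
  have hp0 := tube_ne_zero hκ hpos hp
  have hp' : ‖p.1‖ = _ := hp
  have hn : 0 < ‖p.1‖ := norm_pos_iff.2 hp0
  have hρ : ∀ t, 0 < Real.tanh (σ t / κ) := fun t => tanh_pos_of_pos (div_pos (hpos t) hκ)
  set e : V := ‖p.1‖⁻¹ • p.1 with he
  have he1 : ‖e‖ = 1 := norm_smul_inv_norm hp0
  -- reparametrize by `∫ (1 + σ'²)`, since the gradient has height component `(1 + σ'²)⁻¹`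
  have hc : Continuous fun t => 1 + deriv σ t ^ 2 :=
    continuous_const.add ((contDiff_deriv_profile hσ).continuous.pow 2)
  obtain ⟨ψ, -, hψ₁, hψ₂, -, hψ⟩ := exists_inverse_integral hc (fun t => by positivity) one_pos
    fun t _ => le_add_of_nonneg_right (sq_nonneg _)
  set a : ℝ := ∫ t in (0 : ℝ)..p.2, (1 + deriv σ t ^ 2) with ha
  refine ⟨fun u => (Real.tanh (σ (ψ (u + a)) / κ) • e, ψ (u + a)), fun u => ?_, ?_,
    fun s => Real.tanh (s / κ) • e, h.isGeodesicRay hκ he1, ?_⟩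
  · set t := ψ (u + a) with ht
    have hmem : ∀ u, (Real.tanh (σ (ψ (u + a)) / κ) • e, ψ (u + a)) ∈ tube V κ σ := fun u => by
      simp only [tube, mem_ofPred_eq]
      rw [norm_smul, he1, mul_one, Real.norm_eq_abs, abs_of_pos (hρ _)]
    have hψu : HasDerivAt (fun u => ψ (u + a)) (1 + deriv σ t ^ 2)⁻¹ u :=
      (hψ (u + a)).comp_add_const u a
    have hd := (((hasDerivAt_tubeRadius κ hσ t).comp u hψu).smul_const e).prodMk hψu
    have hcone := mem_tangentConeAt_of_hasDerivAt hd hmem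
    refine ⟨hmem u, _, ⟨hcone, fun X hX => ?_⟩, hd⟩
    have h1 := inner_of_mem_tangentCone_tube hσ (hmem u) hX
    have hx1 := tube_norm_lt (hmem u)
    have hnu : ‖Real.tanh (σ t / κ) • e‖ = Real.tanh (σ t / κ) := hmem u
    have hq := one_sub_norm_sq_pos hx1
    simp only [← ht, hnu] at h1 hq
    have h3 : ballMetric κ Q (Real.tanh (σ t / κ) • e) e X.1 =
        κ * (deriv σ t) * X.2 / (1 - Real.tanh (σ t / κ) ^ 2) := by
      have h5 := h.metric_smul_left (κ := κ) (Real.tanh (σ t / κ) • e) (Real.tanh (σ t / κ)) e X.1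
      have h6 := h.metric_radial (κ := κ) hx1 X.1
      simp only [← ht, hnu, h1] at h6
      have := hρ t
      apply mul_left_cancel₀ this.ne'
      rw [← h5, h6]
      field_simp
    have h4 : (0 : ℝ) < 1 + deriv σ t ^ 2 := by positivity
    simp only [prodMetric, h.metric_smul_left, ← ht, h3]
    field_simp
    ring
  · have h1 : ψ (0 + a) = p.2 := by rw [zero_add, ha, hψ₁]
    refine Prod.ext ?_ h1
    simp only [h1, ← hp', he, smul_smul, mul_inv_cancel₀ hn.ne', one_smul]
  · ext y
    constructor
    · rintro ⟨u, rfl⟩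
      exact ⟨ψ (u + a), rfl⟩
    · rintro ⟨t, rfl⟩
      refine ⟨(∫ x in (0 : ℝ)..t, (1 + deriv σ x ^ 2)) - a, ?_⟩
      simp only [sub_add_cancel, hψ₁]

theorem isDelaunayType_tube (h : IsLineForm β Q) (hκ : 0 < κ) {T l : ℝ}
    (hσ : IsUnduloidProfile σ T) (hl : σ 0 = l) :
    IsDelaunayType (ballMetric κ Q) (Metric.ball 0 1) 0 l (tube V κ σ) := by
  refine ⟨T, hσ.2.1, fun x t => ?_, σ, hσ, hl, fun p hp =>
    h.exists_heightTrajectory hκ hσ.1 hσ.2.2.1 hp⟩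
  simp only [tube, mem_ofPred_eq, hσ.2.2.2.1 t]

end IsLineForm

end Tube

/-! ### Normed algebras with conjugation -/

section Hurwitz

/-- The algebraic identities of the four normed division algebras on which the properties of
the metric rest: alternativity, and adjunction of multiplications. -/
structure IsHurwitz (F : Type*) [NormedAddCommGroup F] [InnerProductSpace ℝ F] [Mul F] [Star F] :
    Prop where
  mul_add : ∀ a b c : F, a * (b + c) = a * b + a * c
  add_mul : ∀ a b c : F, (a + b) * c = a * c + b * c
  smul_mul : ∀ (t : ℝ) (a b : F), (t • a) * b = t • (a * b)
  mul_smul : ∀ (t : ℝ) (a b : F), a * (t • b) = t • (a * b)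
  star_add : ∀ a b : F, star (a + b) = star a + star b
  star_smul : ∀ (t : ℝ) (a : F), star (t • a) = t • star a
  star_star : ∀ a : F, star (star a) = a
  star_mul : ∀ a b : F, star (a * b) = star b * star a
  inner_star : ∀ a b : F, ⟪star a, star b⟫ = ⟪a, b⟫
  inner_mul : ∀ a u v : F, ⟪a * u, v⟫ = ⟪a, v * star u⟫
  mul_star_mul : ∀ a u : F, a * (star a * u) = ‖a‖ ^ 2 • u
  mul_star_mul' : ∀ a u : F, (a * star a) * u = ‖a‖ ^ 2 • u

namespace IsHurwitz

variable {F : Type*} [NormedAddCommGroup F] [InnerProductSpace ℝ F] [Mul F] [Star F]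

theorem norm_star (h : IsHurwitz F) (a : F) : ‖star a‖ = ‖a‖ := by
  rw [norm_eq_sqrt_real_inner, h.inner_star, ← norm_eq_sqrt_real_inner]

theorem inner_mul_left (h : IsHurwitz F) (a u v : F) : ⟪a * u, v⟫ = ⟪u, star a * v⟫ := by
  rw [← h.inner_star, h.star_mul, h.inner_mul, h.star_star, ← h.inner_star, h.star_star, h.star_mul,
    h.star_star]

theorem inner_mul_mul_left (h : IsHurwitz F) (a b c : F) : ⟪a * b, a * c⟫ = ‖a‖ ^ 2 * ⟪b, c⟫ := by
  have := h.mul_star_mul (star a) c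
  rw [h.star_star, h.norm_star] at this
  rw [h.inner_mul_left, this, real_inner_smul_right]

theorem inner_mul_mul_right (h : IsHurwitz F) (a b c : F) : ⟪a * c, b * c⟫ = ‖c‖ ^ 2 * ⟪a, b⟫ := by
  rw [← h.inner_star, h.star_mul, h.star_mul, h.inner_mul_mul_left, h.norm_star, h.inner_star]

theorem norm_mul (h : IsHurwitz F) (a b : F) : ‖a * b‖ = ‖a‖ * ‖b‖ := by
  rw [← sq_eq_sq₀ (norm_nonneg _) (by positivity), ← real_inner_self_eq_norm_sq,
    h.inner_mul_mul_left, real_inner_self_eq_norm_sq, mul_pow]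

theorem mul_star_mul_self (h : IsHurwitz F) (a b : F) : (a * star b) * b = ‖b‖ ^ 2 • a := by
  have e := h.mul_star_mul (star b) (star a)
  rw [h.star_star, h.norm_star] at e
  rw [← h.star_star ((a * star b) * b), h.star_mul (a * star b), h.star_mul a, h.star_star b, e,
    h.star_smul, h.star_star]

theorem contDiff_mul_star (h : IsHurwitz F) : ContDiff ℝ ∞ fun p : F × F => p.1 * star p.2 := by
  have hb : IsBoundedBilinearMap ℝ fun p : F × F => p.1 * star p.2 :=
    { add_left := fun a b c => h.add_mul a b _
      smul_left := fun t a b => h.smul_mul t a _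
      add_right := fun a b c => by rw [h.star_add, h.mul_add]
      smul_right := fun t a b => by rw [h.star_smul, h.mul_smul]
      bound := ⟨1, one_pos, fun a b => by rw [h.norm_mul, h.norm_star, one_mul]⟩ }
  exact hb.contDiff

end IsHurwitz

variable {F : Type*} [NormedAddCommGroup F] [InnerProductSpace ℝ F] [Mul F] [Star F] {m : ℕ}

/-- `∑ i j, ⟪y j z̄ i, v j ū i⟫`. -/
noncomputable def lineForm₂ (y z u v : PiLp 2 fun _ : Fin m => F) : ℝ :=
  ∑ i, ∑ j, ⟪y j * star (z i), v j * star (u i)⟫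

/-- The form `Q` of the metric: `∑ i j, ⟪x j x̄ i, v j ū i⟫`. -/
noncomputable def lineForm (x u v : PiLp 2 fun _ : Fin m => F) : ℝ := lineForm₂ x x u v

namespace IsHurwitz

/-- The operator `u ↦ (∑ i, (x j x̄ i) u i)_j`, which is `‖x‖²` times the orthogonal projection to the
`F`-line through `0` and `x`. -/
noncomputable def lineOp (h : IsHurwitz F) (x : PiLp 2 fun _ : Fin m => F) :
    (PiLp 2 fun _ : Fin m => F) →ₗ[ℝ] PiLp 2 fun _ : Fin m => F where
  toFun u := WithLp.toLp 2 fun j => ∑ i, (x j * star (x i)) * u i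
  map_add' u v := by
    ext j
    simp [h.mul_add, Finset.sum_add_distrib]
  map_smul' t u := by
    ext j
    simp [h.mul_smul, Finset.smul_sum]

theorem lineOp_apply (h : IsHurwitz F) (x u : PiLp 2 fun _ : Fin m => F) (j : Fin m) :
    h.lineOp x u j = ∑ i, (x j * star (x i)) * u i := rfl

theorem lineForm_eq (h : IsHurwitz F) (x u v : PiLp 2 fun _ : Fin m => F) :
    lineForm x u v = ⟪h.lineOp x u, v⟫ := by
  rw [PiLp.inner_apply, lineForm, lineForm₂, Finset.sum_comm]
  refine Finset.sum_congr rfl fun j _ => ?_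
  rw [h.lineOp_apply, sum_inner]
  exact Finset.sum_congr rfl fun i _ => (h.inner_mul _ _ _).symm

theorem lineOp_symm (h : IsHurwitz F) (x u v : PiLp 2 fun _ : Fin m => F) :
    ⟪h.lineOp x u, v⟫ = ⟪u, h.lineOp x v⟫ := by
  rw [PiLp.inner_apply, PiLp.inner_apply]
  simp only [h.lineOp_apply, sum_inner, inner_sum]
  rw [Finset.sum_comm]
  refine Finset.sum_congr rfl fun i _ => Finset.sum_congr rfl fun j _ => ?_
  rw [h.inner_mul_left, h.star_mul, h.star_star]

theorem lineOp_self (h : IsHurwitz F) (x : PiLp 2 fun _ : Fin m => F) :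
    h.lineOp x x = ‖x‖ ^ 2 • x := by
  ext j
  rw [h.lineOp_apply, PiLp.smul_apply, PiLp.norm_sq_eq_of_L2, Finset.sum_smul]
  exact Finset.sum_congr rfl fun i _ => h.mul_star_mul_self _ _

/-- What remains of associativity in `F^m`. -/
def IsTriple (F : Type*) [NormedAddCommGroup F] [InnerProductSpace ℝ F] [Mul F] [Star F]
    (m : ℕ) : Prop :=
  ∀ (x : PiLp 2 fun _ : Fin m => F) (i j k : Fin m) (u : F),
    (x j * star (x k)) * ((x k * star (x i)) * u) = ‖x k‖ ^ 2 • ((x j * star (x i)) * u)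

theorem isTriple_of_assoc (h : IsHurwitz F) (ha : ∀ a b c : F, a * b * c = a * (b * c)) (m : ℕ) :
    IsTriple F m := by
  intro x i j k u
  have := h.mul_star_mul (star (x k)) (star (x i) * u)
  rw [h.star_star, h.norm_star] at this
  rw [ha, ha, this, h.mul_smul, ha]

/-- In two dimensions alternativity suffices: among three indices two coincide. -/
theorem isTriple_two (h : IsHurwitz F) : IsTriple F 2 := by
  intro x i j k u
  by_cases hij : i = j
  · subst hij
    have h1 := h.mul_star_mul (x i * star (x k)) u
    rw [h.star_mul, h.star_star, h.norm_mul, h.norm_star] at h1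
    rw [h1, h.mul_star_mul', smul_smul, mul_pow, mul_comm]
  · by_cases hki : k = i
    · subst hki
      rw [h.mul_star_mul', h.mul_smul]
    · have hkj : k = j := by omega
      subst hkj
      rw [h.mul_star_mul']

theorem lineOp_lineOp (h : IsHurwitz F) (ht : IsTriple F m) (x u : PiLp 2 fun _ : Fin m => F) :
    h.lineOp x (h.lineOp x u) = ‖x‖ ^ 2 • h.lineOp x u := by
  have hms : ∀ (a : F) (f : Fin m → F), a * ∑ i, f i = ∑ i, a * f i := fun a f =>
    map_sum (AddMonoidHom.mk' (fun b => a * b) (h.mul_add a)) f Finset.univ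
  ext j
  rw [h.lineOp_apply, PiLp.smul_apply, PiLp.norm_sq_eq_of_L2, Finset.sum_smul]
  refine Finset.sum_congr rfl fun k _ => ?_
  rw [h.lineOp_apply, h.lineOp_apply, hms, Finset.smul_sum]
  exact Finset.sum_congr rfl fun i _ => ht x i j k (u i)

theorem trace_lineOp [FiniteDimensional ℝ F] (h : IsHurwitz F) (x : PiLp 2 fun _ : Fin m => F) :
    LinearMap.trace ℝ _ (h.lineOp x) = Module.finrank ℝ F * ‖x‖ ^ 2 := by
  rw [LinearMap.trace_eq_sum_inner _ (Pi.orthonormalBasis fun _ : Fin m => stdOrthonormalBasis ℝ F)]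
  have key : ∀ (i : Fin m) (b : F), ‖b‖ = 1 →
      ⟪(PiLp.single 2 i b : PiLp 2 fun _ : Fin m => F), h.lineOp x (PiLp.single 2 i b)⟫ =
        ‖x i‖ ^ 2 := by
    intro i b hb
    have h0 : ∀ a : F, a * 0 = 0 := fun a => by simpa using h.mul_smul 0 a 0
    have h1 : ∀ v : PiLp 2 fun _ : Fin m => F,
        ⟪(PiLp.single 2 i b : PiLp 2 fun _ : Fin m => F), v⟫ = ⟪b, v i⟫ := by
      intro v
      rw [PiLp.inner_apply, Finset.sum_eq_single i]
      · rw [PiLp.single_eq_same]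
      · intro k _ hk
        rw [PiLp.single_eq_of_ne 2 hk, inner_zero_left]
      · simp
    rw [h1, h.lineOp_apply, Finset.sum_eq_single i]
    · rw [PiLp.single_eq_same, h.mul_star_mul', real_inner_smul_right, real_inner_self_eq_norm_sq, hb]
      ring
    · intro k _ hk
      rw [PiLp.single_eq_of_ne 2 hk, h0]
    · simp
  rw [Fintype.sum_sigma]
  simp only [Pi.orthonormalBasis_apply]
  rw [PiLp.norm_sq_eq_of_L2, Finset.mul_sum]
  refine Finset.sum_congr rfl fun i _ => ?_
  rw [Finset.sum_congr rfl fun b _ => key i _ ((stdOrthonormalBasis ℝ F).orthonormal.1 b)]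
  simp

end IsHurwitz

end Hurwitz

/-! ### The form of the metric -/

section LineForm

namespace IsHurwitz

variable {F : Type*} [NormedAddCommGroup F] [InnerProductSpace ℝ F] [Mul F] [Star F] {m : ℕ}

theorem lineForm₂_add_smul_left (h : IsHurwitz F) (t : ℝ) (y y' z u v : PiLp 2 fun _ : Fin m => F) :
    lineForm₂ (y + t • y') z u v = lineForm₂ y z u v + t * lineForm₂ y' z u v := by
  simp only [lineForm₂, Finset.mul_sum, ← Finset.sum_add_distrib, PiLp.add_apply, PiLp.smul_apply,
    h.add_mul, h.smul_mul, inner_add_left, real_inner_smul_left]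

theorem lineForm₂_add_smul_right (h : IsHurwitz F) (t : ℝ) (y z z' u v : PiLp 2 fun _ : Fin m => F) :
    lineForm₂ y (z + t • z') u v = lineForm₂ y z u v + t * lineForm₂ y z' u v := by
  simp only [lineForm₂, Finset.mul_sum, ← Finset.sum_add_distrib, PiLp.add_apply, PiLp.smul_apply,
    h.star_add, h.star_smul, h.mul_add, h.mul_smul, inner_add_left, real_inner_smul_left]

theorem contDiff_lineForm (h : IsHurwitz F) :
    ContDiff ℝ ∞ fun p : (PiLp 2 fun _ : Fin m => F) × (PiLp 2 fun _ : Fin m => F) ×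
      (PiLp 2 fun _ : Fin m => F) => lineForm p.1 p.2.1 p.2.2 := by
  have hc : ∀ i, ContDiff ℝ ∞ fun x : PiLp 2 fun _ : Fin m => F => x i := fun i =>
    (PiLp.proj (𝕜 := ℝ) 2 (fun _ : Fin m => F) i).contDiff
  unfold lineForm lineForm₂
  refine ContDiff.sum fun i _ => ?_
  refine ContDiff.sum fun j _ => ?_
  refine ContDiff.inner ℝ (E := F) ?_ ?_
  · exact h.contDiff_mul_star.comp
      (((hc j).comp contDiff_fst).prodMk ((hc i).comp contDiff_fst))
  · exact h.contDiff_mul_star.comp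
      (((hc j).comp (contDiff_snd.comp contDiff_snd)).prodMk
        ((hc i).comp (contDiff_fst.comp contDiff_snd)))

theorem fderiv_lineForm (h : IsHurwitz F) (x u v w : PiLp 2 fun _ : Fin m => F) :
    fderiv ℝ (fun y => lineForm y v w) x u = lineForm₂ x u v w + lineForm₂ u x v w := by
  have hd : DifferentiableAt ℝ (fun y => lineForm y v w) x :=
    ((h.contDiff_lineForm.comp (contDiff_id.prodMk (contDiff_const (c := (v, w))))).differentiable
      (by simp)) x
  rw [← hd.lineDeriv_eq_fderiv, lineDeriv]
  have he : (fun t : ℝ => lineForm (x + t • u) v w) = fun t =>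
      lineForm₂ x x v w + t * (lineForm₂ x u v w + lineForm₂ u x v w) + t ^ 2 * lineForm₂ u u v w := by
    funext t
    rw [lineForm, h.lineForm₂_add_smul_left, h.lineForm₂_add_smul_right, h.lineForm₂_add_smul_right]
    ring
  rw [he]
  have h1 := (((hasDerivAt_id (0 : ℝ)).mul_const
    (lineForm₂ x u v w + lineForm₂ u x v w)).const_add (lineForm₂ x x v w)).add
      (((hasDerivAt_id (0 : ℝ)).pow 2).mul_const (lineForm₂ u u v w))
  have h2 := h1.deriv
  simp only [id_eq] at h2
  refine Eq.trans ?_ (h2.trans (by simp))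
  rfl

theorem lineForm₂_self_right (h : IsHurwitz F) (x y v : PiLp 2 fun _ : Fin m => F) :
    lineForm₂ y x x v = ‖x‖ ^ 2 * ⟪y, v⟫ := by
  rw [lineForm₂, PiLp.norm_sq_eq_of_L2, PiLp.inner_apply, Finset.sum_mul_sum]
  exact Finset.sum_congr rfl fun i _ => Finset.sum_congr rfl fun j _ => by
    rw [h.inner_mul_mul_right, h.norm_star]

theorem lineForm₂_self_left (h : IsHurwitz F) (x z u : PiLp 2 fun _ : Fin m => F) :
    lineForm₂ x z u x = ‖x‖ ^ 2 * ⟪z, u⟫ := by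
  rw [lineForm₂, PiLp.norm_sq_eq_of_L2, PiLp.inner_apply, Finset.sum_mul_sum, Finset.sum_comm]
  exact Finset.sum_congr rfl fun i _ => Finset.sum_congr rfl fun j _ => by
    rw [h.inner_mul_mul_left, h.inner_star]

theorem lineForm₂_comm (y z u v : PiLp 2 fun _ : Fin m => F) :
    lineForm₂ y z u v = lineForm₂ v u z y := by
  rw [lineForm₂, lineForm₂]
  exact Finset.sum_congr rfl fun i _ => Finset.sum_congr rfl fun j _ => real_inner_comm _ _

theorem norm_lineOp_sq (h : IsHurwitz F) (ht : IsTriple F m) (x u : PiLp 2 fun _ : Fin m => F) :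
    ‖h.lineOp x u‖ ^ 2 = ‖x‖ ^ 2 * lineForm x u u := by
  rw [← real_inner_self_eq_norm_sq, h.lineOp_symm, h.lineOp_lineOp ht, real_inner_smul_right,
    h.lineForm_eq, real_inner_comm]

theorem inner_sq_le_lineForm (h : IsHurwitz F) (ht : IsTriple F m)
    (x u : PiLp 2 fun _ : Fin m => F) : ⟪x, u⟫ ^ 2 ≤ lineForm x u u := by
  rcases eq_or_ne x 0 with rfl | hx
  · have := h.lineForm₂_add_smul_left 0 (0 : PiLp 2 fun _ : Fin m => F) 0 0 u u
    have h0 := h.lineForm₂_add_smul_left (-1) (0 : PiLp 2 fun _ : Fin m => F) 0 0 u u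
    rw [inner_zero_left, lineForm]
    simp only [smul_zero, add_zero] at h0
    linarith
  have hp : 0 < ‖x‖ ^ 2 := by positivity
  have h1 : ‖x‖ ^ 2 * ⟪x, u⟫ = ⟪x, h.lineOp x u⟫ := by
    rw [← h.lineOp_symm, h.lineOp_self, real_inner_smul_left]
  have h2 : ⟪x, h.lineOp x u⟫ ^ 2 ≤ ‖x‖ ^ 2 * ‖h.lineOp x u‖ ^ 2 := by
    rw [← mul_pow]
    exact sq_le_sq' (neg_le_of_abs_le (abs_real_inner_le_norm _ _)) (real_inner_le_norm _ _)
  rw [← h1, h.norm_lineOp_sq ht] at h2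
  have h3 : 0 < ‖x‖ ^ 2 * ‖x‖ ^ 2 := by positivity
  refine le_of_mul_le_mul_left ?_ h3
  linarith

theorem finrank_range_lineOp [FiniteDimensional ℝ F] (h : IsHurwitz F) (ht : IsTriple F m)
    {x : PiLp 2 fun _ : Fin m => F} (hx : x ≠ 0) :
    Module.finrank ℝ (LinearMap.range (h.lineOp x)) = Module.finrank ℝ F := by
  have hp : ‖x‖ ^ 2 ≠ 0 := by positivity
  have hproj : LinearMap.IsProj (LinearMap.range (h.lineOp x)) ((‖x‖ ^ 2)⁻¹ • h.lineOp x) :=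
    { map_mem := fun u => Submodule.smul_mem _ _ ⟨u, rfl⟩
      map_id := by
        rintro _ ⟨u, rfl⟩
        rw [LinearMap.smul_apply, h.lineOp_lineOp ht, smul_smul, inv_mul_cancel₀ hp, one_smul] }
  have := hproj.trace
  rw [map_smul, h.trace_lineOp, smul_eq_mul] at this
  have h2 : (Module.finrank ℝ F : ℝ) = Module.finrank ℝ (LinearMap.range (h.lineOp x)) := by
    rw [← this]
    field_simp
  exact_mod_cast h2.symm

/-- The exponents of the principal directions: `1` along the `F`-line, `0` across it. -/
theorem exists_basis_lineForm [FiniteDimensional ℝ F] (h : IsHurwitz F) (ht : IsTriple F m)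
    {n : ℕ} (hn : Module.finrank ℝ (PiLp 2 fun _ : Fin m => F) = n)
    {x : PiLp 2 fun _ : Fin m => F} (hx : x ≠ 0) :
    ∃ e : Fin (n - 1) → PiLp 2 fun _ : Fin m => F, Orthonormal ℝ e ∧ (∀ i, ⟪x, e i⟫ = 0) ∧
      ∀ i v, lineForm x (e i) v =
        (if i.val < Module.finrank ℝ F - 1 then 1 else 0) * ‖x‖ ^ 2 * ⟪e i, v⟫ := by
  let V := PiLp 2 fun _ : Fin m => F
  set L : Submodule ℝ V := LinearMap.range (h.lineOp x) with hL
  set d := Module.finrank ℝ F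
  have hp : ‖x‖ ^ 2 ≠ 0 := by positivity
  have hLd : Module.finrank ℝ L = d := h.finrank_range_lineOp ht hx
  have hxL : x ∈ L := ⟨(‖x‖ ^ 2)⁻¹ • x, by
    rw [map_smul, h.lineOp_self, smul_smul, inv_mul_cancel₀ hp, one_smul]⟩
  have hspan : Submodule.span ℝ {x} ≤ L := by
    rwa [Submodule.span_singleton_le_iff_mem]
  have hd1 : 1 + Module.finrank ℝ ((Submodule.span ℝ {x})ᗮ ⊓ L : Submodule ℝ V) = d := by
    rw [← hLd, ← Submodule.finrank_add_inf_finrank_orthogonal hspan, finrank_span_singleton hx]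
  have hd2 : d + Module.finrank ℝ Lᗮ = n := by
    rw [← hLd, Submodule.finrank_add_finrank_orthogonal, hn]
  set A : Submodule ℝ V := (Submodule.span ℝ {x})ᗮ ⊓ L with hA
  have hopL : ∀ u ∈ L, h.lineOp x u = ‖x‖ ^ 2 • u := by
    rintro _ ⟨u, rfl⟩
    exact h.lineOp_lineOp ht x u
  have hopLo : ∀ u ∈ Lᗮ, h.lineOp x u = 0 := by
    intro u hu
    rw [← inner_self_eq_zero (𝕜 := ℝ), h.lineOp_symm, real_inner_comm]
    exact hu _ ⟨_, rfl⟩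
  have hdA : Module.finrank ℝ A = d - 1 := by omega
  let f : Fin (d - 1) ⊕ Fin (Module.finrank ℝ Lᗮ) → V := Sum.elim
    (fun i => (stdOrthonormalBasis ℝ A (finCongr hdA.symm i) : V))
    (fun i => (stdOrthonormalBasis ℝ Lᗮ i : V))
  have hf : Orthonormal ℝ f := by
    constructor
    · rintro (i | i)
      · exact (stdOrthonormalBasis ℝ A).orthonormal.1 _
      · exact (stdOrthonormalBasis ℝ Lᗮ).orthonormal.1 _
    · rintro (i | i) (j | j) hij
      · exact (stdOrthonormalBasis ℝ A).orthonormal.2 fun hc => hij (by simpa using hc)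
      · exact (stdOrthonormalBasis ℝ Lᗮ j).2 _ (stdOrthonormalBasis ℝ A _).2.2
      · rw [real_inner_comm]
        exact (stdOrthonormalBasis ℝ Lᗮ i).2 _ (stdOrthonormalBasis ℝ A _).2.2
      · exact (stdOrthonormalBasis ℝ Lᗮ).orthonormal.2 fun hc => hij (by simpa using hc)
  have hn' : n - 1 = d - 1 + Module.finrank ℝ Lᗮ := by omega
  let g : Fin (n - 1) ≃ Fin (d - 1) ⊕ Fin (Module.finrank ℝ Lᗮ) :=
    (finCongr hn').trans finSumFinEquiv.symm
  have hgval : ∀ i, (∃ k, g i = Sum.inl k ∧ i.val < d - 1) ∨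
      ∃ k, g i = Sum.inr k ∧ ¬ i.val < d - 1 := by
    intro i
    obtain ⟨s, rfl⟩ := g.symm.surjective i
    rcases s with k | k
    · exact Or.inl ⟨k, by simp, by simp [g]⟩
    · exact Or.inr ⟨k, by simp, by simp [g]⟩
  refine ⟨f ∘ g, hf.comp g g.injective, fun i => ?_, fun i v => ?_⟩
  · rcases hgval i with ⟨k, hk, -⟩ | ⟨k, hk, -⟩
    · rw [Function.comp_apply, hk]
      exact (stdOrthonormalBasis ℝ A (finCongr hdA.symm k)).2.1 x
        (Submodule.mem_span_singleton_self x)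
    · rw [Function.comp_apply, hk]
      exact (stdOrthonormalBasis ℝ Lᗮ k).2 x hxL
  · rw [h.lineForm_eq]
    rcases hgval i with ⟨k, hk, hi⟩ | ⟨k, hk, hi⟩
    · rw [Function.comp_apply, hk, if_pos hi, one_mul, ← real_inner_smul_left]
      congr 1
      exact hopL _ (stdOrthonormalBasis ℝ A (finCongr hdA.symm k)).2.2
    · rw [Function.comp_apply, hk, if_neg hi, zero_mul, zero_mul]
      have := hopLo _ (stdOrthonormalBasis ℝ Lᗮ k).2
      change ⟪h.lineOp x (stdOrthonormalBasis ℝ Lᗮ k : V), v⟫ = 0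
      rw [this, inner_zero_left]

theorem isLineForm [FiniteDimensional ℝ F] (h : IsHurwitz F) (ht : IsTriple F m) :
    IsLineForm (V := PiLp 2 fun _ : Fin m => F)
      (fun i => if i.val < Module.finrank ℝ F - 1 then 1 else 0) lineForm where
  smooth := h.contDiff_lineForm
  smul_left x a u v := by rw [h.lineForm_eq, h.lineForm_eq, map_smul, real_inner_smul_left]
  add_left x u u' v := by
    rw [h.lineForm_eq, h.lineForm_eq, h.lineForm_eq, map_add, inner_add_left]
  symm x u v := by rw [h.lineForm_eq, h.lineOp_symm, real_inner_comm, ← h.lineForm_eq]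
  radial x v := h.lineForm₂_self_right x x v
  fderiv_radial x v w := by rw [h.fderiv_lineForm, two_mul, lineForm]
  fderiv_closed x X Y _ _ := by
    rw [h.fderiv_lineForm, h.fderiv_lineForm, h.lineForm₂_self_right, h.lineForm₂_self_left,
      lineForm₂_comm x X x Y, real_inner_comm, add_comm]
  fderiv_self x X hX := by
    rw [h.fderiv_lineForm, h.lineForm₂_self_right, h.lineForm₂_self_left, real_inner_comm, hX]
    simp
  inner_sq_le := h.inner_sq_le_lineForm ht
  exists_basis x hx := h.exists_basis_lineForm ht rfl hx

end IsHurwitz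

end LineForm

/-! ### The four algebras -/

theorem isHurwitz_real : IsHurwitz ℝ where
  mul_add := mul_add
  add_mul := add_mul
  smul_mul := smul_mul_assoc
  mul_smul t a b := mul_smul_comm t a b
  star_add := star_add
  star_smul t a := by simp
  star_star := star_star
  star_mul := star_mul
  inner_star a b := by simp
  inner_mul a u v := by simp [mul_comm, mul_left_comm]
  mul_star_mul a u := by
    rw [star_trivial, ← mul_assoc, ← sq, Real.norm_eq_abs, sq_abs, smul_eq_mul]
  mul_star_mul' a u := by
    rw [star_trivial, ← sq, Real.norm_eq_abs, sq_abs, smul_eq_mul]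

theorem isHurwitz_complex : IsHurwitz ℂ where
  mul_add := mul_add
  add_mul := add_mul
  smul_mul := smul_mul_assoc
  mul_smul t a b := mul_smul_comm t a b
  star_add := star_add
  star_smul t a := by simp
  star_star := star_star
  star_mul := star_mul
  inner_star a b := by simp [Complex.inner]
  inner_mul a u v := by simp [Complex.inner]; ring
  mul_star_mul a u := by
    rw [← mul_assoc, Complex.star_def, Complex.mul_conj, Complex.normSq_eq_norm_sq, Complex.real_smul]
  mul_star_mul' a u := by
    rw [Complex.star_def, Complex.mul_conj, Complex.normSq_eq_norm_sq, Complex.real_smul]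

theorem isHurwitz_quaternion : IsHurwitz ℍ[ℝ] where
  mul_add := mul_add
  add_mul := add_mul
  smul_mul := smul_mul_assoc
  mul_smul t a b := mul_smul_comm t a b
  star_add := star_add
  star_smul t a := by simp
  star_star := star_star
  star_mul := star_mul
  inner_star a b := by simp [Quaternion.inner_def]
  inner_mul a u v := by simp [Quaternion.inner_def]; ring
  mul_star_mul a u := by
    rw [← mul_assoc, Quaternion.self_mul_star, Quaternion.normSq_eq_norm_mul_self, ← sq,
      Quaternion.coe_mul_eq_smul]
  mul_star_mul' a u := by
    rw [Quaternion.self_mul_star, Quaternion.normSq_eq_norm_mul_self, ← sq,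
      Quaternion.coe_mul_eq_smul]

namespace Octonion

/-- The first quaternion component. -/
def re (x : Octonion) : ℍ[ℝ] := WithLp.fst x

/-- The second quaternion component. -/
def im (x : Octonion) : ℍ[ℝ] := WithLp.snd x

theorem ext_components {x y : Octonion} (h1 : x.re = y.re) (h2 : x.im = y.im) : x = y :=
  (WithLp.equiv 2 (ℍ[ℝ] × ℍ[ℝ])).injective (Prod.ext h1 h2)

theorem re_add (x y : Octonion) : (x + y).re = x.re + y.re := rfl
theorem im_add (x y : Octonion) : (x + y).im = x.im + y.im := rfl
theorem re_smul (t : ℝ) (x : Octonion) : (t • x).re = t • x.re := rfl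
theorem im_smul (t : ℝ) (x : Octonion) : (t • x).im = t • x.im := rfl
theorem re_mul (x y : Octonion) : (x * y).re = x.re * y.re - star y.im * x.im := rfl
theorem im_mul (x y : Octonion) : (x * y).im = y.im * x.re + x.im * star y.re := rfl
theorem re_star (x : Octonion) : (star x).re = star x.re := rfl
theorem im_star (x : Octonion) : (star x).im = -x.im := rfl

theorem inner_eq (x y : Octonion) : ⟪x, y⟫ = ⟪x.re, y.re⟫ + ⟪x.im, y.im⟫ :=
  WithLp.prod_inner_apply (𝕜 := ℝ) (E := ℍ[ℝ]) (F := ℍ[ℝ]) x y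

theorem norm_sq_eq (x : Octonion) : ‖x‖ ^ 2 = ‖x.re‖ ^ 2 + ‖x.im‖ ^ 2 := by
  rw [← real_inner_self_eq_norm_sq, inner_eq, real_inner_self_eq_norm_sq,
    real_inner_self_eq_norm_sq]

end Octonion

open Octonion in
theorem isHurwitz_octonion : IsHurwitz Octonion := by
  have h := isHurwitz_quaternion
  have hs : ∀ a : ℍ[ℝ], a * star a = (‖a‖ ^ 2 : ℝ) := fun a => by
    rw [Quaternion.self_mul_star, Quaternion.normSq_eq_norm_mul_self, sq]
  have hs' : ∀ a : ℍ[ℝ], star a * a = (‖a‖ ^ 2 : ℝ) := fun a => by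
    rw [Quaternion.star_mul_self, Quaternion.normSq_eq_norm_mul_self, sq]
  constructor
  · intro a b c
    refine ext_components ?_ ?_
    · simp only [re_add, im_add, re_mul, star_add]; noncomm_ring
    · simp only [re_add, im_add, im_mul, star_add]; noncomm_ring
  · intro a b c
    refine ext_components ?_ ?_
    · simp only [re_add, im_add, re_mul]; noncomm_ring
    · simp only [re_add, im_add, im_mul]; noncomm_ring
  · intro t a b
    refine ext_components ?_ ?_
    · simp only [re_smul, im_smul, re_mul, smul_mul_assoc, mul_smul_comm, smul_sub]
    · simp only [re_smul, im_smul, im_mul, smul_mul_assoc, mul_smul_comm, smul_add]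
  · intro t a b
    refine ext_components ?_ ?_
    · simp only [re_smul, im_smul, re_mul, h.star_smul, smul_mul_assoc, mul_smul_comm, smul_sub]
    · simp only [re_smul, im_smul, im_mul, h.star_smul, smul_mul_assoc, mul_smul_comm, smul_add]
  · intro a b
    refine ext_components ?_ ?_
    · simp only [re_star, re_add, star_add]
    · simp only [im_star, im_add, neg_add]
  · intro t a
    refine ext_components ?_ ?_
    · simp only [re_star, re_smul, h.star_smul]
    · simp only [im_star, im_smul, smul_neg]
  · intro a
    refine ext_components ?_ ?_
    · simp only [re_star, star_star]
    · simp only [im_star, neg_neg]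
  · intro a b
    refine ext_components ?_ ?_
    · simp only [re_star, im_star, re_mul, star_sub, star_mul, star_star, star_neg]; noncomm_ring
    · simp only [re_star, im_star, im_mul, star_star]; noncomm_ring
  · intro a b
    simp only [inner_eq, re_star, im_star, h.inner_star, inner_neg_neg]
  · intro a u v
    simp only [inner_eq, re_mul, im_mul, re_star, im_star, inner_add_left, inner_sub_left,
      inner_add_right, star_star, star_neg, inner_neg_right, neg_mul,
      sub_neg_eq_add, h.inner_mul]
    have e1 : ⟪star u.im * a.im, v.re⟫ = ⟪a.im, u.im * v.re⟫ := by
      rw [h.inner_mul_left, star_star]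
    have e2 : ⟪u.im * a.re, v.im⟫ = ⟪a.re, star u.im * v.im⟫ := h.inner_mul_left _ _ _
    simp only [h.inner_mul] at e1 e2
    linarith
  · intro a u
    refine ext_components ?_ ?_
    · simp only [re_mul, im_mul, re_star, im_star, re_smul, star_add, star_mul, star_star, star_neg]
      trans (a.re * star a.re) * u.re + u.re * (star a.im * a.im)
      · noncomm_ring
      · rw [hs, hs', ← Quaternion.coe_commutes, ← add_mul, ← Quaternion.coe_add,
          Quaternion.coe_mul_eq_smul, norm_sq_eq]
    · simp only [re_mul, im_mul, re_star, im_star, im_smul, star_sub, star_mul, star_star, star_neg]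
      trans u.im * (star a.re * a.re) + (a.im * star a.im) * u.im
      · noncomm_ring
      · rw [hs, hs', ← Quaternion.coe_commutes, ← add_mul, ← Quaternion.coe_add,
          Quaternion.coe_mul_eq_smul, norm_sq_eq]
  · intro a u
    have h1 : (a * star a).re = (‖a‖ ^ 2 : ℝ) := by
      rw [re_mul, re_star, im_star, star_neg, neg_mul, sub_neg_eq_add, hs, hs', norm_sq_eq,
        Quaternion.coe_add]
    have h2 : (a * star a).im = 0 := by
      rw [im_mul, re_star, im_star, star_star, neg_mul, neg_add_cancel]
    refine ext_components ?_ ?_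
    · rw [re_mul, h1, h2, mul_zero, sub_zero, Quaternion.coe_mul_eq_smul, re_smul]
    · rw [im_mul, h1, h2, zero_mul, add_zero, Quaternion.mul_coe_eq_smul, im_smul]

namespace HypAlg

theorem isHurwitz : (A : HypAlg) → IsHurwitz A.Carrier
  | real => isHurwitz_real
  | complex => isHurwitz_complex
  | quaternion => isHurwitz_quaternion
  | octonion => isHurwitz_octonion

theorem isTriple {m : ℕ} : (A : HypAlg) → (A = octonion → m = 2) → IsHurwitz.IsTriple A.Carrier m
  | real, _ => isHurwitz_real.isTriple_of_assoc mul_assoc m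
  | complex, _ => isHurwitz_complex.isTriple_of_assoc mul_assoc m
  | quaternion, _ => isHurwitz_quaternion.isTriple_of_assoc mul_assoc m
  | octonion, hm => by
    obtain rfl := hm rfl
    exact isHurwitz_octonion.isTriple_two

instance : FiniteDimensional ℝ Octonion :=
  inferInstanceAs (FiniteDimensional ℝ (WithLp 2 (ℍ[ℝ] × ℍ[ℝ])))

instance : (A : HypAlg) → FiniteDimensional ℝ A.Carrier
  | real => inferInstanceAs (FiniteDimensional ℝ ℝ)
  | complex => inferInstanceAs (FiniteDimensional ℝ ℂ)
  | quaternion => inferInstanceAs (FiniteDimensional ℝ ℍ[ℝ])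
  | octonion => inferInstanceAs (FiniteDimensional ℝ Octonion)

theorem finrank_octonion : Module.finrank ℝ Octonion = 8 := by
  have h : Module.finrank ℝ (WithLp 2 (ℍ[ℝ] × ℍ[ℝ])) = 8 := by
    rw [(WithLp.linearEquiv 2 ℝ (ℍ[ℝ] × ℍ[ℝ])).finrank_eq, Module.finrank_prod,
      Quaternion.finrank_eq_four]
  exact h

theorem finrank_carrier : (A : HypAlg) → Module.finrank ℝ A.Carrier = A.dim
  | real => Module.finrank_self ℝ
  | complex => Complex.finrank_real_complex
  | quaternion => Quaternion.finrank_eq_four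
  | octonion => finrank_octonion

theorem finrank_fSpace (A : HypAlg) (m : ℕ) : Module.finrank ℝ (FSpace A m) = m * A.dim := by
  rw [(WithLp.linearEquiv 2 ℝ (Fin m → A.Carrier)).finrank_eq, Module.finrank_pi_fintype]
  simp [finrank_carrier]

/-- The square root of the scale of the metric. -/
noncomputable def sqrtScale : HypAlg → ℝ
  | real => 1
  | _ => 2

theorem sqrtScale_pos (A : HypAlg) : 0 < A.sqrtScale := by
  cases A <;> simp [sqrtScale]

theorem hypMetric_eq (A : HypAlg) (m : ℕ) : hypMetric A m = ballMetric A.sqrtScale lineForm := by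
  funext z u v
  have : A.scale = A.sqrtScale ^ 2 := by cases A <;> norm_num [scale, sqrtScale]
  rw [hypMetric, ballMetric, this]
  rfl

end HypAlg

/-! ### Rotational hypersurfaces of constant mean curvature -/

namespace HypAlg

/-- The exponents of the principal curvatures of the spheres of the hyperbolic space over `A`. -/
noncomputable def exponents (A : HypAlg) (m : ℕ) (i : Fin (Module.finrank ℝ (FSpace A m) - 1)) : ℝ :=
  if i.val < Module.finrank ℝ A.Carrier - 1 then 1 else 0

theorem exponents_eq (A : HypAlg) (m : ℕ) (i : Fin (Module.finrank ℝ (FSpace A m) - 1)) :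
    A.exponents m i = 0 ∨ A.exponents m i = 1 := by
  rw [exponents]
  split_ifs <;> simp

theorem isLineForm (A : HypAlg) {m : ℕ} (hm : A = octonion → m = 2) :
    IsLineForm (A.exponents m) (lineForm : FSpace A m → FSpace A m → FSpace A m → ℝ) :=
  A.isHurwitz.isLineForm (A.isTriple hm)

variable {A : HypAlg} {m : ℕ}

theorem isSphereMeanCurv_sphereMeanCurv [Nontrivial (FSpace A m)] (hm : A = octonion → m = 2) (k : ℕ)
    {s : ℝ} (hs : 0 < s) :
    IsSphereMeanCurv (hypMetric A m) (hypBall A m) 0 k s (sphereMeanCurv A m k s) := by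
  refine Classical.epsilon_spec
    (p := fun h => IsSphereMeanCurv (hypMetric A m) (hypBall A m) 0 k s h) ?_
  rw [hypMetric_eq]
  exact ⟨_, (A.isLineForm hm).isSphereMeanCurv A.sqrtScale_pos (A.exponents_eq m) hs k⟩

theorem abs_sphereMeanCurv [Nontrivial (FSpace A m)] (hm : A = octonion → m = 2) (k : ℕ) {s : ℝ}
    (hs : 0 < s) :
    |sphereMeanCurv A m k s| = radialEsymm A.sqrtScale (A.exponents m) k s := by
  have h := isSphereMeanCurv_sphereMeanCurv hm k hs
  rw [hypMetric_eq] at h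
  rw [(A.isLineForm hm).sphereMeanCurv_unique A.sqrtScale_pos (A.exponents_eq m) hs h, abs_mul,
    abs_pow, abs_neg, abs_one, one_pow, one_mul,
    abs_of_nonneg (radialEsymm_nonneg A.sqrtScale_pos (A.exponents_eq m) k hs)]

theorem tendsto_abs_sphereMeanCurv [Nontrivial (FSpace A m)] (hm : A = octonion → m = 2) (r : ℕ) :
    Tendsto (fun s : ℝ => |sphereMeanCurv A m r s|) atTop
      (𝓝 (esymmFn r fun i => (1 + A.exponents m i) / A.sqrtScale)) :=
  (radialEsymm_tendsto A.sqrtScale_pos r).congr' <| by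
    filter_upwards [eventually_gt_atTop 0] with s hs using (abs_sphereMeanCurv hm r hs).symm

/-- The condition on the slope of `τ` says that the sphere of radius `l` has mean curvature larger
than `H`. -/
theorem isNeckRadius_iff [Nontrivial (FSpace A m)] (hm : A = octonion → m = 2) {r : ℕ}
    (hr : 1 ≤ r) (hrn : r ≤ Module.finrank ℝ (FSpace A m) - 1) {H l : ℝ} :
    IsNeckRadius A m r H l ↔ 0 < l ∧ H < radialEsymm A.sqrtScale (A.exponents m) r l := by
  have hpair := isCurvaturePair_radialEsymm A.sqrtScale_pos (A.exponents_eq m) hr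
    (by simpa using hrn)
  have hode : ∀ τ : ℝ → ℝ,
      (∀ s, 0 < s → HasDerivAt τ (coeffA A m r s * τ s + coeffB A m r H s) s) ∧ τ l = 1 ↔
      IsTau (radialEsymm A.sqrtScale (A.exponents m) r)
        (radialEsymm A.sqrtScale (A.exponents m) (r - 1)) r H l τ := by
    have hco : ∀ (τ : ℝ → ℝ) (s : ℝ), 0 < s → coeffA A m r s * τ s + coeffB A m r H s =
        -(r * radialEsymm A.sqrtScale (A.exponents m) r s /
          radialEsymm A.sqrtScale (A.exponents m) (r - 1) s) * τ s +
          r * H / radialEsymm A.sqrtScale (A.exponents m) (r - 1) s := fun τ s hs => by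
      rw [coeffA, coeffB, abs_sphereMeanCurv hm r hs, abs_sphereMeanCurv hm (r - 1) hs]
    refine fun τ => ⟨fun h => ⟨fun s hs => ?_, h.2⟩, fun h => ⟨fun s hs => ?_, h.init⟩⟩
    · rw [← hco τ s hs]
      exact h.1 s hs
    · rw [hco τ s hs]
      exact h.ode s hs
  have hsign : 0 < l → ∀ τ, IsTau (radialEsymm A.sqrtScale (A.exponents m) r)
      (radialEsymm A.sqrtScale (A.exponents m) (r - 1)) r H l τ →
      (deriv τ l < 0 ↔ H < radialEsymm A.sqrtScale (A.exponents m) r l) := by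
    intro hl τ hτ
    have hp : 0 < (r : ℝ) / radialEsymm A.sqrtScale (A.exponents m) (r - 1) l :=
      div_pos (by exact_mod_cast hr) (hpair.pos₀ l hl)
    rw [hτ.deriv_eq hl hτ.init, ← sub_neg (a := H)]
    exact ⟨fun h => by nlinarith, fun h => mul_neg_of_pos_of_neg hp h⟩
  constructor
  · rintro ⟨hl, τ, h1, h2, h3⟩
    exact ⟨hl, (hsign hl τ ((hode τ).1 ⟨h1, h2⟩)).1 h3⟩
  · rintro ⟨hl, h⟩
    obtain ⟨τ, hτ⟩ := hpair.exists_tau r H hl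
    exact ⟨hl, τ, ((hode τ).2 hτ).1, hτ.init, (hsign hl τ hτ).2 h⟩

theorem neckBound_pos [Nontrivial (FSpace A m)] (hm : A = octonion → m = 2) {r : ℕ}
    (hr : 1 ≤ r) (hrn : r ≤ Module.finrank ℝ (FSpace A m) - 1) {H : ℝ} (hH : 0 < H) :
    0 < neckBound A m r H := by
  obtain ⟨s, hs, hHs⟩ := exists_lt_radialEsymm A.sqrtScale_pos (A.exponents_eq m) hr
    (by simpa using hrn) hH
  exact lt_of_lt_of_le (EReal.coe_pos.2 hs)
    (le_sSup ⟨s, (isNeckRadius_iff hm hr hrn).2 ⟨hs, hHs⟩, rfl⟩)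

/-- The neck radii form an open interval because `|H_r^s|` is continuous and decreasing in `s`. -/
theorem lt_neckBound_iff [Nontrivial (FSpace A m)] (hm : A = octonion → m = 2) {r : ℕ}
    (hr : 1 ≤ r) (hrn : r ≤ Module.finrank ℝ (FSpace A m) - 1) {H l : ℝ} (hl : 0 < l) :
    (l : EReal) < neckBound A m r H ↔ IsNeckRadius A m r H l := by
  have hpair := isCurvaturePair_radialEsymm A.sqrtScale_pos (A.exponents_eq m) hr
    (by simpa using hrn)
  rw [neckBound, lt_sSup_iff]
  constructor
  · rintro ⟨_, ⟨l', hl', rfl⟩, hll'⟩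
    rw [mem_ofPred_eq, isNeckRadius_iff hm hr hrn] at hl'
    exact (isNeckRadius_iff hm hr hrn).2
      ⟨hl, hl'.2.trans (hpair.anti₁ hl hl'.1 (EReal.coe_lt_coe_iff.1 hll'))⟩
  · intro h
    rw [isNeckRadius_iff hm hr hrn] at h
    have hc : ContinuousAt (radialEsymm A.sqrtScale (A.exponents m) r) l :=
      hpair.smooth₁.continuousOn.continuousAt (Ioi_mem_nhds hl)
    have hev : ∀ᶠ s in 𝓝[>] l, H < radialEsymm A.sqrtScale (A.exponents m) r s :=
      (hc.eventually (lt_mem_nhds h.2)).filter_mono nhdsWithin_le_nhds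
    obtain ⟨l', h1, h2⟩ := (hev.and self_mem_nhdsWithin).exists
    exact ⟨_, ⟨l', (isNeckRadius_iff hm hr hrn).2 ⟨hl.trans h2, h1⟩, rfl⟩,
      EReal.coe_lt_coe_iff.2 h2⟩

end HypAlg

theorem mainTheorem3 (𝔽 : HypAlg) (m : ℕ) (hm : 𝔽 = HypAlg.octonion → m = 2)
    (r : ℕ) (hr : 1 ≤ r) (hrn : r + 1 ≤ m * 𝔽.dim) (H : ℝ) (hH : 0 < H) :
    -- the quantities `H_k^s`, `C_𝔽(r)` and `δ_H` are well defined
    (∀ (k : ℕ) (s : ℝ), 0 < s →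
      IsSphereMeanCurv (hypMetric 𝔽 m) (hypBall 𝔽 m) 0 k s (sphereMeanCurv 𝔽 m k s)) ∧
    Tendsto (fun s : ℝ => |sphereMeanCurv 𝔽 m r s|) atTop (𝓝 (limitMeanCurv 𝔽 m r)) ∧
    0 < neckBound 𝔽 m r H ∧
    (∀ l : ℝ, 0 < l → ((l : EReal) < neckBound 𝔽 m r H ↔ IsNeckRadius 𝔽 m r H l)) ∧
    -- the family of annuli
    ∃ S : ℝ → Set (FSpace 𝔽 m × ℝ), ∀ l : ℝ, 0 < l → (l : EReal) < neckBound 𝔽 m r H →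
      IsProperlyEmbedded (hypBall 𝔽 m ×ˢ univ) (S l) ∧
      IsRotational (hypMetric 𝔽 m) (hypBall 𝔽 m) 0 (S l) ∧
      IsHrHypersurface (prodMetric (hypMetric 𝔽 m)) (S l) r H ∧
      Nonempty (S l ≃ₜ
        (Metric.sphere (0 : EuclideanSpace ℝ (Fin (m * 𝔽.dim))) 1 × ℝ)) ∧
      -- the distance to the axis has minimum `l`, attained along `S_l(0) × {0}`
      (∀ x t, (x, t) ∈ S l → l ≤ riemDist (hypMetric 𝔽 m) (hypBall 𝔽 m) 0 x) ∧
      (∀ x ∈ geodesicSphere (hypMetric 𝔽 m) (hypBall 𝔽 m) 0 l, (x, (0 : ℝ)) ∈ S l) ∧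
      -- the two cases
      (limitMeanCurv 𝔽 m r < H →
        IsDelaunayType (hypMetric 𝔽 m) (hypBall 𝔽 m) 0 l (S l)) ∧
      (H ≤ limitMeanCurv 𝔽 m r →
        IsSymmetricZero (S l) ∧ ¬ BddAbove (Prod.snd '' S l)) := by
  have hfin := HypAlg.finrank_fSpace 𝔽 m
  have : Nontrivial (FSpace 𝔽 m) := Module.nontrivial_of_finrank_pos (R := ℝ) (by omega)
  have hrn' : r ≤ Module.finrank ℝ (FSpace 𝔽 m) - 1 := by omega
  have hκ := 𝔽.sqrtScale_pos
  have hβ := 𝔽.exponents_eq m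
  have hQ := 𝔽.isLineForm hm
  have hlim : limitMeanCurv 𝔽 m r = esymmFn r fun i => (1 + 𝔽.exponents m i) / 𝔽.sqrtScale :=
    (HypAlg.tendsto_abs_sphereMeanCurv hm r).limUnder_eq
  have hpair := isCurvaturePair_radialEsymm hκ hβ hr (by simpa using hrn')
  refine ⟨fun k s hs => HypAlg.isSphereMeanCurv_sphereMeanCurv hm k hs,
    hlim ▸ HypAlg.tendsto_abs_sphereMeanCurv hm r, HypAlg.neckBound_pos hm hr hrn' hH,
    fun l hl => HypAlg.lt_neckBound_iff hm hr hrn' hl, ?_⟩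
  have hprofile : ∀ l : ℝ, ∃ σ : ℝ → ℝ, 0 < l → (l : EReal) < neckBound 𝔽 m r H →
      (ContDiff ℝ ∞ σ ∧ (∀ t, l ≤ σ t) ∧ σ 0 = l ∧ Function.Even σ ∧
        ∀ t, H = tubeAngle σ t ^ r * radialEsymm 𝔽.sqrtScale (𝔽.exponents m) r (σ t) +
          -(deriv (deriv σ) t * tubeAngle σ t ^ 3) *
            (tubeAngle σ t ^ (r - 1) *
              radialEsymm 𝔽.sqrtScale (𝔽.exponents m) (r - 1) (σ t))) ∧
      (limitMeanCurv 𝔽 m r < H → ∃ T, IsUnduloidProfile σ T) := by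
    intro l
    by_cases h : 0 < l ∧ (l : EReal) < neckBound 𝔽 m r H
    · rw [hlim]
      obtain ⟨σ, hσ⟩ := exists_profile hpair hr hH h.1
        ((HypAlg.isNeckRadius_iff hm hr hrn').1 ((HypAlg.lt_neckBound_iff hm hr hrn' h.1).1 h.2)).2
      exact ⟨σ, fun _ _ => hσ⟩
    · exact ⟨0, fun h1 h2 => absurd ⟨h1, h2⟩ h⟩
  choose σ hσ using hprofile
  refine ⟨fun l => tube (FSpace 𝔽 m) 𝔽.sqrtScale (σ l), fun l hl hlb => ?_⟩
  obtain ⟨⟨hsm, hge, h0, heven, hcurv⟩, hund⟩ := hσ l hl hlb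
  have hpos : ∀ t, 0 < σ l t := fun t => hl.trans_le (hge t)
  rw [HypAlg.hypMetric_eq]
  refine ⟨isProperlyEmbedded_tube hκ hsm hpos, hQ.isRotational_tube hκ hpos,
    hQ.isHrHypersurface_tube hκ hβ hsm hpos hr hcurv,
    nonempty_homeomorph_tube ((stdOrthonormalBasis ℝ (FSpace 𝔽 m)).reindex (finCongr hfin)).repr
      hκ hsm hpos, fun x t hx => ?_, fun x hx => ?_, fun hC => ?_, fun _ => ⟨fun x t => ?_, ?_⟩⟩
  · have hx' : ‖x‖ = _ := hx
    rw [hypBall, hQ.riemDist_zero hκ (tube_norm_lt hx), hx', Real.artanh_tanh,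
      mul_div_cancel₀ _ hκ.ne']
    exact hge t
  · change ‖x‖ = Real.tanh (σ l 0 / 𝔽.sqrtScale)
    rw [h0]
    exact ((hQ.mem_geodesicSphere hκ).1 hx).2
  · obtain ⟨T, hT⟩ := hund hC
    exact hQ.isDelaunayType_tube hκ hT h0
  · simp only [tube, mem_ofPred_eq, heven t]
  · have hsurj : Prod.snd '' tube (FSpace 𝔽 m) 𝔽.sqrtScale (σ l) = univ := by
      refine eq_univ_of_forall fun t => ?_
      obtain ⟨x, hx⟩ := exists_norm_eq (FSpace 𝔽 m)
        (tanh_pos_of_pos (div_pos (hpos t) hκ)).le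
      exact ⟨(x, t), hx, rfl⟩
    rw [hsurj]
    exact not_bddAbove_univ
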